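/- Conventions. Let $K$ be the algebra of compact operators on $\ell^2(\mathbb{N})$. For a C*-algebra $A$ and positive elements $a,b$ of $A \otimes K$ (or of $A$), write $a \precsim_A b$ if there is a sequence $(v_n)$ in $A \otimes K$ (respectively in $A$) with $v_n b v_n^* \to a$. The Cuntz semigroup is $\mathrm{Cu}(A) = (A \otimes K)_+ / {\sim_A}$, where $a \sim_A b$ means $a \precsim_A b$ and $b \precsim_A a$, with addition induced by the direct sum and order induced by $\precsim_A$. In an ordered semigroup $S$ write $\xi' \ll \xi$ if for every increasing sequence $(\xi_n)$ in $S$ that has a supremum with $\xi \leq \sup_n \xi_n$ there is $n$ with $\xi' \leq \xi_n$. For an integer $m \geq 0$, a C*-algebra $A$ is called $m$-almost divisible if for all $\xi', \xi \in \mathrm{Cu}(A)$ with $\xi' \ll \xi$ and every integer $N \geq 1$ there is $\eta \in \mathrm{Cu}(A)$ with $N \eta \leq \xi$ and $\xi' \leq (N+1)(m+1)\eta$. A C*-subalgebra $B$ of a unital C*-algebra $A$, containing the unit of $A$, is called large if for all $n \geq 1$, $a_1, \ldots, a_n \in A$, $\varepsilon > 0$, $x \in A_+$ with $\|x\| = 1$,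 and $y \in B_+ \setminus \{0\}$ there are $c_1, \ldots, c_n \in A$ and $g \in B$ such that $0 \leq g \leq 1$, $\|c_j - a_j\| < \varepsilon$ and $(1-g)c_j \in B$ for all $j$, $g \precsim_B y$, $g \precsim_A x$, and $\|(1-g)x(1-g)\| > 1 - \varepsilon$. A unital C*-algebra $A$ is stably finite if every isometry in every $M_n(A)$ is unitary. Proposition. Let $A$ be an infinite dimensional simple stably finite unital C*-algebra, let $B \subseteq A$ be a large subalgebra, and let $m \geq 0$ be an integer. (1) If $B$ is $m$-almost divisible, then $A$ is $(2m+1)$-almost divisible. (2) If $A$ is $m$-almost divisible, then $B$ is $(4m+3)$-almost divisible. -/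

import Mathlib

noncomputable section

open Filter Topology

namespace CuntzSemigroup

section FiniteMatrices

attribute [local instance] CStarAlgebra.spectralOrder CStarAlgebra.spectralOrderedRing

variable {A : Type*} [NonUnitalCStarAlgebra A]

/-- For injective `f` and `g`, the matrix over `κ` whose `(f i, g j)` entry is `M i j` and whose other entries vanish. -/
def spread {ι κ : Type*} (f g : ι → κ) (M : CStarMatrix ι ι A) : CStarMatrix κ κ A :=
  CStarMatrix.ofMatrix fun a b =>
    Function.extend (Prod.map f g) (fun p => M p.1 p.2) 0 (a, b)

section Spread

variable {ι κ μ : Type*} {f g h k : ι → κ}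

lemma spread_apply (hf : f.Injective) (hg : g.Injective) (M : CStarMatrix ι ι A) (i j : ι) :
    spread f g M (f i) (g j) = M i j :=
  (hf.prodMap hg).extend_apply (fun p => M p.1 p.2) 0 (i, j)

lemma spread_apply_left (M : CStarMatrix ι ι A) {a : κ} (b : κ) (ha : a ∉ Set.range f) :
    spread f g M a b = 0 :=
  Function.extend_apply' (f := Prod.map f g) (fun p => M p.1 p.2) 0 (a, b)
    fun ⟨p, hp⟩ => ha ⟨p.1, congrArg Prod.fst hp⟩

lemma spread_apply_right (M : CStarMatrix ι ι A) (a : κ) {b : κ} (hb : b ∉ Set.range g) :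
    spread f g M a b = 0 :=
  Function.extend_apply' (f := Prod.map f g) (fun p => M p.1 p.2) 0 (a, b)
    fun ⟨p, hp⟩ => hb ⟨p.2, congrArg Prod.snd hp⟩

/-- Two matrices agree with a spread matrix as soon as the entries do. -/
lemma eq_spread (hf : f.Injective) (hg : g.Injective) {M : CStarMatrix ι ι A}
    {N : CStarMatrix κ κ A} (h1 : ∀ i j, N (f i) (g j) = M i j)
    (h2 : ∀ a b, a ∉ Set.range f → N a b = 0) (h3 : ∀ a b, b ∉ Set.range g → N a b = 0) :
    N = spread f g M := by
  ext a b
  by_cases ha : a ∈ Set.range f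
  · by_cases hb : b ∈ Set.range g
    · obtain ⟨i, rfl⟩ := ha
      obtain ⟨j, rfl⟩ := hb
      rw [h1, spread_apply hf hg]
    · rw [h3 _ _ hb, spread_apply_right _ _ hb]
  · rw [h2 _ _ ha, spread_apply_left _ _ ha]

lemma spread_add (hf : f.Injective) (hg : g.Injective) (M N : CStarMatrix ι ι A) :
    spread f g (M + N) = spread f g M + spread f g N := by
  symm
  apply eq_spread hf hg
  · intro i j; simp [spread_apply hf hg]
  · intro a b ha; simp [spread_apply_left _ _ ha]
  · intro a b hb; simp [spread_apply_right _ _ hb]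

lemma spread_smul (hf : f.Injective) (hg : g.Injective) (c : ℂ) (M : CStarMatrix ι ι A) :
    spread f g (c • M) = c • spread f g M := by
  symm
  apply eq_spread hf hg
  · intro i j; simp [spread_apply hf hg]
  · intro a b ha; simp [spread_apply_left _ _ ha]
  · intro a b hb; simp [spread_apply_right _ _ hb]

lemma star_spread (hf : f.Injective) (hg : g.Injective) (M : CStarMatrix ι ι A) :
    star (spread f g M) = spread g f (star M) := by
  apply eq_spread hg hf
  · intro i j; simp [CStarMatrix.star_apply, spread_apply hf hg]
  · intro a b ha; simp [CStarMatrix.star_apply, spread_apply_right _ _ ha]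
  · intro a b hb; simp [CStarMatrix.star_apply, spread_apply_left _ _ hb]

lemma spread_spread (hf : f.Injective) (hg : g.Injective) {f' g' : κ → μ} (hf' : f'.Injective)
    (hg' : g'.Injective) (M : CStarMatrix ι ι A) :
    spread f' g' (spread f g M) = spread (f' ∘ f) (g' ∘ g) M := by
  apply eq_spread (hf'.comp hf) (hg'.comp hg)
  · intro i j; simp [spread_apply hf hg, spread_apply hf' hg']
  · intro a b ha
    by_cases ha' : a ∈ Set.range f'
    · obtain ⟨a, rfl⟩ := ha'
      have : a ∉ Set.range f := fun ⟨i, hi⟩ => ha ⟨i, by simp [hi]⟩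
      by_cases hb' : b ∈ Set.range g'
      · obtain ⟨b, rfl⟩ := hb'
        rw [spread_apply hf' hg', spread_apply_left _ _ this]
      · exact spread_apply_right _ _ hb'
    · exact spread_apply_left _ _ ha'
  · intro a b hb
    by_cases hb' : b ∈ Set.range g'
    · obtain ⟨b, rfl⟩ := hb'
      have : b ∉ Set.range g := fun ⟨i, hi⟩ => hb ⟨i, by simp [hi]⟩
      by_cases ha' : a ∈ Set.range f'
      · obtain ⟨a, rfl⟩ := ha'
        rw [spread_apply hf' hg', spread_apply_right _ _ this]
      · exact spread_apply_left _ _ ha'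
    · exact spread_apply_right _ _ hb'

variable [Fintype ι] [Fintype κ]

lemma spread_mul (hf : f.Injective) (hg : g.Injective) (hh : h.Injective)
    (M N : CStarMatrix ι ι A) :
    spread f g M * spread g h N = spread f h (M * N) := by
  apply eq_spread hf hh
  · intro i j
    rw [CStarMatrix.mul_apply, CStarMatrix.mul_apply]
    symm
    apply Fintype.sum_of_injective g hg
    · intro a ha
      rw [spread_apply_right _ _ ha, zero_mul]
    · intro l
      rw [spread_apply hf hg, spread_apply hg hh]
  · intro a b ha
    rw [CStarMatrix.mul_apply]
    exact Finset.sum_eq_zero fun l _ => by rw [spread_apply_left _ _ ha, zero_mul]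
  · intro a b hb
    rw [CStarMatrix.mul_apply]
    exact Finset.sum_eq_zero fun l _ => by rw [spread_apply_right _ _ hb, mul_zero]

lemma spread_mul_disjoint (hgh : ∀ i j, g i ≠ h j) (M N : CStarMatrix ι ι A) :
    spread f g M * spread h k N = 0 := by
  ext a b
  rw [CStarMatrix.mul_apply]
  refine Finset.sum_eq_zero fun l _ => ?_
  by_cases hl : l ∈ Set.range g
  · obtain ⟨i, rfl⟩ := hl
    rw [spread_apply_left (f := h) _ _ (fun ⟨j, hj⟩ => hgh i j hj.symm), mul_zero]
  · rw [spread_apply_right _ _ hl, zero_mul]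

/-- Spreading along one injection, as a homomorphism. -/
def spreadHom (f : ι → κ) (hf : f.Injective) :
    CStarMatrix ι ι A →⋆ₙₐ[ℂ] CStarMatrix κ κ A where
  toFun := spread f f
  map_smul' := spread_smul hf hf
  map_zero' := by simpa using spread_smul hf hf 0 (0 : CStarMatrix ι ι A)
  map_add' := spread_add hf hf
  map_mul' M N := (spread_mul hf hf hf M N).symm
  map_star' M := (star_spread hf hf M).symm

lemma spreadHom_injective (hf : f.Injective) :
    Function.Injective (spreadHom (A := A) f hf) := fun M N hMN => by
  ext i j
  rw [← spread_apply hf hf M, ← spread_apply hf hf N]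
  exact congrFun (congrFun hMN _) _

lemma norm_spread_same (hf : f.Injective) (M : CStarMatrix ι ι A) :
    ‖spread f f M‖ = ‖M‖ :=
  NonUnitalStarAlgHom.norm_map (spreadHom f hf) (spreadHom_injective hf) M

lemma norm_spread (hf : f.Injective) (hg : g.Injective) (M : CStarMatrix ι ι A) :
    ‖spread f g M‖ = ‖M‖ := by
  have := CStarRing.norm_star_mul_self (x := spread f g M)
  rw [star_spread hf hg, spread_mul hg hf hg, norm_spread_same hg, CStarRing.norm_star_mul_self] at this
  nlinarith [norm_nonneg M, norm_nonneg (spread f g M)]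

end Spread

/-- The upper left corner embedding. -/
def corner (A : Type*) [NonUnitalCStarAlgebra A] (m n : ℕ) (h : m ≤ n) :
    CStarMatrix (Fin m) (Fin m) A →⋆ₙₐ[ℂ] CStarMatrix (Fin n) (Fin n) A :=
  spreadHom (Fin.castLE h) (Fin.castLE_injective h)

instance corner_directedSystem (A : Type*) [NonUnitalCStarAlgebra A] :
    DirectedSystem (fun n => CStarMatrix (Fin n) (Fin n) A) (corner A · · ·) where
  map_self n M := by
    symm
    refine eq_spread (Fin.castLE_injective _) (Fin.castLE_injective _) (fun i j => rfl) ?_ ?_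
    · exact fun a b ha => (ha ⟨a, rfl⟩).elim
    · exact fun a b hb => (hb ⟨b, rfl⟩).elim
  map_map i j k hij hjk M :=
    spread_spread (Fin.castLE_injective _) (Fin.castLE_injective _) (Fin.castLE_injective _)
      (Fin.castLE_injective _) M

/-- The algebra `M_∞(A)`, the union of the algebras `M_n(A)` along the upper left corner
embeddings, with the norm inherited from the C⋆-norms of the `M_n(A)`. -/
def FinMat (A : Type*) [NonUnitalCStarAlgebra A] : Type _ :=
  DirectLimit (fun n : ℕ => CStarMatrix (Fin n) (Fin n) A) (corner A)

namespace FinMat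

instance : NonUnitalRing (FinMat A) := inferInstanceAs (NonUnitalRing (DirectLimit _ (corner A)))

instance : SMul ℂ (FinMat A) := inferInstanceAs (SMul ℂ (DirectLimit _ (corner A)))
instance : StarRing (FinMat A) := inferInstanceAs (StarRing (DirectLimit _ (corner A)))

/-- The inclusion of `M_n(A)` in `M_∞(A)`. -/
def mk (n : ℕ) (M : CStarMatrix (Fin n) (Fin n) A) : FinMat A :=
  (⟦⟨n, M⟩⟧ : DirectLimit _ (corner A))

lemma ind {C : FinMat A → Prop} (h : ∀ n M, C (mk n M)) (x : FinMat A) : C x :=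
  DirectLimit.induction (f := corner A) h x

lemma ind₂ {C : FinMat A → FinMat A → Prop} (h : ∀ n M N, C (mk n M) (mk n N))
    (x y : FinMat A) : C x y :=
  DirectLimit.induction₂ (corner A) h x y

lemma mk_corner {m n : ℕ} (h : m ≤ n) (M : CStarMatrix (Fin m) (Fin m) A) :
    mk n (corner A m n h M) = mk m M :=
  by have := DirectLimit.mk_apply (f := corner A) m n M h; exact this

lemma mk_eq_of_le {m n : ℕ} (h : m ≤ n) (M : CStarMatrix (Fin m) (Fin m) A) :
    mk m M = mk n (corner A m n h M) := (mk_corner h M).symm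

lemma zero_eq_mk (n : ℕ) : (0 : FinMat A) = mk n 0 := DirectLimit.zero_def (f := corner A) n
lemma mk_add (n : ℕ) (M N : CStarMatrix (Fin n) (Fin n) A) : mk n (M + N) = mk n M + mk n N :=
  by have := DirectLimit.add_def (f := corner A) n M N; exact this.symm
lemma mk_mul (n : ℕ) (M N : CStarMatrix (Fin n) (Fin n) A) : mk n (M * N) = mk n M * mk n N :=
  by have := DirectLimit.mul_def (f := corner A) n M N; exact this.symm
lemma mk_star (n : ℕ) (M : CStarMatrix (Fin n) (Fin n) A) : mk n (star M) = star (mk n M) := rfl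
lemma mk_smul (n : ℕ) (c : ℂ) (M : CStarMatrix (Fin n) (Fin n) A) :
    mk n (c • M) = c • mk n M := rfl

instance : Module ℂ (FinMat A) where
  one_smul := ind fun n M => by rw [← mk_smul, one_smul]
  mul_smul c d := ind fun n M => by simp only [← mk_smul, mul_smul]
  smul_zero c := by rw [zero_eq_mk 0, ← mk_smul, smul_zero]
  smul_add c := ind₂ fun n M N => by simp only [← mk_smul, ← mk_add, smul_add]
  add_smul c d := ind fun n M => by simp only [← mk_smul, ← mk_add, add_smul]
  zero_smul := ind fun n M => by rw [← mk_smul, zero_smul, ← zero_eq_mk]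

instance : IsScalarTower ℂ (FinMat A) (FinMat A) where
  smul_assoc c := ind₂ fun n M N => by
    simp only [smul_eq_mul, ← mk_smul, ← mk_mul, smul_mul_assoc]

instance : SMulCommClass ℂ (FinMat A) (FinMat A) where
  smul_comm c := ind₂ fun n M N => by
    simp only [smul_eq_mul, ← mk_smul, ← mk_mul, mul_smul_comm]

instance : StarModule ℂ (FinMat A) where
  star_smul c := ind fun n M => by simp only [← mk_smul, ← mk_star, star_smul]

instance : Norm (FinMat A) where
  norm := DirectLimit.lift (corner A) (fun _ M => ‖M‖) fun _ _ h M =>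
    (norm_spread_same (Fin.castLE_injective h) M).symm

lemma norm_mk (n : ℕ) (M : CStarMatrix (Fin n) (Fin n) A) : ‖mk n M‖ = ‖M‖ := rfl

lemma normCore : NormedSpace.Core ℂ (FinMat A) where
  norm_nonneg := ind fun n M => norm_nonneg M
  norm_smul c := ind fun n M => by rw [← mk_smul, norm_mk, norm_mk, norm_smul]
  norm_triangle := ind₂ fun n M N => by
    rw [← mk_add, norm_mk, norm_mk, norm_mk]; exact norm_add_le M N
  norm_eq_zero_iff := ind fun n M => by
    rw [norm_mk, norm_eq_zero]
    refine ⟨fun h => by rw [h, ← zero_eq_mk], fun h => ?_⟩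
    have := congrArg norm h
    rwa [norm_mk, zero_eq_mk n, norm_mk, norm_zero, norm_eq_zero] at this

instance : NormedAddCommGroup (FinMat A) := .ofCore normCore
instance : NormedSpace ℂ (FinMat A) := .ofCore normCore
instance : NonUnitalNormedRing (FinMat A) where
  dist_eq _ _ := dist_eq_norm_neg_add _ _
  norm_mul_le := ind₂ fun n M N => by
    rw [← mk_mul, norm_mk, norm_mk, norm_mk]; exact norm_mul_le M N
instance : CStarRing (FinMat A) where
  norm_mul_self_le := ind fun n M => by
    rw [← mk_star, ← mk_mul, norm_mk, norm_mk]; exact CStarRing.norm_mul_self_le M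

/-- An injection of `ℕ`, restricted to an initial segment. -/
def trunc (f : ℕ ↪ ℕ) {n N : ℕ} (h : ∀ i : Fin n, f i < N) (i : Fin n) : Fin N := ⟨f i, h i⟩

lemma trunc_injective (f : ℕ ↪ ℕ) {n N : ℕ} (h : ∀ i : Fin n, f i < N) :
    (trunc f h).Injective :=
  fun _ _ hij => Fin.ext (f.injective (congrArg Fin.val hij))

lemma mk_spread_trunc_eq (f g : ℕ ↪ ℕ) {n m N N' : ℕ} (hnm : n ≤ m) (hf : ∀ i : Fin n, f i < N)
    (hg : ∀ i : Fin n, g i < N) (hf' : ∀ i : Fin m, f i < N') (hg' : ∀ i : Fin m, g i < N')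
    (M : CStarMatrix (Fin n) (Fin n) A) :
    mk N (spread (trunc f hf) (trunc g hg) M) =
      mk N' (spread (trunc f hf') (trunc g hg') (corner A n m hnm M)) := by
  have key : corner A N (max N N') (le_max_left _ _) (spread (trunc f hf) (trunc g hg) M) =
      corner A N' (max N N') (le_max_right _ _)
        (spread (trunc f hf') (trunc g hg') (corner A n m hnm M)) := by
    have e1 : ∀ (p q : ℕ) (h : p ≤ q) (X : CStarMatrix (Fin p) (Fin p) A),
      corner A p q h X = spread (Fin.castLE h) (Fin.castLE h) X := fun _ _ _ _ => rfl
    simp only [e1]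
    rw [spread_spread (trunc_injective f hf) (trunc_injective g hg) (Fin.castLE_injective _)
        (Fin.castLE_injective _),
      spread_spread (Fin.castLE_injective _) (Fin.castLE_injective _) (trunc_injective f hf')
        (trunc_injective g hg'),
      spread_spread ((trunc_injective f hf').comp (Fin.castLE_injective _))
        ((trunc_injective g hg').comp (Fin.castLE_injective _)) (Fin.castLE_injective _)
        (Fin.castLE_injective _)]
    rfl
  rw [← mk_corner (le_max_left N N'), key, mk_corner]

/-- A common strict bound for the values of `f` and `g` on `{0, …, n - 1}`. -/
def bound (f g : ℕ ↪ ℕ) (n : ℕ) : ℕ := (Finset.range n).sup fun i => f i + g i + 1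

lemma lt_bound_left (f g : ℕ ↪ ℕ) (n : ℕ) (i : Fin n) : f i < bound f g n :=
  lt_of_lt_of_le (by lia)
    (Finset.le_sup (f := fun i => f i + g i + 1) (Finset.mem_range.2 i.2))

lemma lt_bound_right (f g : ℕ ↪ ℕ) (n : ℕ) (i : Fin n) : g i < bound f g n :=
  lt_of_lt_of_le (by lia)
    (Finset.le_sup (f := fun i => f i + g i + 1) (Finset.mem_range.2 i.2))

/-- The map of `M_∞(A)` moving the `(i, j)` entry to the place `(f i, g j)`. -/
def shift (f g : ℕ ↪ ℕ) : FinMat A → FinMat A :=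
  DirectLimit.lift (corner A)
    (fun n M => mk (bound f g n)
      (spread (trunc f (lt_bound_left f g n)) (trunc g (lt_bound_right f g n)) M))
    fun _ _ h M => mk_spread_trunc_eq f g h _ _ _ _ M

lemma shift_mk (f g : ℕ ↪ ℕ) {n N : ℕ} (hf : ∀ i : Fin n, f i < N) (hg : ∀ i : Fin n, g i < N)
    (M : CStarMatrix (Fin n) (Fin n) A) :
    shift f g (mk n M) = mk N (spread (trunc f hf) (trunc g hg) M) := by
  have h : corner A n n le_rfl M = M := (corner_directedSystem A).map_self M
  conv_rhs => rw [← h]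
  exact mk_spread_trunc_eq f g le_rfl (lt_bound_left f g n) (lt_bound_right f g n) hf hg M

lemma exists_bound (f g h : ℕ ↪ ℕ) (n : ℕ) : ∃ N, (∀ i : Fin n, f i < N) ∧
    (∀ i : Fin n, g i < N) ∧ ∀ i : Fin n, h i < N :=
  ⟨max (bound f g n) (bound h h n), fun i => lt_max_of_lt_left (lt_bound_left f g n i),
    fun i => lt_max_of_lt_left (lt_bound_right f g n i),
    fun i => lt_max_of_lt_right (lt_bound_left h h n i)⟩

lemma shift_add (f g : ℕ ↪ ℕ) (x y : FinMat A) : shift f g (x + y) = shift f g x + shift f g y := by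
  induction x, y using ind₂ with | h n M N
  simp only [← mk_add, shift_mk f g (lt_bound_left f g n) (lt_bound_right f g n),
    spread_add (trunc_injective f _) (trunc_injective g _)]

lemma shift_smul (f g : ℕ ↪ ℕ) (c : ℂ) (x : FinMat A) : shift f g (c • x) = c • shift f g x := by
  induction x using ind with | h n M
  simp only [← mk_smul, shift_mk f g (lt_bound_left f g n) (lt_bound_right f g n),
    spread_smul (trunc_injective f _) (trunc_injective g _)]

lemma norm_shift (f g : ℕ ↪ ℕ) (x : FinMat A) : ‖shift f g x‖ = ‖x‖ := by
  induction x using ind with | h n M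
  rw [shift_mk f g (lt_bound_left f g n) (lt_bound_right f g n), norm_mk, norm_mk,
    norm_spread (trunc_injective f _) (trunc_injective g _)]

lemma star_shift (f g : ℕ ↪ ℕ) (x : FinMat A) : star (shift f g x) = shift g f (star x) := by
  induction x using ind with | h n M
  rw [shift_mk f g (lt_bound_left f g n) (lt_bound_right f g n), ← mk_star, ← mk_star,
    shift_mk g f (lt_bound_right f g n) (lt_bound_left f g n),
    star_spread (trunc_injective f _) (trunc_injective g _)]

lemma shift_mul (f g h : ℕ ↪ ℕ) (x y : FinMat A) :
    shift f g x * shift g h y = shift f h (x * y) := by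
  induction x, y using ind₂ with | h n M N
  obtain ⟨K, hf, hg, hh⟩ := exists_bound f g h n
  rw [shift_mk f g hf hg, shift_mk g h hg hh, ← mk_mul, ← mk_mul, shift_mk f h hf hh,
    spread_mul (trunc_injective f _) (trunc_injective g _) (trunc_injective h _)]

lemma shift_mul_disjoint (f g h k : ℕ ↪ ℕ) (hgh : ∀ i j, g i ≠ h j) (x y : FinMat A) :
    shift f g x * shift h k y = 0 := by
  induction x, y using ind₂ with | h n M N
  obtain ⟨K, hf, hg, hh⟩ := exists_bound f g h n
  rw [shift_mk f g (fun i => lt_max_of_lt_left (hf i)) (fun i => lt_max_of_lt_left (hg i)),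
    shift_mk h k (fun i => lt_max_of_lt_left (hh i))
      (fun i => lt_max_of_lt_right (lt_bound_left k k n i)), ← mk_mul,
    spread_mul_disjoint, ← zero_eq_mk]
  exact fun i j hij => hgh i j (congrArg Fin.val hij)

lemma shift_shift (f g f' g' : ℕ ↪ ℕ) (x : FinMat A) :
    shift f' g' (shift f g x) = shift (f.trans f') (g.trans g') x := by
  induction x using ind with | h n M
  rw [shift_mk f g (lt_bound_left f g n) (lt_bound_right f g n),
    shift_mk f' g' (lt_bound_left f' g' _) (lt_bound_right f' g' _),
    spread_spread (trunc_injective f _) (trunc_injective g _) (trunc_injective f' _)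
      (trunc_injective g' _),
    shift_mk (f.trans f') (g.trans g')
      (fun i => lt_bound_left f' g' _ ⟨f i, lt_bound_left f g n i⟩)
      (fun i => lt_bound_right f' g' _ ⟨g i, lt_bound_right f g n i⟩)]
  rfl

lemma shift_refl (x : FinMat A) : shift (.refl ℕ) (.refl ℕ) x = x := by
  induction x using ind with | h n M
  rw [shift_mk (N := n) _ _ (fun i => i.2) (fun i => i.2)]
  congr 1
  exact (corner_directedSystem A).map_self M

end FinMat
end FiniteMatrices

section Stabilization

open UniformSpace

attribute [local instance] CStarAlgebra.spectralOrder CStarAlgebra.spectralOrderedRing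

variable {A : Type*} [NonUnitalCStarAlgebra A]

/-- The stabilization `A ⊗ K`, where `K` is the algebra of compact operators on `ℓ²(ℕ)`: the
completion of `M_∞(A)` with respect to its C⋆-norm. -/
def Stab (A : Type*) [NonUnitalCStarAlgebra A] : Type _ := Completion (FinMat A)

namespace Stab

instance : NormedAddCommGroup (Stab A) := inferInstanceAs (NormedAddCommGroup (Completion (FinMat A)))
instance : NormedSpace ℂ (Stab A) := inferInstanceAs (NormedSpace ℂ (Completion (FinMat A)))
instance : CompleteSpace (Stab A) := inferInstanceAs (CompleteSpace (Completion (FinMat A)))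

lemma continuous_smul_left (c : ℂ) : Continuous fun x : Stab A => c • x := by
  exact continuous_const_smul c

/-- The inclusion of `M_∞(A)` in `A ⊗ K`. -/
def incl : FinMat A →ₗᵢ[ℂ] Stab A := Completion.toComplₗᵢ (𝕜 := ℂ) (E := FinMat A)

lemma isDenseInducing_incl : IsDenseInducing (incl : FinMat A → Stab A) :=
  Completion.isDenseInducing_coe

lemma ind {C : Stab A → Prop} (hC : IsClosed {x | C x}) (h : ∀ x, C (incl x)) (x : Stab A) : C x :=
  Completion.induction_on x hC h

lemma ind₂ {C : Stab A → Stab A → Prop} (hC : IsClosed {p : Stab A × Stab A | C p.1 p.2})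
    (h : ∀ x y, C (incl x) (incl y)) (x y : Stab A) : C x y :=
  Completion.induction_on₂ x y hC h

lemma ind₃ {C : Stab A → Stab A → Stab A → Prop}
    (hC : IsClosed {p : Stab A × Stab A × Stab A | C p.1 p.2.1 p.2.2})
    (h : ∀ x y z, C (incl x) (incl y) (incl z)) (x y z : Stab A) : C x y z :=
  Completion.induction_on₃ x y z hC h

/-- The multiplication extends that of `M_∞(A)` by continuity. -/
instance : Mul (Stab A) where
  mul := Function.curry <| (isDenseInducing_incl.prodMap isDenseInducing_incl).extend
    fun p : FinMat A × FinMat A => incl (p.1 * p.2)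

instance : ContinuousMul (Stab A) where
  continuous_mul := by
    let m := (AddMonoidHom.mul : FinMat A →+ FinMat A →+ FinMat A).compr₂
      (incl (A := A)).toLinearMap.toAddMonoidHom
    have : Continuous fun p : FinMat A × FinMat A => m p.1 p.2 :=
      incl.continuous.comp continuous_mul
    have di : IsDenseInducing ((incl (A := A)).toLinearMap.toAddMonoidHom) := isDenseInducing_incl
    exact di.extend_Z_bilin di this

lemma incl_mul (x y : FinMat A) : incl (x * y) = incl x * incl y :=
  ((isDenseInducing_incl.prodMap isDenseInducing_incl).extend_eq
    (incl.continuous.comp (@continuous_mul (FinMat A) _ _ _)) (x, y)).symm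

instance : NonUnitalRing (Stab A) where
  zero_mul := ind (isClosed_eq (by fun_prop) (by fun_prop)) fun x => by
    rw [← map_zero incl, ← incl_mul, zero_mul]
  mul_zero := ind (isClosed_eq (by fun_prop) (by fun_prop)) fun x => by
    rw [← map_zero incl, ← incl_mul, mul_zero]
  mul_assoc := ind₃ (isClosed_eq (by fun_prop) (by fun_prop)) fun x y z => by
    simp only [← incl_mul, mul_assoc]
  left_distrib := ind₃ (isClosed_eq (by fun_prop) (by fun_prop)) fun x y z => by
    simp only [← incl_mul, ← map_add, mul_add]
  right_distrib := ind₃ (isClosed_eq (by fun_prop) (by fun_prop)) fun x y z => by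
    simp only [← incl_mul, ← map_add, add_mul]

/-- The involution extends that of `M_∞(A)` by continuity. -/
instance : Star (Stab A) where
  star := Completion.map (star : FinMat A → FinMat A)

lemma incl_star (x : FinMat A) : incl (star x) = star (incl x) :=
  (Completion.map_coe star_isometry.uniformContinuous x).symm

instance : ContinuousStar (Stab A) where
  continuous_star := Completion.continuous_map

instance : StarRing (Stab A) where
  star_involutive := ind (isClosed_eq (by fun_prop) (by fun_prop)) fun x => by
    simp only [← incl_star, star_star]
  star_mul := ind₂ (isClosed_eq (by fun_prop) (by fun_prop)) fun x y => by
    simp only [← incl_mul, ← incl_star, star_mul]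
  star_add := ind₂ (isClosed_eq (by fun_prop) (by fun_prop)) fun x y => by
    simp only [← map_add, ← incl_star, star_add]

lemma incl_smul (c : ℂ) (x : FinMat A) : incl (c • x) = c • incl x := incl.map_smul c x

instance : IsScalarTower ℂ (Stab A) (Stab A) where
  smul_assoc c := ind₂ (isClosed_eq
      (((continuous_smul_left c).comp continuous_fst).mul continuous_snd)
      ((continuous_smul_left c).comp (continuous_fst.mul continuous_snd))) fun x y => by
    rw [smul_eq_mul, smul_eq_mul, ← incl_smul, ← incl_mul, ← incl_mul, ← incl_smul, smul_mul_assoc]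

instance : SMulCommClass ℂ (Stab A) (Stab A) where
  smul_comm c := ind₂ (isClosed_eq
      ((continuous_smul_left c).comp (continuous_fst.mul continuous_snd))
      (continuous_fst.mul ((continuous_smul_left c).comp continuous_snd))) fun x y => by
    rw [smul_eq_mul, smul_eq_mul, ← incl_smul, ← incl_mul, ← incl_mul, ← incl_smul, mul_smul_comm]

instance : StarModule ℂ (Stab A) where
  star_smul c := ind (isClosed_eq (continuous_star.comp (continuous_smul_left c))
      ((continuous_smul_left (star c)).comp continuous_star)) fun x => by
    rw [← incl_smul, ← incl_star, ← incl_star, ← incl_smul, star_smul]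

instance : NonUnitalNormedRing (Stab A) where
  dist_eq := dist_eq_norm_neg_add
  norm_mul_le := ind₂ (isClosed_le (by fun_prop) (by fun_prop)) fun x y => by
    simp only [← incl_mul, incl.norm_map]; exact norm_mul_le x y

instance : CStarRing (Stab A) where
  norm_mul_self_le := ind (isClosed_le (by fun_prop) (by fun_prop)) fun x => by
    simp only [← incl_star, ← incl_mul, incl.norm_map]; exact CStarRing.norm_mul_self_le x

instance : NonUnitalCStarAlgebra (Stab A) where

/-- The map of `A ⊗ K` moving the `(i, j)` entry to the place `(f i, g j)`. -/
def shift (f g : ℕ ↪ ℕ) : Stab A → Stab A := Completion.map (FinMat.shift (A := A) f g)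

lemma isometry_finMat_shift (f g : ℕ ↪ ℕ) : Isometry (FinMat.shift (A := A) f g) :=
  AddMonoidHomClass.isometry_of_norm (AddMonoidHom.mk' _ (FinMat.shift_add f g))
    (FinMat.norm_shift f g)

lemma shift_incl (f g : ℕ ↪ ℕ) (x : FinMat A) : shift f g (incl x) = incl (FinMat.shift f g x) :=
  Completion.map_coe (isometry_finMat_shift f g).uniformContinuous x

@[fun_prop]
lemma continuous_shift (f g : ℕ ↪ ℕ) : Continuous (shift (A := A) f g) :=
  Completion.continuous_map

lemma shift_add (f g : ℕ ↪ ℕ) (x y : Stab A) : shift f g (x + y) = shift f g x + shift f g y := by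
  refine ind₂ (C := fun x y => shift f g (x + y) = shift f g x + shift f g y)
    (isClosed_eq (by fun_prop) (by fun_prop)) (fun x y => ?_) x y
  simp only [← map_add, shift_incl, FinMat.shift_add]

lemma star_shift (f g : ℕ ↪ ℕ) (x : Stab A) : star (shift f g x) = shift g f (star x) := by
  refine ind (C := fun x => star (shift f g x) = shift g f (star x))
    (isClosed_eq (by fun_prop) (by fun_prop)) (fun x => ?_) x
  simp only [← incl_star, shift_incl, FinMat.star_shift]

lemma shift_mul (f g h : ℕ ↪ ℕ) (x y : Stab A) :
    shift f g x * shift g h y = shift f h (x * y) := by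
  refine ind₂ (C := fun x y => shift f g x * shift g h y = shift f h (x * y))
    (isClosed_eq (by fun_prop) (by fun_prop)) (fun x y => ?_) x y
  simp only [← incl_mul, shift_incl, FinMat.shift_mul]

lemma shift_mul_disjoint (f g h k : ℕ ↪ ℕ) (hgh : ∀ i j, g i ≠ h j) (x y : Stab A) :
    shift f g x * shift h k y = 0 := by
  refine ind₂ (C := fun x y => shift f g x * shift h k y = 0)
    (isClosed_eq (by fun_prop) (by fun_prop)) (fun x y => ?_) x y
  rw [shift_incl, shift_incl, ← incl_mul, FinMat.shift_mul_disjoint f g h k hgh, map_zero]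

lemma shift_zero (f g : ℕ ↪ ℕ) : shift f g (0 : Stab A) = 0 := by
  simpa using shift_add f g (0 : Stab A) 0

lemma shift_shift (f g f' g' : ℕ ↪ ℕ) (x : Stab A) :
    shift f' g' (shift f g x) = shift (f.trans f') (g.trans g') x := by
  refine ind (C := fun x => shift f' g' (shift f g x) = shift (f.trans f') (g.trans g') x)
    (isClosed_eq (by fun_prop) (by fun_prop)) (fun x => ?_) x
  simp only [shift_incl, FinMat.shift_shift]

lemma shift_refl (x : Stab A) : shift (.refl ℕ) (.refl ℕ) x = x := by
  refine ind (C := fun x => shift (.refl ℕ) (.refl ℕ) x = x)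
    (isClosed_eq (by fun_prop) (by fun_prop)) (fun x => ?_) x
  rw [shift_incl, FinMat.shift_refl]

lemma shift_nonneg (f : ℕ ↪ ℕ) {x : Stab A} (hx : 0 ≤ x) : 0 ≤ shift f f x := by
  obtain ⟨y, rfl⟩ := CStarAlgebra.nonneg_iff_eq_star_mul_self.1 hx
  rw [← shift_mul f f f, ← star_shift]
  exact star_mul_self_nonneg _

/-- The injection `i ↦ 2 i`. -/
def even : ℕ ↪ ℕ := ⟨fun i => 2 * i, fun i j h => by simpa using h⟩

/-- The injection `i ↦ 2 i + 1`. -/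
def odd : ℕ ↪ ℕ := ⟨fun i => 2 * i + 1, fun i j h => by simpa using h⟩

/-- The direct sum `a ⊕ b` in `M₂(A ⊗ K)`, identified with `A ⊗ K` by means of the bijection
`ℕ ⊔ ℕ ≃ ℕ` with components `even` and `odd`. -/
def dsum (a b : Stab A) : Stab A := shift even even a + shift odd odd b

lemma dsum_nonneg {a b : Stab A} (ha : 0 ≤ a) (hb : 0 ≤ b) : 0 ≤ dsum a b :=
  add_nonneg (shift_nonneg _ ha) (shift_nonneg _ hb)

end Stab
end Stabilization

section Cuntz

attribute [local instance] CStarAlgebra.spectralOrder CStarAlgebra.spectralOrderedRing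

/-- Cuntz subequivalence `a ≾ b` over `C`: there is a sequence `vₙ` in `C` with
`vₙ b vₙ* → a`. -/
def CuntzLE {C : Type*} [Mul C] [Star C] [TopologicalSpace C] (a b : C) : Prop :=
  ∃ v : ℕ → C, Tendsto (fun n => v n * b * star (v n)) atTop (𝓝 a)

section General

variable {C : Type*} [NonUnitalCStarAlgebra C]

lemma cuntzLE_iff_mem_closure {a b : C} :
    CuntzLE a b ↔ a ∈ closure (Set.range fun v : C => v * b * star v) := by
  rw [mem_closure_iff_seq_limit]
  constructor
  · rintro ⟨v, hv⟩
    exact ⟨_, fun n => ⟨v n, rfl⟩, hv⟩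
  · rintro ⟨x, hx, h⟩
    choose v hv using hx
    exact ⟨v, by simpa only [hv] using h⟩

lemma CuntzLE.trans {a b c : C} (hab : CuntzLE a b) (hbc : CuntzLE b c) : CuntzLE a c := by
  rw [cuntzLE_iff_mem_closure] at *
  refine closure_minimal ?_ isClosed_closure hab
  rintro _ ⟨v, rfl⟩
  have hcont : Continuous fun x : C => v * x * star v := by fun_prop
  refine map_mem_closure (f := fun x => v * x * star v) hcont hbc ?_
  rintro _ ⟨w, rfl⟩
  exact ⟨v * w, by simp only [star_mul, mul_assoc]⟩

lemma CuntzLE.refl {a : C} (ha : 0 ≤ a) : CuntzLE a a := by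
  obtain ⟨y, rfl⟩ := CStarAlgebra.nonneg_iff_eq_star_mul_self.1 ha
  rw [cuntzLE_iff_mem_closure]
  have hl := (CStarAlgebra.increasingApproximateUnit C).toIsApproximateUnit
  have := hl.neBot
  have h1 := hl.tendsto_mul_left y
  refine mem_closure_of_tendsto (h1.star.mul h1) (Eventually.of_forall fun e => ⟨star e, ?_⟩)
  simp only [star_mul, star_star, mul_assoc]

end General

section Stab

variable {A : Type*} [NonUnitalCStarAlgebra A]

/-- Sums of pairwise orthogonal copies are monotone for Cuntz subequivalence, whichever
injections are used to form the copies. -/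
lemma cuntzLE_sum_shift {I : Type*} [Fintype I] (f g : I → ℕ ↪ ℕ)
    (hg : ∀ s t, s ≠ t → ∀ i j, g s i ≠ g t j) (a b : I → Stab A)
    (hab : ∀ s, CuntzLE (a s) (b s)) :
    CuntzLE (∑ s, (a s).shift (f s) (f s)) (∑ s, (b s).shift (g s) (g s)) := by
  classical
  choose v hv using hab
  refine ⟨fun n => ∑ s, (v s n).shift (f s) (g s), ?_⟩
  have key : ∀ n, (∑ s, (v s n).shift (f s) (g s)) * (∑ s, (b s).shift (g s) (g s)) *
      star (∑ s, (v s n).shift (f s) (g s)) =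
      ∑ s, (v s n * b s * star (v s n)).shift (f s) (f s) := by
    intro n
    have h1 : (∑ s, (v s n).shift (f s) (g s)) * (∑ s, (b s).shift (g s) (g s)) =
        ∑ s, (v s n * b s).shift (f s) (g s) := by
      rw [Finset.sum_mul_sum]
      refine Finset.sum_congr rfl fun s _ => ?_
      rw [Finset.sum_eq_single s, Stab.shift_mul]
      · exact fun t _ hts => Stab.shift_mul_disjoint _ _ _ _ (hg s t hts.symm) _ _
      · exact fun h => (h (Finset.mem_univ s)).elim
    rw [h1, star_sum, Finset.sum_mul_sum]
    refine Finset.sum_congr rfl fun s _ => ?_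
    rw [Finset.sum_eq_single s, Stab.star_shift, Stab.shift_mul]
    · intro t _ hts
      rw [Stab.star_shift]
      exact Stab.shift_mul_disjoint _ _ _ _ (hg s t hts.symm) _ _
    · exact fun h => (h (Finset.mem_univ s)).elim
  simp only [key]
  exact tendsto_finsetSum _ fun s _ => ((Stab.continuous_shift _ _).tendsto _).comp (hv s)

end Stab

/-- The positive cone `(A ⊗ K)₊`. -/
structure StabPos (A : Type*) [NonUnitalCStarAlgebra A] where
  val : Stab A
  nonneg : 0 ≤ val

variable {A : Type*} [NonUnitalCStarAlgebra A]

/-- `(A ⊗ K)₊` is preordered by Cuntz subequivalence. -/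
instance : Preorder (StabPos A) where
  le a b := CuntzLE a.val b.val
  le_refl a := CuntzLE.refl a.nonneg
  le_trans _ _ _ := CuntzLE.trans

variable (A) in
/-- The Cuntz semigroup `Cu(A) = (A ⊗ K)₊ / ∼`. Its partial order is induced by Cuntz
subequivalence. -/
def Cu : Type _ := Antisymmetrization (StabPos A) (· ≤ ·)

namespace Cu

instance : PartialOrder (Cu A) := inferInstanceAs (PartialOrder (Antisymmetrization (StabPos A) _))

/-- The class of a positive element. -/
def cls (a : StabPos A) : Cu A := toAntisymmetrization (· ≤ ·) a

lemma cls_le_cls {a b : StabPos A} : cls a ≤ cls b ↔ CuntzLE a.val b.val := Iff.rfl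

lemma cls_eq_cls {a b : StabPos A} :
    cls a = cls b ↔ CuntzLE a.val b.val ∧ CuntzLE b.val a.val := by
  rw [le_antisymm_iff, cls_le_cls, cls_le_cls]

lemma ind {P : Cu A → Prop} (h : ∀ a, P (cls a)) (x : Cu A) : P x :=
  Antisymmetrization.ind (· ≤ ·) h x

instance : Zero (Cu A) where
  zero := cls ⟨0, le_rfl⟩

lemma even_ne_odd (i j : ℕ) : Stab.even i ≠ Stab.odd j := by
  show 2 * i ≠ 2 * j + 1
  lia

lemma cuntzLE_dsum {a b c d : Stab A} (hab : CuntzLE a b) (hcd : CuntzLE c d) :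
    CuntzLE (Stab.dsum a c) (Stab.dsum b d) := by
  have := cuntzLE_sum_shift ![Stab.even, Stab.odd] ![Stab.even, Stab.odd] (by
    intro s t hst i j
    fin_cases s <;> fin_cases t <;> simp at hst ⊢
    · exact even_ne_odd i j
    · exact (even_ne_odd j i).symm) ![a, c] ![b, d] (by
    intro s; fin_cases s <;> simpa)
  simpa [Fin.sum_univ_two, Stab.dsum] using this

/-- The addition `⟨a⟩ + ⟨b⟩ = ⟨a ⊕ b⟩`. -/
instance : Add (Cu A) where
  add := Quotient.map₂ (fun a b => ⟨Stab.dsum a.val b.val, Stab.dsum_nonneg a.nonneg b.nonneg⟩)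
    fun _ _ hab _ _ hcd => ⟨cuntzLE_dsum hab.1 hcd.1, cuntzLE_dsum hab.2 hcd.2⟩

lemma cls_add_cls (a b : StabPos A) :
    cls a + cls b = cls ⟨Stab.dsum a.val b.val, Stab.dsum_nonneg a.nonneg b.nonneg⟩ := rfl

lemma dsum_comm_le {a b : Stab A} (ha : 0 ≤ a) (hb : 0 ≤ b) :
    CuntzLE (Stab.dsum a b) (Stab.dsum b a) := by
  have := cuntzLE_sum_shift ![Stab.even, Stab.odd] ![Stab.odd, Stab.even] (by
    intro s t hst i j
    fin_cases s <;> fin_cases t <;> simp at hst ⊢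
    · exact (even_ne_odd j i).symm
    · exact even_ne_odd i j) ![a, b] ![a, b] (by
    intro s; fin_cases s
    · exact CuntzLE.refl ha
    · exact CuntzLE.refl hb)
  simpa [Fin.sum_univ_two, Stab.dsum, add_comm] using this

lemma dsum_zero_le {a : Stab A} (ha : 0 ≤ a) :
    CuntzLE (Stab.dsum 0 a) a ∧ CuntzLE a (Stab.dsum 0 a) := by
  have h1 := cuntzLE_sum_shift (I := Unit) (fun _ => Stab.odd) (fun _ => .refl ℕ)
    (fun _ _ h => (h rfl).elim) (fun _ => a) (fun _ => a) (fun _ => CuntzLE.refl ha)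
  have h2 := cuntzLE_sum_shift (I := Unit) (fun _ => .refl ℕ) (fun _ => Stab.odd)
    (fun _ _ h => (h rfl).elim) (fun _ => a) (fun _ => a) (fun _ => CuntzLE.refl ha)
  simp only [Finset.univ_unique, Finset.sum_const, Finset.card_singleton, one_smul,
    Stab.shift_refl] at h1 h2
  simpa only [Stab.dsum, Stab.shift_zero, zero_add] using And.intro h1 h2

lemma dsum_assoc_le {a b c : Stab A} (ha : 0 ≤ a) (hb : 0 ≤ b) (hc : 0 ≤ c) :
    CuntzLE (Stab.dsum (Stab.dsum a b) c) (Stab.dsum a (Stab.dsum b c)) ∧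
      CuntzLE (Stab.dsum a (Stab.dsum b c)) (Stab.dsum (Stab.dsum a b) c) := by
  let e := Stab.even
  let o := Stab.odd
  let f : Fin 3 → ℕ ↪ ℕ := ![e.trans e, o.trans e, o]
  let g : Fin 3 → ℕ ↪ ℕ := ![e, e.trans o, o.trans o]
  have he : ∀ i, e i = 2 * i := fun _ => rfl
  have ho : ∀ i, o i = 2 * i + 1 := fun _ => rfl
  have hf : ∀ s t, s ≠ t → ∀ i j, f s i ≠ f t j := by
    intro s t hst i j
    fin_cases s <;> fin_cases t <;> simp [f, he, ho] at hst ⊢ <;> lia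
  have hg : ∀ s t, s ≠ t → ∀ i j, g s i ≠ g t j := by
    intro s t hst i j
    fin_cases s <;> fin_cases t <;> simp [g, he, ho] at hst ⊢ <;> lia
  have hx : ∀ s, CuntzLE (![a, b, c] s) (![a, b, c] s) := by
    intro s
    fin_cases s
    · exact CuntzLE.refl ha
    · exact CuntzLE.refl hb
    · exact CuntzLE.refl hc
  have h1 := cuntzLE_sum_shift f g hg ![a, b, c] ![a, b, c] hx
  have h2 := cuntzLE_sum_shift g f hf ![a, b, c] ![a, b, c] hx
  simp only [Fin.sum_univ_three] at h1 h2
  simp only [Stab.dsum, Stab.shift_add, Stab.shift_shift, ← add_assoc]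
  exact ⟨h1, h2⟩

instance : AddCommMonoid (Cu A) where
  add_assoc x y z := by
    induction x using ind with | h a
    induction y using ind with | h b
    induction z using ind with | h c
    exact cls_eq_cls.2 (dsum_assoc_le a.nonneg b.nonneg c.nonneg)
  add_comm x y := by
    induction x using ind with | h a
    induction y using ind with | h b
    exact cls_eq_cls.2 ⟨dsum_comm_le a.nonneg b.nonneg, dsum_comm_le b.nonneg a.nonneg⟩
  zero_add x := by
    induction x using ind with | h a
    exact cls_eq_cls.2 (dsum_zero_le a.nonneg)
  add_zero x := by
    induction x using ind with | h a
    refine cls_eq_cls.2 ⟨(dsum_comm_le a.nonneg le_rfl).trans (dsum_zero_le a.nonneg).1,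
      (dsum_zero_le a.nonneg).2.trans (dsum_comm_le le_rfl a.nonneg)⟩
  nsmul := nsmulRec

instance : IsOrderedAddMonoid (Cu A) where
  add_le_add_left x y hxy z := by
    induction x using ind with | h a
    induction y using ind with | h b
    induction z using ind with | h c
    exact cuntzLE_dsum hxy (CuntzLE.refl c.nonneg)

end Cu
end Cuntz

section Divisibility

/-- The way below relation `x ≪ y` with respect to increasing sequences. -/
def WayBelow {S : Type*} [PartialOrder S] (x y : S) : Prop :=
  ∀ f : ℕ → S, Monotone f → ∀ s, IsLUB (Set.range f) s → y ≤ s → ∃ n, x ≤ f n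

/-- `m`-almost divisibility of an ordered semigroup. -/
def IsAlmostDivisible (S : Type*) [AddCommMonoid S] [PartialOrder S] (m : ℕ) : Prop :=
  ∀ x' x : S, WayBelow x' x → ∀ N : ℕ, 0 < N →
    ∃ y : S, N • y ≤ x ∧ x' ≤ ((N + 1) * (m + 1)) • y

/-- A C⋆-algebra is `m`-almost divisible if its Cuntz semigroup is. -/
def AlmostDivisible (A : Type*) [NonUnitalCStarAlgebra A] (m : ℕ) : Prop :=
  IsAlmostDivisible (Cu A) m

end Divisibility

section Algebras

/-- Simplicity: there are no closed two-sided ideals besides `0` and `A`. -/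
def IsSimple (A : Type*) [NonUnitalCStarAlgebra A] : Prop :=
  Nontrivial A ∧ ∀ I : TwoSidedIdeal A, IsClosed (I : Set A) → I = ⊥ ∨ I = ⊤

/-- Stable finiteness of a unital algebra: every isometry in every `M_n(A)` is unitary. -/
def IsStablyFinite (A : Type*) [CStarAlgebra A] : Prop :=
  ∀ (n : ℕ) (v : Matrix (Fin n) (Fin n) A), star v * v = 1 → v * star v = 1

attribute [local instance] CStarAlgebra.spectralOrder

/-- A unital subalgebra `B` of `A` is large if for all `a₁, …, aₙ ∈ A`, `ε > 0`, `x ∈ A₊` with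
`‖x‖ = 1` and nonzero `y ∈ B₊` there are `c₁, …, cₙ ∈ A` and `g ∈ B` with `0 ≤ g ≤ 1`,
`‖cⱼ - aⱼ‖ < ε`, `(1 - g) cⱼ ∈ B`, `g ≾ y` over `B`, `g ≾ x` over `A`, and
`‖(1 - g) x (1 - g)‖ > 1 - ε`. -/
def IsLarge {A : Type*} [CStarAlgebra A] (B : StarSubalgebra ℂ A) : Prop :=
  ∀ (n : ℕ) (a : Fin n → A) (ε : ℝ) (x : A) (y : B), 0 < ε → 0 ≤ x → ‖x‖ = 1 →
    0 ≤ (y : A) → y ≠ 0 →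
    ∃ (c : Fin n → A) (g : B), 0 ≤ (g : A) ∧ (g : A) ≤ 1 ∧ (∀ j, ‖c j - a j‖ < ε) ∧
      (∀ j, (1 - (g : A)) * c j ∈ B) ∧ CuntzLE g y ∧ CuntzLE (g : A) x ∧
      1 - ε < ‖(1 - (g : A)) * x * (1 - (g : A))‖

end Algebras

end CuntzSemigroup

end

/-! A large subalgebra `B` determines comparison in `Cu(A)` up to arbitrarily small nonzero classes,
and room for such classes can be made at the cost of a factor two.

Only two consequences of simplicity and infinite dimension enter the comparison arguments: `A` is
prime and no corner `a A a` is one-dimensional. Both pass to `B` by largeness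
(`IsLargeHom.isPrimeAlg`, `IsLargeHom.noMinimal`) and from an algebra to its stabilization
(`IsPrimeAlg.stab`, `NoMinimal.stab`). Together they place in every nonzero hereditary subalgebra an
element `w ≠ 0` with `w * w = 0`, so every nonzero class dominates `n` copies of some nonzero class
(`Cu.exists_nsmul_le`). Hence largeness can be applied entrywise to matrices: any `v` in `A ⊗ K` is
approximated by some `c` with `(1 - g) c` in `B ⊗ K`, where `g` is as small as desired in both Cuntz
semigroups (`IsLargeHom.stab`).

Since `a ≤ 2 (1 - g) a (1 - g) + 2 g a g`, cutting off by `1 - g` costs only the class of `g`. This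
gives two transfer principles. If `x ≤ y` holds in `Cu(A)` for classes from `B`, then `x ≤ y + z`
holds in `Cu(B)` for every nonzero `z` (`IsLargeHom.le_add`). Every cut-down of a class of `Cu(A)`
lies below a sum `d + γ` from `Cu(B)`, with `d` below the original class and `γ` below a prescribed
nonzero class (`IsLargeHom.exists_approx`).

The errors `z` and `γ` must fit below the class being divided. For this `Cu.exists_room` replaces
`a` by `c` with `c + s ≤ a`, `s ≠ 0`, while a cut-down of `a` stays below `2 c`. Passing from `B` to
`A` uses this once, and `2 (m + 1) = (2 m + 1) + 1`. Passing from `A` to `B` uses it twice, once in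
each algebra, and `4 (m + 1) = (4 m + 3) + 1`. -/

noncomputable section

open Filter Topology

namespace CuntzSemigroup

/-! ### Cuntz comparison and cut-downs in a general C⋆-algebra. -/

section Basics

attribute [local instance] CStarAlgebra.spectralOrder CStarAlgebra.spectralOrderedRing

variable {C : Type*} [NonUnitalCStarAlgebra C]

lemma mul_cfcₙ_eq {f : ℝ → ℝ} {b : C} (hb : IsSelfAdjoint b) (hf : Continuous f) (h0 : f 0 = 0) :
    b * cfcₙ f b = cfcₙ (fun t => t * f t) b := by
  conv_lhs => enter [1]; rw [← cfcₙ_id' ℝ b]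
  rw [← cfcₙ_mul (fun t => t) f b]

lemma cfcₙ_mul_eq {f : ℝ → ℝ} {b : C} (hb : IsSelfAdjoint b) (hf : Continuous f) (h0 : f 0 = 0) :
    cfcₙ f b * b = cfcₙ (fun t => f t * t) b := by
  conv_lhs => enter [2]; rw [← cfcₙ_id' ℝ b]
  rw [← cfcₙ_mul f (fun t => t) b]

lemma spec_nonneg {b : C} (hb : 0 ≤ b) {t : ℝ} (ht : t ∈ quasispectrum ℝ b) : 0 ≤ t :=
  quasispectrum_nonneg_of_nonneg b hb t ht

/-- The function `√t / (|t| + δ)`; on a positive `b`, the elements `k b k` with `k = unitFun δ b`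
form an approximate unit as `δ → 0`. -/
def unitFun (δ t : ℝ) : ℝ := Real.sqrt t / (|t| + δ)

lemma unitFun_continuous {δ : ℝ} (hδ : 0 < δ) : Continuous (unitFun δ) := by
  unfold unitFun
  refine Continuous.div (by fun_prop) (by fun_prop) fun t => ?_
  have := abs_nonneg t
  linarith

lemma unitFun_zero (δ : ℝ) : unitFun δ 0 = 0 := by simp [unitFun]

/-- With `s = t / (t + δ)` the left side equals `δ s (1 - s) (1 + s) ^ 2`, because `t (1 - s) = δ
s`. -/
lemma unitFun_bound {δ t : ℝ} (hδ : 0 < δ) (ht : 0 ≤ t) :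
    |t * (1 - unitFun δ t * t * unitFun δ t) ^ 2| ≤ 4 * δ := by
  have hpos : 0 < t + δ := by linarith
  have h1 : unitFun δ t * t * unitFun δ t = (t / (t + δ)) ^ 2 := by
    have : unitFun δ t * t * unitFun δ t = (Real.sqrt t) ^ 2 * t / (t + δ) ^ 2 := by
      rw [unitFun, abs_of_nonneg ht]; field_simp
    rw [this, Real.sq_sqrt ht, div_pow]; ring
  rw [h1, abs_of_nonneg (by positivity)]
  have h2 : 1 - (t / (t + δ)) ^ 2 = (δ / (t + δ)) * (1 + t / (t + δ)) := by
    field_simp; ring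
  have h3 : t / (t + δ) ≤ 1 := by rw [div_le_one hpos]; linarith
  have h4 : 0 ≤ t / (t + δ) := by positivity
  have h5 : δ / (t + δ) ≤ 1 := by rw [div_le_one hpos]; linarith
  have h6 : 0 ≤ δ / (t + δ) := by positivity
  have h7 : t * (1 - (t / (t + δ)) ^ 2) ^ 2 =
      δ * ((t / (t + δ)) * (δ / (t + δ)) * (1 + t / (t + δ)) ^ 2) := by
    rw [h2]; field_simp
  rw [h7]
  have h8 : (1 + t / (t + δ)) ^ 2 ≤ 4 := by nlinarith
  have h9 : (t / (t + δ)) * (δ / (t + δ)) ≤ 1 := by nlinarith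
  have h10 : (t / (t + δ)) * (δ / (t + δ)) * (1 + t / (t + δ)) ^ 2 ≤ 1 * 4 :=
    mul_le_mul h9 h8 (by positivity) zero_le_one
  nlinarith

/-- Put `f = k b k` with `k = unitFun δ b`. Compressing `b - x⋆ x ≥ 0` by `1 - f` bounds the square
of the norm by the norm of `(1 - f) b (1 - f)`, a function of `b` alone, to which `unitFun_bound`
applies. -/
lemma norm_sub_mul_unit {x b : C} (h : star x * x ≤ b) {δ : ℝ} (hδ : 0 < δ) :
    ‖x - x * (cfcₙ (unitFun δ) b * b * cfcₙ (unitFun δ) b)‖ ^ 2 ≤ 4 * δ := by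
  have hb : 0 ≤ b := (star_mul_self_nonneg x).trans h
  have hc := unitFun_continuous hδ
  have h0 := unitFun_zero δ
  obtain ⟨g, hg⟩ : ∃ g : ℝ → ℝ, g = fun t => unitFun δ t * t * unitFun δ t := ⟨_, rfl⟩
  have hgc : Continuous g := by rw [hg]; fun_prop
  have hg0 : g 0 = 0 := by simp [hg]
  have hf : cfcₙ (unitFun δ) b * b * cfcₙ (unitFun δ) b = cfcₙ g b := by
    rw [cfcₙ_mul_eq hb.isSelfAdjoint hc h0,
      ← cfcₙ_mul (fun t => unitFun δ t * t) (unitFun δ) b (by fun_prop) (by simp) (by fun_prop) h0,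
      hg]
  rw [hf]
  set f := cfcₙ g b with hfd
  have hfs : star f = f := (cfcₙ_predicate g b : IsSelfAdjoint _).star_eq
  obtain ⟨z, hz⟩ := CStarAlgebra.nonneg_iff_eq_star_mul_self.1 (sub_nonneg.2 h)
  have e1 : star (x - x * f) * (x - x * f) ≤ b - b * f - f * b + f * b * f := by
    rw [← sub_nonneg]
    have : b - b * f - f * b + f * b * f - star (x - x * f) * (x - x * f) =
        star (z - z * f) * (z - z * f) := by
      have hz' : b = star z * z + star x * x := by rw [← hz]; abel
      rw [hz']
      simp only [star_sub, star_mul, hfs]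
      noncomm_ring
    rw [this]
    exact star_mul_self_nonneg _
  have e2 : b - b * f - f * b + f * b * f = cfcₙ (fun t => t * (1 - g t) ^ 2) b := by
    have a1 : b * f = cfcₙ (fun t => t * g t) b := mul_cfcₙ_eq hb.isSelfAdjoint hgc hg0
    have a2 : f * b = cfcₙ (fun t => g t * t) b := cfcₙ_mul_eq hb.isSelfAdjoint hgc hg0
    have a3 : f * b * f = cfcₙ (fun t => g t * t * g t) b := by
      rw [a2, ← cfcₙ_mul (fun t => g t * t) g b]
    have a4 : b = cfcₙ (fun t : ℝ => t) b := (cfcₙ_id' ℝ b).symm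
    rw [a3, a2, a1]
    conv_lhs => enter [1, 1, 1]; rw [a4]
    rw [← cfcₙ_sub (fun t => t) (fun t => t * g t) b (by fun_prop) rfl (by fun_prop) (by simp),
      ← cfcₙ_sub (fun t => t - t * g t) (fun t => g t * t) b (by fun_prop) (by simp) (by fun_prop)
        (by simp),
      ← cfcₙ_add (fun t => t - t * g t - g t * t) (fun t => g t * t * g t) b (by fun_prop)
        (by simp) (by fun_prop) (by simp)]
    congr 1; ext t; ring
  calc ‖x - x * f‖ ^ 2 = ‖star (x - x * f) * (x - x * f)‖ := by
        rw [CStarRing.norm_star_mul_self, sq]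
    _ ≤ ‖cfcₙ (fun t => t * (1 - g t) ^ 2) b‖ := by
        rw [← e2]
        exact CStarAlgebra.norm_le_norm_of_nonneg_of_le (star_mul_self_nonneg _) e1
    _ ≤ 4 * δ := norm_cfcₙ_le fun t ht => by
        rw [hg, Real.norm_eq_abs]; exact unitFun_bound hδ (spec_nonneg hb ht)

/-- If `x⋆ x ≤ b`, then `x x⋆ ≾ b`. -/
lemma cuntzLE_of_star_mul_self_le {x b : C} (h : star x * x ≤ b) : CuntzLE (x * star x) b := by
  have hb : 0 ≤ b := (star_mul_self_nonneg x).trans h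
  let k : ℕ → C := fun n => cfcₙ (unitFun (1 / ((n : ℝ) + 1))) b
  have hk : ∀ n, star (k n) = k n := fun n => (cfcₙ_predicate _ b : IsSelfAdjoint _).star_eq
  refine ⟨fun n => x * k n, ?_⟩
  have h1 : Tendsto (fun n => x * (k n * b * k n)) atTop (𝓝 x) := by
    rw [tendsto_iff_norm_sub_tendsto_zero]
    have h2 : Tendsto (fun n : ℕ => Real.sqrt (4 * (1 / ((n : ℝ) + 1)))) atTop (𝓝 0) := by
      have := (Real.continuous_sqrt.tendsto (4 * 0)).comp
        (tendsto_one_div_add_atTop_nhds_zero_nat.const_mul (4 : ℝ))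
      simpa only [mul_zero, Real.sqrt_zero, Function.comp_def] using this
    refine squeeze_zero (fun _ => norm_nonneg _) (fun n => ?_) h2
    rw [norm_sub_rev]
    exact Real.le_sqrt_of_sq_le (norm_sub_mul_unit h (by positivity))
  have := h1.mul_const (star x)
  refine this.congr fun n => ?_
  simp only [star_mul, hk, mul_assoc]

lemma cuntzLE_of_le {a b : C} (ha : 0 ≤ a) (h : a ≤ b) : CuntzLE a b := by
  have hs := CFC.sqrt_mul_sqrt_self a ha
  have hsa : star (CFC.sqrt a) = CFC.sqrt a := (CFC.sqrt_nonneg a).isSelfAdjoint.star_eq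
  have := cuntzLE_of_star_mul_self_le (x := CFC.sqrt a) (b := b) (by rwa [hsa, hs])
  rwa [hsa, hs] at this

lemma cuntzLE_mul_star (x : C) : CuntzLE (x * star x) (star x * x) :=
  cuntzLE_of_star_mul_self_le le_rfl

lemma cuntzLE_conj (v b : C) : CuntzLE (v * b * star v) b := ⟨fun _ => v, tendsto_const_nhds⟩

lemma CuntzLE.smul_left {a b : C} (h : CuntzLE a b) {r : ℝ} (hr : 0 ≤ r) : CuntzLE (r • a) b := by
  obtain ⟨v, hv⟩ := h
  refine ⟨fun n => Real.sqrt r • v n, ?_⟩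
  refine (hv.const_smul r).congr fun n => ?_
  rw [star_smul, smul_mul_assoc, smul_mul_assoc, mul_smul_comm, smul_smul, star_trivial (√r),
    Real.mul_self_sqrt hr]

/-- The closedness of Cuntz subequivalence in its left argument. -/
lemma isClosed_cuntzLE (b : C) : IsClosed {a : C | CuntzLE a b} := by
  simp only [cuntzLE_iff_mem_closure]
  exact isClosed_closure

lemma cuntzLE_zero (b : C) : CuntzLE 0 b := ⟨fun _ => 0, by simp⟩

lemma CuntzLE.eq_zero {a : C} (h : CuntzLE a 0) : a = 0 := by
  obtain ⟨v, hv⟩ := h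
  simp only [mul_zero, zero_mul] at hv
  exact tendsto_nhds_unique hv tendsto_const_nhds

/-- Taking adjoints gives `x e = x` too, so `x = e x e`, which is at most `‖x‖ e e`. -/
lemma conj_le_smul {x e : C} (he : IsSelfAdjoint e) (hx : 0 ≤ x) (h : e * x = x) :
    x ≤ ‖x‖ • (e * e) := by
  have h2 : x * e = x := by
    have := congrArg star h
    rwa [star_mul, he.star_eq, hx.isSelfAdjoint.star_eq] at this
  have := CStarAlgebra.star_left_conjugate_le_norm_smul (a := e) (b := x) hx.isSelfAdjoint
  rwa [he.star_eq, h, h2] at this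

lemma cuntzLE_mul_self {e : C} (he : 0 ≤ e) : CuntzLE (e * e) e := by
  have hs := CFC.sqrt_mul_sqrt_self e he
  have hsa : star (CFC.sqrt e) = CFC.sqrt e := (CFC.sqrt_nonneg e).isSelfAdjoint.star_eq
  have : CFC.sqrt e * e * star (CFC.sqrt e) = e * e := by
    rw [hsa]
    calc CFC.sqrt e * e * CFC.sqrt e
        = CFC.sqrt e * (CFC.sqrt e * CFC.sqrt e) * CFC.sqrt e := by rw [hs]
      _ = (CFC.sqrt e * CFC.sqrt e) * (CFC.sqrt e * CFC.sqrt e) := by simp only [mul_assoc]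
      _ = e * e := by rw [hs]
  rw [← this]; exact cuntzLE_conj _ _

/-- If `e` is a left unit of `x`, then `x ≾ e`. -/
lemma cuntzLE_of_mul_eq {x e : C} (he : 0 ≤ e) (hx : 0 ≤ x) (h : e * x = x) : CuntzLE x e :=
  (cuntzLE_of_le hx (conj_le_smul he.isSelfAdjoint hx h)).trans
    ((cuntzLE_mul_self he).smul_left (norm_nonneg _))

/-- The element `(a - ε)₊`. -/
def cut (a : C) (ε : ℝ) : C := cfcₙ (fun t : ℝ => max (t - ε) 0) a

lemma cut_nonneg (a : C) (ε : ℝ) : 0 ≤ cut a ε := cfcₙ_nonneg fun _ _ => le_max_right _ _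

lemma cut_le {a : C} (ha : 0 ≤ a) {ε : ℝ} (hε : 0 ≤ ε) : cut a ε ≤ a := by
  conv_rhs => rw [← cfcₙ_id' ℝ a]
  refine cfcₙ_mono (fun t ht => max_le (by linarith) (spec_nonneg ha ht)) (by fun_prop)
    (by fun_prop) (by simpa using hε) rfl

lemma cut_anti {a : C} {ε δ : ℝ} (hε : 0 ≤ ε) (h : ε ≤ δ) : cut a δ ≤ cut a ε :=
  cfcₙ_mono (fun t _ => max_le_max (by linarith) le_rfl) (by fun_prop)
    (by fun_prop) (by simpa using hε.trans h) (by simpa using hε)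

lemma cut_cut {a : C} (ha : 0 ≤ a) {ε δ : ℝ} (hε : 0 ≤ ε) (hδ : 0 ≤ δ) :
    cut (cut a ε) δ = cut a (ε + δ) := by
  have := ha.isSelfAdjoint
  unfold cut
  rw [← cfcₙ_comp (fun t : ℝ => max (t - δ) 0) (fun t : ℝ => max (t - ε) 0) a (by fun_prop)
    (by simpa using hδ) (by fun_prop) (by simpa using hε)]
  congr 1; ext t
  simp only [Function.comp]
  rcases le_total (t - ε) 0 with h | h
  · rw [max_eq_right h, max_eq_right (by linarith), max_eq_right (by linarith)]
  · rw [max_eq_left h, sub_sub]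

lemma norm_sub_cut_le {a : C} (ha : 0 ≤ a) {ε : ℝ} (hε : 0 ≤ ε) : ‖a - cut a ε‖ ≤ ε := by
  have := ha.isSelfAdjoint
  have h : a - cut a ε = cfcₙ (fun t : ℝ => t - max (t - ε) 0) a := by
    conv_lhs => enter [1]; rw [← cfcₙ_id' ℝ a]
    unfold cut
    rw [← cfcₙ_sub (fun t : ℝ => t) _ a (by fun_prop) rfl (by fun_prop) (by simpa using hε)]
  rw [h]
  refine norm_cfcₙ_le fun t ht => ?_
  have := spec_nonneg ha ht
  rw [Real.norm_eq_abs, abs_le]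
  rcases le_total (t - ε) 0 with h | h
  · rw [max_eq_right h]; constructor <;> linarith
  · rw [max_eq_left h]; constructor <;> linarith

lemma cut_tendsto {a : C} (ha : 0 ≤ a) :
    Tendsto (fun n : ℕ => cut a (1 / ((n : ℝ) + 1))) atTop (𝓝 a) := by
  rw [tendsto_iff_norm_sub_tendsto_zero]
  refine squeeze_zero (fun _ => norm_nonneg _) (fun n => ?_) tendsto_one_div_add_atTop_nhds_zero_nat
  rw [norm_sub_rev]
  exact norm_sub_cut_le ha (by positivity)

/-- A form of Rørdam's lemma: if `a ≤ z + e` with `‖e‖ < ε`, then `(a - ε)₊ ≾ z`. -/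
lemma cut_cuntzLE_of_le_add {a z e : C} (ha : 0 ≤ a) (he : IsSelfAdjoint e)
    (h : a ≤ z + e) {ε : ℝ} (hε : ‖e‖ < ε) : CuntzLE (cut a ε) z := by
  have hε0 : 0 < ε := (norm_nonneg e).trans_lt hε
  set r := ‖e‖ with hr
  have hsa := ha.isSelfAdjoint
  have hkd : ∀ t : ℝ, 0 < max (t - r) (ε - r) := fun t => lt_max_of_lt_right (by linarith)
  -- With `q = k(a)` one gets `(a - ε)₊ = q (a - r) q ≤ q z q`, since `q e q ≤ r q q`. The maximum
  -- with `ε - r` keeps the denominator positive and changes nothing where `t ≥ ε`.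
  obtain ⟨k, hkc, hk0, hk2⟩ : ∃ k : ℝ → ℝ, Continuous k ∧ k 0 = 0 ∧
      ∀ t, k t * k t * (t - r) = max (t - ε) 0 := by
    refine ⟨fun t => Real.sqrt (max (t - ε) 0 / max (t - r) (ε - r)), ?_, ?_, fun t => ?_⟩
    · exact Real.continuous_sqrt.comp
        (Continuous.div (by fun_prop) (by fun_prop) fun t => (hkd t).ne')
    · simp only
      rw [max_eq_right (by linarith : (0 : ℝ) - ε ≤ 0)]; simp
    · simp only
      rw [Real.mul_self_sqrt (div_nonneg (le_max_right _ _) (hkd t).le)]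
      rcases le_total t ε with h | h
      · rw [max_eq_right (by linarith : t - ε ≤ 0)]; simp
      · rw [max_eq_left (by linarith : ε - r ≤ t - r), div_mul_cancel₀]
        intro h'; linarith
  set q := cfcₙ k a with hq
  have hqs : star q = q := (cfcₙ_predicate k a : IsSelfAdjoint _).star_eq
  have e1 : q * a * q - r • (q * q) = cut a ε := by
    rw [hq, cfcₙ_mul_eq hsa hkc hk0,
      ← cfcₙ_mul (fun t => k t * t) k a (by fun_prop) (by simp) (by fun_prop) hk0,
      ← cfcₙ_mul k k a (by fun_prop) hk0 (by fun_prop) hk0,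
      ← cfcₙ_smul r (fun t => k t * k t) a (by fun_prop) (by simp [hk0]),
      ← cfcₙ_sub (fun t => k t * t * k t) (fun t => r • (k t * k t)) a (by fun_prop)
        (by simp) (by fun_prop) (by simp [hk0])]
    unfold cut
    congr 1; ext t
    rw [← hk2, smul_eq_mul]; ring
  have e2 : q * e * q ≤ r • (q * q) := by
    have := CStarAlgebra.star_left_conjugate_le_norm_smul (a := q) (b := e) he
    rwa [hqs] at this
  have e3 : q * a * q ≤ q * (z + e) * q := by
    have := star_left_conjugate_le_conjugate h q
    rwa [hqs] at this
  have e4 : cut a ε ≤ q * z * star q := by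
    rw [← e1, hqs, sub_le_iff_le_add]
    refine e3.trans ?_
    rw [mul_add, add_mul]
    gcongr
  exact (cuntzLE_of_le (cut_nonneg _ _) e4).trans (cuntzLE_conj _ _)

lemma cut_cuntzLE_of_norm_sub_lt {a b : C} (ha : 0 ≤ a) (hb : IsSelfAdjoint b) {ε : ℝ}
    (h : ‖a - b‖ < ε) : CuntzLE (cut a ε) b :=
  cut_cuntzLE_of_le_add (e := a - b) ha (ha.isSelfAdjoint.sub hb) (by simp) h

lemma isSelfAdjoint_conj {b : C} (hb : IsSelfAdjoint b) (v : C) :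
    IsSelfAdjoint (v * b * star v) := hb.conjugate v

/-- If `a ≾ b`, then `(a - ε)₊ ≾ (b - δ)₊` for small `δ`. -/
lemma CuntzLE.exists_cut {a b : C} (ha : 0 ≤ a) (hb : 0 ≤ b) (h : CuntzLE a b) {ε : ℝ}
    (hε : 0 < ε) : ∃ δ > 0, ∀ δ' ≤ δ, 0 ≤ δ' → CuntzLE (cut a ε) (cut b δ') := by
  obtain ⟨v, hv⟩ := h
  obtain ⟨n, hn⟩ := ((tendsto_iff_norm_sub_tendsto_zero.1 hv).eventually
    (gt_mem_nhds (half_pos hε))).exists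
  set w := v n
  have hw : 0 < ‖w‖ * ‖w‖ + 1 := by positivity
  -- Replacing `b` by its cut-down moves `w b w⋆` by at most `‖w‖ δ ‖w‖ ≤ ε / 2`; the `+ 1` covers
  -- `w = 0`.
  refine ⟨ε / 2 / (‖w‖ * ‖w‖ + 1), by positivity, fun δ hδ hδ0 => ?_⟩
  refine (cut_cuntzLE_of_norm_sub_lt (b := w * cut b δ * star w) ha
    (isSelfAdjoint_conj (cut_nonneg _ _).isSelfAdjoint _) ?_).trans (cuntzLE_conj _ _)
  have e : a - w * cut b δ * star w = (a - w * b * star w) + w * (b - cut b δ) * star w := by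
    noncomm_ring
  rw [e]
  have h1 : ‖w * (b - cut b δ) * star w‖ ≤ ‖w‖ * δ * ‖w‖ := by
    refine (norm_mul_le _ _).trans ?_
    rw [norm_star]
    gcongr
    refine (norm_mul_le _ _).trans ?_
    gcongr
    exact norm_sub_cut_le hb hδ0
  have h2 : ‖w‖ * δ * ‖w‖ ≤ ε / 2 := by
    rw [le_div_iff₀ hw] at hδ
    nlinarith [norm_nonneg w]
  rw [norm_sub_rev] at hn
  exact (norm_add_le _ _).trans_lt (by linarith)

end Basics

/-! ### Orthogonal sums, perturbation and upper bounds in the stabilization. -/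

section StabSums

attribute [local instance] CStarAlgebra.spectralOrder CStarAlgebra.spectralOrderedRing

variable {A : Type*} [NonUnitalCStarAlgebra A]

lemma Stab.norm_shift (f g : ℕ ↪ ℕ) (x : Stab A) : ‖x.shift f g‖ = ‖x‖ := by
  refine Stab.ind (C := fun x => ‖x.shift f g‖ = ‖x‖)
    (isClosed_eq (by fun_prop) (by fun_prop)) (fun x => ?_) x
  rw [Stab.shift_incl, Stab.incl.norm_map, Stab.incl.norm_map, FinMat.norm_shift]

lemma Stab.even_ne_odd' (i j : ℕ) : Stab.odd i ≠ Stab.even j := (Cu.even_ne_odd j i).symm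

/-- Sums are bounded by direct sums. -/
lemma cuntzLE_add_dsum {a b : Stab A} (ha : 0 ≤ a) (hb : 0 ≤ b) :
    CuntzLE (a + b) (Stab.dsum a b) := by
  obtain ⟨v, hv⟩ := CuntzLE.refl ha
  obtain ⟨w, hw⟩ := CuntzLE.refl hb
  -- The row matrix `(v n, w n)` conjugates `a ⊕ b` to `v a v⋆ + w b w⋆`.
  refine ⟨fun n => (v n).shift (.refl ℕ) Stab.even + (w n).shift (.refl ℕ) Stab.odd, ?_⟩
  refine (hv.add hw).congr fun n => ?_
  have d1 := fun x y : Stab A => Stab.shift_mul_disjoint (.refl ℕ) Stab.even Stab.odd Stab.odd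
    Cu.even_ne_odd x y
  have d2 := fun x y : Stab A => Stab.shift_mul_disjoint (.refl ℕ) Stab.odd Stab.even Stab.even
    Stab.even_ne_odd' x y
  have d3 := fun x y : Stab A => Stab.shift_mul_disjoint (.refl ℕ) Stab.even Stab.odd (.refl ℕ)
    Cu.even_ne_odd x y
  have d4 := fun x y : Stab A => Stab.shift_mul_disjoint (.refl ℕ) Stab.odd Stab.even (.refl ℕ)
    Stab.even_ne_odd' x y
  simp only [Stab.dsum, star_add, Stab.star_shift, add_mul, mul_add, Stab.shift_mul, d1, d2, d3, d4,
    Stab.shift_refl, add_zero, zero_add]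

lemma sqrt_mul_eq_zero {C : Type*} [NonUnitalCStarAlgebra C] {a b : C} (ha : 0 ≤ a)
    (h : a * b = 0) : CFC.sqrt a * b = 0 := by
  have hs : star (CFC.sqrt a) = CFC.sqrt a := (CFC.sqrt_nonneg a).isSelfAdjoint.star_eq
  rw [← CStarRing.star_mul_self_eq_zero_iff, star_mul, hs, mul_assoc, ← mul_assoc (CFC.sqrt a),
    CFC.sqrt_mul_sqrt_self a ha, h, mul_zero]

/-- Direct sums of orthogonal elements are bounded by sums. -/
lemma cuntzLE_dsum_add {a b : Stab A} (ha : 0 ≤ a) (hb : 0 ≤ b) (h : a * b = 0) :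
    CuntzLE (Stab.dsum a b) (a + b) := by
  set p := CFC.sqrt a
  set q := CFC.sqrt b
  have hp : star p = p := (CFC.sqrt_nonneg a).isSelfAdjoint.star_eq
  have hq : star q = q := (CFC.sqrt_nonneg b).isSelfAdjoint.star_eq
  have hpp : p * p = a := CFC.sqrt_mul_sqrt_self a ha
  have hqq : q * q = b := CFC.sqrt_mul_sqrt_self b hb
  have hpb : p * b = 0 := sqrt_mul_eq_zero ha h
  have hqp : q * p = 0 := sqrt_mul_eq_zero hb (by
    have := congrArg star hpb
    rwa [star_mul, hp, hb.isSelfAdjoint.star_eq, star_zero] at this)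
  have hpq : p * q = 0 := by
    have := congrArg star hqp
    rwa [star_mul, hp, hq, star_zero] at this
  have d1 := fun x y : Stab A => Stab.shift_mul_disjoint (.refl ℕ) Stab.even Stab.odd (.refl ℕ)
    Cu.even_ne_odd x y
  have d2 := fun x y : Stab A => Stab.shift_mul_disjoint (.refl ℕ) Stab.odd Stab.even (.refl ℕ)
    Stab.even_ne_odd' x y
  -- For the column `x` with entries `p` and `q`, orthogonality makes `x x⋆` the diagonal matrix `a
  -- ⊕ b`, whereas `x⋆ x = a + b`.
  have := cuntzLE_mul_star (p.shift Stab.even (.refl ℕ) + q.shift Stab.odd (.refl ℕ))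
  simp only [star_add, Stab.star_shift, add_mul, mul_add, Stab.shift_mul, d1, d2, hp, hq, hpp, hqq,
    hpq, hqp, Stab.shift_refl, add_zero, zero_add, Stab.shift_zero] at this
  exact this

/-- A positive element below `b` can be approximated by elements equivalent to `b`. -/
lemma CuntzLE.exists_near {a b : Stab A} (hb : 0 ≤ b) (h : CuntzLE a b) {η : ℝ} (hη : 0 < η) :
    ∃ b' : Stab A, 0 ≤ b' ∧ CuntzLE b b' ∧ CuntzLE b' b ∧ ‖b' - a‖ < η := by
  obtain ⟨v, hv⟩ := h
  obtain ⟨n, hn⟩ := ((tendsto_iff_norm_sub_tendsto_zero.1 hv).eventually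
    (gt_mem_nhds (by positivity : 0 < η / 4))).exists
  set w := v n
  obtain ⟨x, hx⟩ := Metric.denseRange_iff.1
    (Stab.isDenseInducing_incl (A := A)).dense (w * b * star w) (η / 8) (by positivity)
  obtain ⟨k, M, rfl⟩ : ∃ k M, x = FinMat.mk k M := by
    induction x using FinMat.ind with | h k M => exact ⟨k, M, rfl⟩
  -- `f` fixes the first `k` indices, so it fixes `M` and moves `w b w⋆` only slightly, but it
  -- leaves free the infinitely many odd places listed by `g`.
  let f : ℕ ↪ ℕ := ⟨fun i => if i < k then i else 2 * i, fun i j hij => by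
    simp only at hij; split_ifs at hij <;> omega⟩
  let g : ℕ ↪ ℕ := ⟨fun i => 2 * (i + k) + 1, fun i j hij => by simpa using hij⟩
  have hf : ∀ i, f i = if i < k then i else 2 * i := fun _ => rfl
  have hg : ∀ i, g i = 2 * (i + k) + 1 := fun _ => rfl
  have hfg : ∀ i j, f i ≠ g j := by
    intro i j; rw [hf, hg]; split_ifs <;> omega
  have hgf : ∀ i j, g i ≠ f j := fun i j => (hfg j i).symm
  have hfx : (Stab.incl (FinMat.mk k M)).shift f f = Stab.incl (FinMat.mk k M) := by
    have hb' : ∀ i : Fin k, f i < k := fun i => by rw [hf, if_pos i.2]; exact i.2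
    rw [Stab.shift_incl, FinMat.shift_mk f f hb' hb']
    congr 2
    have : FinMat.trunc f hb' = Fin.castLE le_rfl := by
      ext i; show f i = i; rw [hf, if_pos i.2]
    rw [this]
    exact (corner_directedSystem A).map_self M
  set r := CFC.sqrt b
  have hr : star r = r := (CFC.sqrt_nonneg b).isSelfAdjoint.star_eq
  have hrr : r * r = b := CFC.sqrt_mul_sqrt_self b hb
  -- The `g` part adds a small orthogonal copy of `b`: `z⋆ z` lies between `τ ^ 2 b` and a multiple
  -- of `b`, so `z z⋆` is equivalent to `b`, and it tends to the shifted `w b w⋆` as `τ → 0`.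
  let z : ℝ → Stab A := fun τ => (w * r).shift f (.refl ℕ) + τ • r.shift g (.refl ℕ)
  have hz1 : ∀ τ, star (z τ) * z τ = r * star w * (w * r) + (τ * τ) • b := by
    intro τ
    have d1 := fun x y : Stab A => Stab.shift_mul_disjoint (.refl ℕ) f g (.refl ℕ) hfg x y
    have d2 := fun x y : Stab A => Stab.shift_mul_disjoint (.refl ℕ) g f (.refl ℕ) hgf x y
    simp only [z, star_add, star_smul, Stab.star_shift, add_mul, mul_add, smul_mul_assoc,
      mul_smul_comm, Stab.shift_mul, d1, d2, Stab.shift_refl, star_mul, hr, smul_zero, add_zero,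
      zero_add, smul_smul, hrr, star_trivial]
  have hz0 : z 0 * star (z 0) = (w * b * star w).shift f f := by
    simp only [z, zero_smul, add_zero, Stab.star_shift, Stab.shift_mul, star_mul, hr]
    rw [← hrr]; simp only [mul_assoc]
  have hcont : Continuous fun τ => z τ * star (z τ) := by
    have : Continuous z := by fun_prop
    fun_prop
  obtain ⟨τ, hτ0, hτ⟩ : ∃ τ > 0, ‖z τ * star (z τ) - z 0 * star (z 0)‖ < η / 4 := by
    obtain ⟨δ, hδ, h⟩ := Metric.continuous_iff.1 hcont 0 (η / 4) (by positivity)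
    refine ⟨δ / 2, by positivity, ?_⟩
    rw [← dist_eq_norm]
    refine h _ ?_
    rw [Real.dist_eq, sub_zero, abs_of_pos (by positivity)]; linarith
  refine ⟨z τ * star (z τ), mul_star_self_nonneg _, ?_, ?_, ?_⟩
  · have h1 : CuntzLE ((τ * τ) • b) (star (z τ) * z τ) := by
      refine cuntzLE_of_le (smul_nonneg (by positivity) hb) ?_
      rw [hz1, le_add_iff_nonneg_left]
      have := star_mul_self_nonneg (w * r)
      rwa [star_mul, hr] at this
    have h2 : CuntzLE (star (z τ) * z τ) (z τ * star (z τ)) := by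
      simpa using cuntzLE_mul_star (star (z τ))
    have h3 := (h1.trans h2).smul_left (r := (τ * τ)⁻¹) (by positivity)
    rwa [smul_smul, inv_mul_cancel₀ (by positivity), one_smul] at h3
  · refine (cuntzLE_mul_star (z τ)).trans ?_
    rw [hz1]
    have : r * star w * (w * r) + (τ * τ) • b ≤ (‖star w * w‖ + τ * τ) • b := by
      rw [add_smul]
      gcongr
      have := CStarAlgebra.star_left_conjugate_le_norm_smul (a := r) (b := star w * w)
        (IsSelfAdjoint.star_mul_self w)
      rwa [hr, hrr, mul_assoc, mul_assoc, ← mul_assoc] at this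
    refine (cuntzLE_of_le ?_ this).trans ((CuntzLE.refl hb).smul_left (by positivity))
    rw [← hz1]; exact star_mul_self_nonneg _
  · set y := Stab.incl (FinMat.mk k M)
    rw [hz0] at hτ
    have h1 : ‖(w * b * star w).shift f f - y‖ < η / 8 := by
      have h2 : (w * b * star w).shift f f - y = (w * b * star w - y).shift f f := by
        rw [sub_eq_iff_eq_add]; nth_rw 2 [← hfx]; rw [← Stab.shift_add]; simp
      rw [h2, Stab.norm_shift, ← dist_eq_norm]; exact hx
    have h3 : ‖y - w * b * star w‖ < η / 8 := by
      rw [← dist_eq_norm, dist_comm]; exact hx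
    have e : z τ * star (z τ) - a = (z τ * star (z τ) - (w * b * star w).shift f f) +
      ((w * b * star w).shift f f - y) + (y - w * b * star w) + (w * b * star w - a) := by abel
    rw [e]
    refine (norm_add_le _ _).trans_lt ?_
    have := norm_add₃_le (a := z τ * star (z τ) - (w * b * star w).shift f f)
      (b := (w * b * star w).shift f f - y) (c := y - w * b * star w)
    linarith

/-- A single `θ` serves finitely many elements at once, as the inductive construction of upper
bounds requires. -/
lemma exists_forall_cut {a : ℕ → Stab A} (ha : ∀ n, 0 ≤ a n) {c : Stab A} (hc : 0 ≤ c) (n : ℕ)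
    (h : ∀ k ≤ n, CuntzLE (a k) c) {ε : ℝ} (hε : 0 < ε) :
    ∃ θ > 0, ∀ k ≤ n, CuntzLE (cut (a k) ε) (cut c θ) := by
  induction n with
  | zero =>
    obtain ⟨δ, hδ, h'⟩ := (h 0 le_rfl).exists_cut (ha 0) hc hε
    exact ⟨δ, hδ, fun k hk => by rw [Nat.le_zero.1 hk]; exact h' δ le_rfl hδ.le⟩
  | succ n ih =>
    obtain ⟨θ, hθ, h1⟩ := ih fun k hk => h k (by omega)
    obtain ⟨δ, hδ, h'⟩ := (h (n + 1) le_rfl).exists_cut (ha _) hc hε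
    refine ⟨min θ δ, lt_min hθ hδ, fun k hk => ?_⟩
    rcases Nat.le_succ_iff.1 hk with hk | rfl
    · exact (h1 k hk).trans (cuntzLE_of_le (cut_nonneg _ _)
        (cut_anti (lt_min hθ hδ).le (min_le_left _ _)))
    · exact h' _ (min_le_right _ _) (lt_min hθ hδ).le

/-- Every increasing sequence of positive elements has an upper bound whose cut-downs are
dominated by the terms of the sequence. -/
lemma exists_upper_bound {a : ℕ → Stab A} (ha : ∀ n, 0 ≤ a n)
    (h : ∀ k n, k ≤ n → CuntzLE (a k) (a n)) :
    ∃ c : Stab A, 0 ≤ c ∧ (∀ n, CuntzLE (a n) c) ∧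
      ∀ ε > 0, ∃ n, CuntzLE (cut c ε) (a n) := by
  -- Representatives of the classes of the `a n` are chosen recursively so as to converge in norm.
  -- The tolerance `p.2` records how far the limit may be from `p.1` while still dominating the
  -- cut-downs of the earlier terms. Steps shorter than a quarter of it, with halving tolerances,
  -- keep the limit within half of it.
  let P : ℕ → Stab A × ℝ → Prop := fun n p => 0 ≤ p.1 ∧ CuntzLE p.1 (a n) ∧ CuntzLE (a n) p.1 ∧
    0 < p.2 ∧ ∀ k ≤ n, CuntzLE (cut (a k) (1 / ((n : ℝ) + 1))) (cut p.1 p.2)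
  have h0 : ∃ p, P 0 p := by
    obtain ⟨θ, hθ, h'⟩ := exists_forall_cut ha (ha 0) 0 (fun k hk => h k 0 hk)
      (ε := 1 / (((0 : ℕ) : ℝ) + 1)) (by positivity)
    exact ⟨(a 0, θ), ha 0, CuntzLE.refl (ha 0), CuntzLE.refl (ha 0), hθ, h'⟩
  have hstep : ∀ n p, P n p → ∃ q, P (n + 1) q ∧ ‖q.1 - p.1‖ < p.2 / 4 ∧ q.2 ≤ p.2 / 2 := by
    rintro n p ⟨h1, h2, h3, h4, h5⟩
    obtain ⟨b, hb0, hb1, hb2, hb3⟩ := (h2.trans (h n (n + 1) n.le_succ)).exists_near (ha (n + 1))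
      (η := p.2 / 4) (by positivity)
    obtain ⟨θ, hθ, h'⟩ := exists_forall_cut ha hb0 (n + 1)
      (fun k hk => (h k (n + 1) hk).trans hb1)
      (ε := 1 / (((n + 1 : ℕ) : ℝ) + 1)) (by positivity)
    have hm : 0 < min θ (p.2 / 2) := lt_min hθ (by positivity)
    refine ⟨(b, min θ (p.2 / 2)), ⟨hb0, hb2, hb1, hm, fun k hk => (h' k hk).trans ?_⟩, hb3,
      min_le_right _ _⟩
    exact cuntzLE_of_le (cut_nonneg _ _) (cut_anti hm.le (min_le_left _ _))
  obtain ⟨p0, hp0⟩ := h0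
  choose! F hF using hstep
  let p : ℕ → Stab A × ℝ := fun n => Nat.rec p0 F n
  have hp : ∀ n, P n (p n) := by
    intro n
    induction n with
    | zero => exact hp0
    | succ n ih => exact (hF n (p n) ih).1
  have hd : ∀ n, ‖(p (n + 1)).1 - (p n).1‖ < (p n).2 / 4 := fun n => (hF n (p n) (hp n)).2.1
  have hθ : ∀ n, (p (n + 1)).2 ≤ (p n).2 / 2 := fun n => (hF n (p n) (hp n)).2.2
  have hθ2 : ∀ n k, (p (n + k)).2 ≤ (p n).2 * (1 / 2) ^ k := by
    intro n k
    induction k with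
    | zero => simp
    | succ k ih =>
      refine (hθ (n + k)).trans ?_
      rw [pow_succ]; linarith
  have hcau : CauchySeq fun n => (p n).1 := by
    refine cauchySeq_of_le_geometric (1 / 2) ((p 0).2 / 4) (by norm_num) fun n => ?_
    rw [dist_comm, dist_eq_norm]
    have := hθ2 0 n
    rw [zero_add] at this
    have := hd n
    linarith
  obtain ⟨c, hc⟩ := cauchySeq_tendsto_of_complete hcau
  have hclose : ∀ n, ‖(p n).1 - c‖ < (p n).2 := by
    intro n
    have : dist (p (n + 0)).1 c ≤ ((p n).2 / 4) / (1 - 1 / 2) := by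
      refine dist_le_of_le_geometric_of_tendsto₀ (f := fun k => (p (n + k)).1) (1 / 2) ((p n).2 / 4)
        (by norm_num) (fun k => ?_) ?_
      · rw [dist_comm, dist_eq_norm]
        have := hθ2 n k
        have := hd (n + k)
        rw [← add_assoc]
        linarith
      · simpa only [add_comm n] using (tendsto_add_atTop_iff_nat n).2 hc
    rw [add_zero, dist_eq_norm, show (p n).2 / 4 / (1 - 1 / 2) = (p n).2 / 2 by ring] at this
    exact this.trans_lt (half_lt_self (hp n).2.2.2.1)
  have hc0 : 0 ≤ c := CStarAlgebra.isClosed_nonneg.mem_of_tendsto hc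
    (Eventually.of_forall fun n => (hp n).1)
  refine ⟨c, hc0, fun k => ?_, fun ε hε => ?_⟩
  · have hk : ∀ᶠ n : ℕ in atTop, cut (a k) (1 / ((n : ℝ) + 1)) ∈ {x | CuntzLE x c} := by
      filter_upwards [eventually_ge_atTop k] with n hn
      exact ((hp n).2.2.2.2 k hn).trans
        (cut_cuntzLE_of_norm_sub_lt (hp n).1 hc0.isSelfAdjoint (hclose n))
    exact (isClosed_cuntzLE c).mem_of_tendsto (cut_tendsto (ha k)) hk
  · obtain ⟨n, hn⟩ := ((tendsto_iff_norm_sub_tendsto_zero.1 hc).eventually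
      (gt_mem_nhds hε)).exists
    rw [norm_sub_rev] at hn
    exact ⟨n, (cut_cuntzLE_of_norm_sub_lt hc0 (hp n).1.isSelfAdjoint hn).trans (hp n).2.1⟩

end StabSums

/-! ### The way below relation in the Cuntz semigroup. -/

section CuWayBelow

attribute [local instance] CStarAlgebra.spectralOrder CStarAlgebra.spectralOrderedRing

variable {A : Type*} [NonUnitalCStarAlgebra A]

/-- The cut-down of a positive element. -/
def StabPos.cut (a : StabPos A) (ε : ℝ) : StabPos A := ⟨CuntzSemigroup.cut a.val ε, cut_nonneg _ _⟩

namespace Cu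

lemma zero_le' (x : Cu A) : 0 ≤ x := by
  induction x using ind with | h a
  exact cuntzLE_zero _

lemma cls_eq_zero_iff {a : StabPos A} : cls a = 0 ↔ a.val = 0 := by
  constructor
  · exact fun h => (cls_eq_cls.1 h).1.eq_zero
  · intro h
    refine cls_eq_cls.2 ⟨?_, cuntzLE_zero _⟩
    rw [h]; exact cuntzLE_zero _

lemma exists_cls (x : Cu A) : ∃ a, cls a = x := by
  induction x using ind with | h a
  exact ⟨a, rfl⟩

lemma exists_upper_bound {f : ℕ → Cu A} (hf : Monotone f) :
    ∃ c : StabPos A, (∀ n, f n ≤ cls c) ∧ ∀ ε > 0, ∃ n, cls (c.cut ε) ≤ f n := by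
  choose b hb using fun n => exists_cls (f n)
  have hmono : ∀ k n, k ≤ n → CuntzLE (b k).val (b n).val := fun k n hkn => by
    rw [← cls_le_cls, hb, hb]; exact hf hkn
  obtain ⟨c, hc0, hc1, hc2⟩ := CuntzSemigroup.exists_upper_bound (fun n => (b n).nonneg) hmono
  refine ⟨⟨c, hc0⟩, fun n => ?_, fun ε hε => ?_⟩
  · rw [← hb]; exact cls_le_cls.2 (hc1 n)
  · obtain ⟨n, hn⟩ := hc2 ε hε
    exact ⟨n, by rw [← hb]; exact cls_le_cls.2 hn⟩

lemma exists_cut_le_cut {a b : StabPos A} (h : cls a ≤ cls b) {ε : ℝ} (hε : 0 < ε) :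
    ∃ δ > 0, cls (a.cut ε) ≤ cls (b.cut δ) := by
  obtain ⟨δ, hδ, h'⟩ := CuntzLE.exists_cut a.nonneg b.nonneg (cls_le_cls.1 h) hε
  exact ⟨δ, hδ, cls_le_cls.2 (h' δ le_rfl hδ.le)⟩

/-- The cut-downs of `a` are way below `a`. -/
lemma wayBelow_cls_cut (a : StabPos A) {ε : ℝ} (hε : 0 < ε) : WayBelow (cls (a.cut ε)) (cls a) := by
  intro f hf s hs has
  obtain ⟨c, hc1, hc2⟩ := exists_upper_bound hf
  -- That `c` is an upper bound suffices: a cut-down of `a` lies below a cut-down of `c`, hence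
  -- below a term of the sequence.
  have hsc : s ≤ cls c := hs.2 (by rintro _ ⟨n, rfl⟩; exact hc1 n)
  obtain ⟨δ, hδ, h⟩ := exists_cut_le_cut (has.trans hsc) hε
  obtain ⟨n, hn⟩ := hc2 δ hδ
  exact ⟨n, h.trans hn⟩

/-- A multiple of a class has a representative depending continuously on the element, so norm limits
can be taken inside multiples. -/
lemma exists_nsmul_rep (A : Type*) [NonUnitalCStarAlgebra A] (n : ℕ) :
    ∃ F : Stab A → Stab A, Continuous F ∧
      ∀ a : StabPos A, ∃ h : 0 ≤ F a.val, cls ⟨F a.val, h⟩ = n • cls a := by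
  induction n with
  | zero => exact ⟨fun _ => 0, continuous_const, fun a => ⟨le_rfl, by rw [zero_smul]; rfl⟩⟩
  | succ n ih =>
    obtain ⟨F, hF, h⟩ := ih
    refine ⟨fun x => Stab.dsum (F x) x, by unfold Stab.dsum; fun_prop, fun a => ?_⟩
    obtain ⟨h1, h2⟩ := h a
    refine ⟨Stab.dsum_nonneg h1 a.nonneg, ?_⟩
    rw [succ_nsmul, ← h2]; rfl

/-- The cut-downs converge in norm to `c`, and Cuntz subequivalence is closed in its left argument.
-/
lemma isLUB_nsmul_cut (n : ℕ) (c : StabPos A) :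
    IsLUB (Set.range fun k : ℕ => n • cls (c.cut (1 / ((k : ℝ) + 1)))) (n • cls c) := by
  obtain ⟨F, hF, h⟩ := exists_nsmul_rep A n
  constructor
  · rintro _ ⟨k, rfl⟩
    refine nsmul_le_nsmul_right ?_ n
    exact cuntzLE_of_le (cut_nonneg _ _) (cut_le c.nonneg (by positivity))
  · intro z hz
    induction z using ind with | h z
    obtain ⟨h1, h2⟩ := h c
    rw [← h2]
    refine (isClosed_cuntzLE z.val).mem_of_tendsto ((hF.tendsto _).comp (cut_tendsto c.nonneg))
      (Eventually.of_forall fun k => ?_)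
    obtain ⟨h3, h4⟩ := h (c.cut (1 / ((k : ℝ) + 1)))
    have := hz ⟨k, rfl⟩
    simp only [← h4] at this
    exact this

lemma cls_cut_anti (c : StabPos A) {ε δ : ℝ} (hε : 0 ≤ ε) (h : ε ≤ δ) :
    cls (c.cut δ) ≤ cls (c.cut ε) := cuntzLE_of_le (cut_nonneg _ _) (cut_anti hε h)

/-- The relation `≪` is tested on the increasing sequence of `isLUB_nsmul_cut`. -/
lemma exists_le_nsmul_cut {x' x : Cu A} (h : WayBelow x' x) (n : ℕ) (c : StabPos A)
    (hx : x ≤ n • cls c) : ∃ ε > 0, x' ≤ n • cls (c.cut ε) := by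
  obtain ⟨k, hk⟩ := h (fun k : ℕ => n • cls (c.cut (1 / ((k : ℝ) + 1)))) (fun i j hij => by
    refine nsmul_le_nsmul_right (cls_cut_anti c (by positivity) ?_) n
    gcongr) _ (isLUB_nsmul_cut n c) hx
  exact ⟨_, by positivity, hk⟩

lemma wayBelow_cut_cut (a : StabPos A) {ε δ : ℝ} (hε : 0 < ε) (h : ε < δ) :
    WayBelow (cls (a.cut δ)) (cls (a.cut ε)) := by
  have := wayBelow_cls_cut (a.cut ε) (sub_pos.2 h)
  have e : (a.cut ε).cut (δ - ε) = a.cut δ := by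
    simp only [StabPos.cut, cut_cut a.nonneg hε.le (sub_pos.2 h).le]
    congr 2; ring
  rwa [e] at this

lemma _root_.CuntzSemigroup.WayBelow.le {S : Type*} [PartialOrder S] {x y : S} (h : WayBelow x y) :
    x ≤ y := by
  obtain ⟨_, h⟩ := h (fun _ => y) monotone_const y (by simp) le_rfl
  exact h

lemma _root_.CuntzSemigroup.WayBelow.mono {S : Type*} [PartialOrder S] {w x y z : S}
    (h : WayBelow x y)
    (hw : w ≤ x) (hz : y ≤ z) : WayBelow w z := fun f hf s hs hzs => by
  obtain ⟨n, hn⟩ := h f hf s hs (hz.trans hzs)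
  exact ⟨n, hw.trans hn⟩

lemma _root_.CuntzSemigroup.WayBelow.exists_cut {x : Cu A} {a : StabPos A}
    (h : WayBelow x (cls a)) :
    ∃ ε > 0, WayBelow x (cls (a.cut ε)) := by
  obtain ⟨ε, hε, hx⟩ := exists_le_nsmul_cut h 1 a (by rw [one_smul])
  rw [one_smul] at hx
  -- Halving `ε` turns the inequality back into `≪`.
  exact ⟨ε / 2, by positivity, (wayBelow_cut_cut a (half_pos hε) (half_lt_self hε)).mono hx le_rfl⟩

lemma _root_.CuntzSemigroup.WayBelow.exists_between {x z : Cu A} (h : WayBelow x z) :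
    ∃ y, WayBelow x y ∧ WayBelow y z := by
  induction z using ind with | h a
  obtain ⟨ε, hε, hx⟩ := h.exists_cut
  exact ⟨_, hx, wayBelow_cls_cut a hε⟩

lemma cls_add_le {a b : Stab A} (ha : 0 ≤ a) (hb : 0 ≤ b) (hab : 0 ≤ a + b) :
    cls ⟨a + b, hab⟩ ≤ cls ⟨a, ha⟩ + cls ⟨b, hb⟩ := cuntzLE_add_dsum ha hb

lemma le_cls_add {a b : Stab A} (ha : 0 ≤ a) (hb : 0 ≤ b) (hab : 0 ≤ a + b) (h : a * b = 0) :
    cls ⟨a, ha⟩ + cls ⟨b, hb⟩ ≤ cls ⟨a + b, hab⟩ := cuntzLE_dsum_add ha hb h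

end Cu
end CuWayBelow

/-! ### Orthogonal elements in hereditary subalgebras, and making room. -/

section Room

attribute [local instance] CStarAlgebra.spectralOrder CStarAlgebra.spectralOrderedRing

/-- Primeness, in terms of elements. -/
def IsPrimeAlg (C : Type*) [NonUnitalCStarAlgebra C] : Prop :=
  ∀ x y : C, (∀ z, x * z * y = 0) → x = 0 ∨ y = 0

/-- The absence of minimal projections: no corner `a C a` with `a ≥ 0` is one-dimensional. -/
def NoMinimal (C : Type*) [NonUnitalCStarAlgebra C] : Prop :=
  ∀ a : C, 0 ≤ a → a ≠ 0 → ∃ x, ∀ c : ℂ, a * x * a ≠ c • a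

variable {C : Type*} [NonUnitalCStarAlgebra C]

lemma mul_self_eq_smul {y : C} (hy : IsSelfAdjoint y) {s : ℝ}
    (h : ∀ t ∈ quasispectrum ℝ y, t = 0 ∨ t = s) : y * y = s • y := by
  have e : y = cfcₙ (fun t : ℝ => t) y := (cfcₙ_id' ℝ y).symm
  have h1 : y * y = cfcₙ (fun t : ℝ => t * t) y := by
    conv_lhs => rw [e]
    rw [← cfcₙ_mul (fun t : ℝ => t) (fun t => t) y (by fun_prop) rfl (by fun_prop) rfl]
  have h2 : s • y = cfcₙ (fun t : ℝ => s • t) y := by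
    conv_lhs => rw [e]
    rw [← cfcₙ_smul s (fun t : ℝ => t) y (by fun_prop) rfl]
  rw [h1, h2]
  refine cfcₙ_congr fun t ht => ?_
  rcases h t ht with rfl | rfl <;> simp

/-- A self-adjoint element with two distinct nonzero spectral values has two orthogonal nonzero
positive compressions. -/
lemma exists_orthogonal_of_spectrum {y : C} (hy : IsSelfAdjoint y) {s t : ℝ} (hs : s ≠ 0)
    (ht : t ≠ 0) (hst : s ≠ t) (hs' : s ∈ quasispectrum ℝ y) (ht' : t ∈ quasispectrum ℝ y) :
    ∃ g₁ g₂ : C, 0 ≤ y * g₁ * y ∧ 0 ≤ y * g₂ * y ∧ y * g₁ * y ≠ 0 ∧ y * g₂ * y ≠ 0 ∧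
      (y * g₁ * y) * (y * g₂ * y) = 0 := by
  -- Tent functions of radius `r` around `s` and `t` then vanish at `0` and have disjoint supports.
  obtain ⟨r, hr0, hrs, hrt, hr⟩ : ∃ r > 0, r ≤ |s| ∧ r ≤ |t| ∧ 2 * r ≤ |s - t| :=
    ⟨min (min |s| |t|) (|s - t| / 2), by
      have := abs_pos.2 (sub_ne_zero.2 hst)
      have := abs_pos.2 hs
      have := abs_pos.2 ht
      positivity,
      (min_le_left _ _).trans (min_le_left _ _), (min_le_left _ _).trans (min_le_right _ _), by
      linarith [min_le_right (min |s| |t|) (|s - t| / 2)]⟩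
  have key : ∀ σ : ℝ, r ≤ |σ| →
      y * cfcₙ (fun τ => max (r - |τ - σ|) 0) y * y =
        cfcₙ (fun τ => τ * max (r - |τ - σ|) 0 * τ) y := by
    intro σ hσ
    have h0 : max (r - |(0 : ℝ) - σ|) 0 = 0 := by
      rw [zero_sub, abs_neg]; exact max_eq_right (by linarith)
    rw [mul_cfcₙ_eq (f := fun τ => max (r - |τ - σ|) 0) hy (by fun_prop) h0,
      cfcₙ_mul_eq hy (by fun_prop) (by simp)]
  have hne : ∀ σ : ℝ, r ≤ |σ| → σ ≠ 0 → σ ∈ quasispectrum ℝ y →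
      cfcₙ (fun τ => τ * max (r - |τ - σ|) 0 * τ) y ≠ 0 := by
    intro σ hσ h0 hmem h
    have := norm_apply_le_norm_cfcₙ (fun τ : ℝ => τ * max (r - |τ - σ|) 0 * τ) y hmem
      (by fun_prop) (by simp) hy
    rw [h, norm_zero, norm_le_zero_iff] at this
    simp [h0] at this
    linarith
  refine ⟨cfcₙ (fun τ => max (r - |τ - s|) 0) y, cfcₙ (fun τ => max (r - |τ - t|) 0) y, ?_⟩
  rw [key s hrs, key t hrt]
  have hpos : ∀ σ τ : ℝ, 0 ≤ τ * max (r - |τ - σ|) 0 * τ := fun σ τ => by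
    have : τ * max (r - |τ - σ|) 0 * τ = max (r - |τ - σ|) 0 * (τ * τ) := by ring
    rw [this]; exact mul_nonneg (le_max_right _ _) (mul_self_nonneg _)
  refine ⟨cfcₙ_nonneg fun τ _ => hpos s τ, cfcₙ_nonneg fun τ _ => hpos t τ, hne s hrs hs hs',
    hne t hrt ht ht', ?_⟩
  rw [← cfcₙ_mul (fun τ => τ * max (r - |τ - s|) 0 * τ) (fun τ => τ * max (r - |τ - t|) 0 * τ) y
    (by fun_prop) (by simp) (by fun_prop) (by simp)]
  have : (fun τ : ℝ => τ * max (r - |τ - s|) 0 * τ * (τ * max (r - |τ - t|) 0 * τ)) =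
      fun _ => 0 := by
    ext τ
    have h3 : |s - t| ≤ |τ - s| + |τ - t| := by
      rw [abs_sub_comm τ s]
      calc |s - t| = |(s - τ) + (τ - t)| := by congr 1; ring
        _ ≤ _ := abs_add_le _ _
    rcases le_total r |τ - s| with h | h
    · rw [max_eq_right (a := r - |τ - s|) (by linarith)]; ring
    · rw [max_eq_right (a := r - |τ - t|) (by linarith)]; ring
  rw [this, cfcₙ_const_zero]

/-- Without minimal projections, every nonzero hereditary subalgebra contains two orthogonal
nonzero positive elements. -/
lemma NoMinimal.exists_orthogonal (hC : NoMinimal C) {b : C} (hb : 0 ≤ b) (hb0 : b ≠ 0) :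
    ∃ t₁ t₂ : C, 0 ≤ b * t₁ * b ∧ 0 ≤ b * t₂ * b ∧ b * t₁ * b ≠ 0 ∧ b * t₂ * b ≠ 0 ∧
      (b * t₁ * b) * (b * t₂ * b) = 0 := by
  by_contra! H
  -- If no orthogonal pair exists, each self-adjoint `y` with `y C y ⊆ b C b` has at most one
  -- nonzero spectral value, hence is a real multiple of a projection or has square zero.
  have key : ∀ y : C, IsSelfAdjoint y → (∀ g, ∃ t, y * g * y = b * t * b) →
      ∃ s : ℝ, y * y = s • y := by
    intro y hy hyg
    have huniq : ∀ s t : ℝ, s ≠ 0 → t ≠ 0 → s ∈ quasispectrum ℝ y → t ∈ quasispectrum ℝ y →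
        s = t := by
      intro s t hs ht hs' ht'
      by_contra hst
      obtain ⟨g₁, g₂, h1, h2, h3, h4, h5⟩ := exists_orthogonal_of_spectrum hy hs ht hst hs' ht'
      obtain ⟨t₁, e1⟩ := hyg g₁
      obtain ⟨t₂, e2⟩ := hyg g₂
      rw [e1] at h1 h3 h5
      rw [e2] at h2 h4 h5
      exact H t₁ t₂ h1 h2 h3 h4 h5
    by_cases hex : ∃ s ∈ quasispectrum ℝ y, s ≠ 0
    · obtain ⟨s, hs, hs0⟩ := hex
      refine ⟨s, mul_self_eq_smul hy fun t ht => ?_⟩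
      by_cases ht0 : t = 0
      · exact Or.inl ht0
      · exact Or.inr (huniq t s ht0 hs0 ht hs)
    · push Not at hex
      exact ⟨0, mul_self_eq_smul hy fun t ht => Or.inl (hex t ht)⟩
  have hbs := hb.isSelfAdjoint
  obtain ⟨β, hβ⟩ := key b hbs fun g => ⟨g, rfl⟩
  have hβ0 : β ≠ 0 := by
    rintro rfl
    rw [zero_smul] at hβ
    apply hb0
    rw [← CStarRing.star_mul_self_eq_zero_iff, hbs.star_eq, hβ]
  have hsa : ∀ x : C, IsSelfAdjoint x → ∃ c : ℝ, b * x * b = c • b := by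
    intro x hx
    set y := b * x * b with hy
    have hys : IsSelfAdjoint y := by
      have := hx.conjugate b
      rwa [hbs.star_eq] at this
    have hby : b * y = β • y := by
      rw [hy, ← mul_assoc, ← mul_assoc, hβ, smul_mul_assoc, smul_mul_assoc]
    have hyb : y * b = β • y := by
      rw [hy, mul_assoc, hβ, mul_smul_comm]
    -- Applying `key` to the whole line `y + r b` makes all these elements quadratic, which is too
    -- rigid unless `y` is a multiple of `b`.
    have hr : ∀ r : ℝ, ∃ σ' : ℝ, (y + r • b) * (y + r • b) = σ' • (y + r • b) := by
      intro r
      refine key _ (hys.add ((IsSelfAdjoint.all r).smul hbs)) fun g =>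
        ⟨x * b * g * b * x + r • (x * b * g) + r • (g * b * x) + (r * r) • g, ?_⟩
      rw [hy]
      simp only [mul_add, add_mul, mul_smul_comm, smul_mul_assoc, smul_smul, mul_assoc, smul_add]
      abel
    obtain ⟨σ, hσ⟩ := hr 0
    simp only [zero_smul, add_zero] at hσ
    by_contra hno
    push Not at hno
    -- If `y` is not a multiple of `b`, the coefficients of `y` and `b` in `(y + r b) ^ 2 = σ' (y +
    -- r b)` give `σ' = σ + 2 r β` and `σ' = r β`. Then `σ = - r β` for both `r = 1` and `r = 2`
    -- forces `β = 0`.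
    have hrr : ∀ r : ℝ, r ≠ 0 → σ = - r * β := by
      intro r hr0
      obtain ⟨σ', hσ'⟩ := hr r
      have e : (σ + 2 * r * β - σ') • y = (σ' * r - r * r * β) • b := by
        have e1 : (y + r • b) * (y + r • b) = σ • y + (2 * r * β) • y + (r * r * β) • b := by
          simp only [mul_add, add_mul, mul_smul_comm, smul_mul_assoc, smul_smul, hσ, hby, hyb, hβ]
          module
        rw [e1] at hσ'
        have : (σ + 2 * r * β - σ') • y - (σ' * r - r * r * β) • b =
            σ • y + (2 * r * β) • y + (r * r * β) • b - σ' • (y + r • b) := by module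
        rw [← sub_eq_zero, this, hσ', sub_self]
      have h1 : σ + 2 * r * β - σ' = 0 := by
        by_contra h1
        apply hno ((σ + 2 * r * β - σ')⁻¹ * (σ' * r - r * r * β))
        rw [mul_smul, ← e, smul_smul, inv_mul_cancel₀ h1, one_smul]
      rw [h1, zero_smul] at e
      have h2 : σ' * r - r * r * β = 0 := (smul_eq_zero.1 e.symm).resolve_right hb0
      have h3 : σ' = r * β := by
        have : r * (σ' - r * β) = 0 := by linarith
        have := (mul_eq_zero.1 this).resolve_left hr0
        linarith
      linarith
    have h1 := hrr 1 one_ne_zero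
    have h2 := hrr 2 two_ne_zero
    apply hβ0; linarith
  obtain ⟨x, hx⟩ := hC b hb hb0
  obtain ⟨c₁, h1⟩ := hsa (realPart x) (realPart x).2
  obtain ⟨c₂, h2⟩ := hsa (imaginaryPart x) (imaginaryPart x).2
  apply hx (c₁ + Complex.I * c₂)
  conv_lhs => rw [← realPart_add_I_smul_imaginaryPart x]
  rw [mul_add, add_mul, h1, mul_smul_comm, smul_mul_assoc, h2, add_smul, mul_smul]
  simp only [Complex.coe_smul]

/-- Every nonzero hereditary subalgebra contains an element `w` of norm one with `w⋆ w` and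
`w w⋆` orthogonal. -/
lemma exists_partial_isometry (hp : IsPrimeAlg C) (hC : NoMinimal C) {b e : C} (hb : 0 ≤ b)
    (hb0 : b ≠ 0) (he : e * b = b) :
    ∃ w : C, ‖w‖ = 1 ∧ e * w = w ∧ e * star w = star w ∧ w * w = 0 := by
  obtain ⟨t₁, t₂, h1, h2, h3, h4, h5⟩ := hC.exists_orthogonal hb hb0
  have h6 := congrArg star h5
  rw [star_mul, h1.isSelfAdjoint.star_eq, h2.isSelfAdjoint.star_eq, star_zero] at h6
  have e1 : e * (b * t₁ * b) = b * t₁ * b := by simp only [← mul_assoc, he]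
  have e2 : e * (b * t₂ * b) = b * t₂ * b := by simp only [← mul_assoc, he]
  generalize b * t₁ * b = u₁ at *
  generalize b * t₂ * b = u₂ at *
  -- Primeness connects the two orthogonal elements; `u₁ z u₂` has square zero because `u₂ u₁ = 0`.
  obtain ⟨z, hz⟩ : ∃ z, u₁ * z * u₂ ≠ 0 := by
    by_contra! h
    exact (hp u₁ u₂ h).elim h3 h4
  refine ⟨((‖u₁ * z * u₂‖⁻¹ : ℝ)) • (u₁ * z * u₂), ?_, ?_, ?_, ?_⟩
  · rw [norm_smul, norm_inv, norm_norm, inv_mul_cancel₀ (norm_ne_zero_iff.2 hz)]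
  · rw [mul_smul_comm, ← mul_assoc, ← mul_assoc, e1]
  · rw [star_smul, mul_smul_comm, star_mul, star_mul, h1.isSelfAdjoint.star_eq,
      h2.isSelfAdjoint.star_eq, ← mul_assoc, e2]
  · have : u₁ * z * u₂ * (u₁ * z * u₂) = 0 := by
      calc u₁ * z * u₂ * (u₁ * z * u₂) = u₁ * z * (u₂ * u₁) * z * u₂ := by simp only [mul_assoc]
        _ = 0 := by rw [h6]; simp
    rw [smul_mul_assoc, mul_smul_comm, this, smul_zero, smul_zero]

/-- The approximate unit `min (t / ε) 1` of the cut-down at `ε`. -/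
lemma exists_unit_of_cut {a : C} (ha : 0 ≤ a) {ε : ℝ} (hε : 0 < ε) :
    ∃ e : C, 0 ≤ e ∧ CuntzLE e a ∧ e * cut a ε = cut a ε ∧ e * e ≤ e := by
  have hsa := ha.isSelfAdjoint
  refine ⟨cfcₙ (fun t : ℝ => min (t / ε) 1) a, cfcₙ_nonneg fun t ht => ?_, ?_, ?_, ?_⟩
  · have := spec_nonneg ha ht
    positivity
  · have h1 : cfcₙ (fun t : ℝ => min (t / ε) 1) a ≤ ε⁻¹ • a := by
      have e : ε⁻¹ • a = cfcₙ (fun t : ℝ => ε⁻¹ • t) a := by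
        conv_lhs => rw [← cfcₙ_id' ℝ a]
        rw [← cfcₙ_smul ε⁻¹ (fun t : ℝ => t) a]
      rw [e]
      refine cfcₙ_mono fun t ht => (min_le_left _ _).trans_eq ?_
      rw [smul_eq_mul, div_eq_inv_mul]
    refine (cuntzLE_of_le (cfcₙ_nonneg fun t ht => ?_) h1).trans
      ((CuntzLE.refl ha).smul_left (by positivity))
    have := spec_nonneg ha ht
    positivity
  · unfold cut
    rw [← cfcₙ_mul (fun t : ℝ => min (t / ε) 1) (fun t : ℝ => max (t - ε) 0) a (by fun_prop)
      (by simp) (by fun_prop) (by simpa using hε.le)]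
    congr 1; ext t
    rcases le_total t ε with h | h
    · rw [max_eq_right (by linarith), mul_zero]
    · rw [min_eq_right ((one_le_div hε).2 h), one_mul]
  · rw [← cfcₙ_mul (fun t : ℝ => min (t / ε) 1) (fun t : ℝ => min (t / ε) 1) a (by fun_prop)
      (by simp) (by fun_prop) (by simp)]
    refine cfcₙ_mono fun t ht => ?_
    have := spec_nonneg ha ht
    have h0 : 0 ≤ min (t / ε) 1 := by positivity
    nlinarith [min_le_right (t / ε) 1]

/-- Every nonzero positive element dominates two orthogonal equivalent nonzero elements. -/
lemma exists_orthogonal_equivalent (hp : IsPrimeAlg C) (hC : NoMinimal C) {a : C} (ha : 0 ≤ a)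
    (ha0 : a ≠ 0) :
    ∃ w : C, w ≠ 0 ∧ CuntzLE (w * star w + star w * w) a ∧ (w * star w) * (star w * w) = 0 := by
  obtain ⟨ε, hε, hb0⟩ : ∃ ε > 0, cut a ε ≠ 0 := by
    by_contra! h
    exact ha0 (tendsto_nhds_unique (cut_tendsto ha) (by
      simp only [h _ (Nat.one_div_pos_of_nat), tendsto_const_nhds]))
  obtain ⟨e, he0, hea, heb, hee⟩ := exists_unit_of_cut ha hε
  obtain ⟨w, hw1, hew, hew', hww⟩ :=
    exists_partial_isometry hp hC (cut_nonneg a ε) hb0 heb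
  refine ⟨w, fun h => by simp [h] at hw1, ?_, ?_⟩
  · have h0 := add_nonneg (mul_star_self_nonneg w) (star_mul_self_nonneg w)
    refine (cuntzLE_of_mul_eq he0 h0 ?_).trans hea
    rw [mul_add, ← mul_assoc, ← mul_assoc, hew, hew']
  · have : star w * star w = 0 := by rw [← star_mul, hww, star_zero]
    rw [mul_assoc, ← mul_assoc (star w), this, zero_mul, mul_zero]

/-- Splitting off a nonzero orthogonal piece at the cost of doubling. -/
lemma exists_room (hp : IsPrimeAlg C) (hC : NoMinimal C) {a : C} (ha : 0 ≤ a) {ε : ℝ} (hε : 0 < ε)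
    (h0 : cut a ε ≠ 0) :
    ∃ c h k : C, 0 ≤ c ∧ 0 ≤ h ∧ 0 ≤ k ∧ k ≠ 0 ∧ c * k = 0 ∧ CuntzLE (c + k) a ∧
      CuntzLE (cut a ε) (c + h) ∧ CuntzLE h c := by
  obtain ⟨e, he0, hea, heb, hee⟩ := exists_unit_of_cut ha hε
  obtain ⟨w, hw1, hew, hew', hww⟩ :=
    exists_partial_isometry hp hC (cut_nonneg a ε) h0 heb
  obtain ⟨D, hD⟩ : ∃ D, D = w * star w := ⟨_, rfl⟩
  obtain ⟨H, hH⟩ : ∃ H, H = star w * w := ⟨_, rfl⟩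
  have hD0 : 0 ≤ D := hD ▸ mul_star_self_nonneg w
  have hH0 : 0 ≤ H := hH ▸ star_mul_self_nonneg w
  have hDs := hD0.isSelfAdjoint
  have hDn : ‖D‖ = 1 := by rw [hD, CStarRing.norm_self_mul_star, hw1, one_mul]
  have hDH : D * H = 0 := by
    have : star w * star w = 0 := by rw [← star_mul, hww, star_zero]
    rw [hD, hH, mul_assoc, ← mul_assoc (star w), this, zero_mul, mul_zero]
  have heD : e * D = D := by rw [hD, ← mul_assoc, hew]
  have heH : e * H = H := by rw [hH, ← mul_assoc, hew']
  have hmax : ∀ t : ℝ, 0 < max 1 (4 * t ^ 2) := fun t => lt_max_of_lt_left one_pos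
  -- The function `t g(t)` equals `1` for `t ≥ 1/2`, so `h` acts as a unit on `k = (D - 1/2)₊`, and
  -- it is at most `4 t ^ 2`, so `h ≾ D`. The factor `g` shows that `h` is a multiple of `D`, hence
  -- orthogonal to `H`.
  obtain ⟨g, hgc, hg0, hg⟩ : ∃ g : ℝ → ℝ, Continuous g ∧ g 0 = 0 ∧
      ∀ t, t * g t = 4 * t ^ 2 / max 1 (4 * t ^ 2) := by
    refine ⟨fun t => 4 * t / max 1 (4 * t ^ 2),
      Continuous.div (by fun_prop) (by fun_prop) fun t => (hmax t).ne', by simp, fun t => ?_⟩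
    ring
  set h := cfcₙ (fun t => t * g t) D with hh
  have hg_nonneg : ∀ t, 0 ≤ t * g t := fun t => by
    rw [hg]; exact div_nonneg (by positivity) (hmax t).le
  have hg_le_one : ∀ t, t * g t ≤ 1 := fun t => by
    rw [hg, div_le_one (hmax t)]; exact le_max_right _ _
  have hg_le_sq : ∀ t, t * g t ≤ 4 * t ^ 2 := fun t => by
    rw [hg]; exact div_le_self (by positivity) (le_max_left _ _)
  have hh0 : 0 ≤ h := cfcₙ_nonneg fun t _ => hg_nonneg t
  have hhD : h = D * cfcₙ g D := (mul_cfcₙ_eq hDs hgc hg0).symm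
  have hhD' : h = cfcₙ g D * D := by
    rw [cfcₙ_mul_eq hDs hgc hg0, hh]; congr 1; ext t; ring
  have heh : e * h = h := by rw [hhD, ← mul_assoc, heD]
  have hhe : h * e = h := by
    have := congrArg star heh
    rwa [star_mul, hh0.isSelfAdjoint.star_eq, he0.isSelfAdjoint.star_eq] at this
  have hhH : h * H = 0 := by rw [hhD', mul_assoc, hDH, mul_zero]
  have hhh : h * h ≤ h := by
    rw [hh, ← cfcₙ_mul (fun t => t * g t) (fun t => t * g t) D (by fun_prop) (by simp)
      (by fun_prop) (by simp)]
    exact cfcₙ_mono (fun t _ => by nlinarith [hg_nonneg t, hg_le_one t]) (by fun_prop)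
      (by fun_prop) (by simp) (by simp)
  have hhk : h * cut D (1 / 2) = cut D (1 / 2) := by
    unfold cut
    rw [hh, ← cfcₙ_mul (fun t => t * g t) (fun t : ℝ => max (t - 1 / 2) 0) D (by fun_prop)
      (by simp) (by fun_prop) (by norm_num)]
    congr 1; ext t
    rcases le_total t (1 / 2) with ht | ht
    · rw [max_eq_right (by linarith), mul_zero]
    · rw [hg, max_eq_right (by nlinarith), div_self (by nlinarith), one_mul]
  have hk0 : cut D (1 / 2) ≠ 0 := by
    intro hk
    have := norm_sub_cut_le hD0 (ε := 1 / 2) (by norm_num)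
    rw [hk, sub_zero, hDn] at this
    norm_num at this
  have hek : e * cut D (1 / 2) = cut D (1 / 2) := by
    nth_rw 1 [← hhk]; rw [← mul_assoc, heh, hhk]
  have hknn := cut_nonneg D (1 / 2)
  generalize cut D (1 / 2) = k at hhk hk0 hek hknn
  -- This element, the future `c`, is `(1 - h) e (1 - h)`, as `e h = h = h e`. It annihilates `k`
  -- and acts as a unit on `H`.
  have hc0 : 0 ≤ e - h - h + h * h := by
    obtain ⟨r, hr⟩ := CStarAlgebra.nonneg_iff_eq_star_mul_self.1 he0
    have : e - h - h + h * h = star (r - r * h) * (r - r * h) := by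
      have e1 : star (r - r * h) * (r - r * h) =
          star r * r - star r * r * h - h * (star r * r) + h * (star r * r) * h := by
        rw [star_sub, star_mul, hh0.isSelfAdjoint.star_eq]; noncomm_ring
      rw [e1, ← hr, heh, hhe]
    rw [this]; exact star_mul_self_nonneg _
  have hcH : (e - h - h + h * h) * H = H := by
    rw [add_mul, sub_mul, sub_mul, mul_assoc, hhH, heH]; simp
  have hck : (e - h - h + h * h) * k = 0 := by
    rw [add_mul, sub_mul, sub_mul, mul_assoc, hhk, hek, hhk]; simp
  have hce : e - h - h + h * h ≤ e := by
    have : e - h - h + h * h = e - h - (h - h * h) := by abel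
    rw [this]
    exact (sub_le_self _ (sub_nonneg.2 hhh)).trans (sub_le_self _ hh0)
  -- The difference of the two sides is `c + h h`.
  have hec : e ≤ (2 : ℝ) • (e - h - h + h * h + h) := by
    rw [← sub_nonneg]
    have : (2 : ℝ) • (e - h - h + h * h + h) - e = (e - h - h + h * h) + h * h := by module
    rw [this]
    refine add_nonneg hc0 ?_
    have := star_mul_self_nonneg h
    rwa [hh0.isSelfAdjoint.star_eq] at this
  have h1 : h ≤ (4 : ℝ) • (D * D) := by
    have : D * D = cfcₙ (fun t : ℝ => t * t) D := by
      conv_lhs => rw [← cfcₙ_id' ℝ D]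
      rw [← cfcₙ_mul (fun t : ℝ => t) (fun t => t) D (by fun_prop) rfl (by fun_prop) rfl]
    rw [this, hh, ← cfcₙ_smul (4 : ℝ) (fun t : ℝ => t * t) D (by fun_prop) (by simp)]
    refine cfcₙ_mono (fun t _ => ?_) (by fun_prop) (by fun_prop) (by simp) (by simp)
    rw [smul_eq_mul, ← sq]; exact hg_le_sq t
  clear_value h
  generalize e - h - h + h * h = c at hc0 hcH hck hce hec
  refine ⟨c, h, k, hc0, hh0, hknn, hk0, hck, ?_, ?_, ?_⟩
  · refine (cuntzLE_of_le (add_nonneg hc0 hknn) (b := (1 + ‖k‖) • e) ?_).trans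
      (hea.smul_left (by positivity))
    rw [add_smul, one_smul]
    refine add_le_add hce ((conj_le_smul he0.isSelfAdjoint hknn hek).trans ?_)
    exact smul_le_smul_of_nonneg_left hee (norm_nonneg _)
  · refine ((cuntzLE_of_mul_eq he0 (cut_nonneg _ _) heb).trans (cuntzLE_of_le he0 hec)).trans ?_
    exact (CuntzLE.refl (add_nonneg hc0 hh0)).smul_left (by norm_num)
  -- The part removed fits below what remains: `h ≾ D ≾ H ≾ c`.
  · have h2 : CuntzLE D H := by rw [hD, hH]; exact cuntzLE_mul_star w
    exact ((cuntzLE_of_le hh0 h1).trans (((cuntzLE_mul_self hD0).trans h2).smul_left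
      (by norm_num))).trans (cuntzLE_of_mul_eq hc0 hH0 hcH)

end Room

/-! ### Functoriality of the stabilization and of the Cuntz semigroup. -/

section Functoriality

attribute [local instance] CStarAlgebra.spectralOrder CStarAlgebra.spectralOrderedRing

variable {A B : Type*} [NonUnitalCStarAlgebra A] [NonUnitalCStarAlgebra B]

lemma map_nonneg_hom (φ : B →⋆ₙₐ[ℂ] A) {b : B} (hb : 0 ≤ b) : 0 ≤ φ b := by
  obtain ⟨y, rfl⟩ := CStarAlgebra.nonneg_iff_eq_star_mul_self.1 hb
  rw [map_mul, map_star]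
  exact star_mul_self_nonneg _

lemma map_cut (φ : B →⋆ₙₐ[ℂ] A) {b : B} (hb : 0 ≤ b) {ε : ℝ} (hε : 0 ≤ ε) :
    φ (cut b ε) = cut (φ b) ε := by
  have h1 := hb.isSelfAdjoint
  have h2 := (map_nonneg_hom φ hb).isSelfAdjoint
  have h3 : Continuous φ := map_continuous φ
  exact NonUnitalStarAlgHom.map_cfcₙ φ (fun t : ℝ => max (t - ε) 0) b (by fun_prop)
    (by simpa using hε) h3 h1 h2

/-- The elements `|b|` and `b` have the same image, because functional calculus commutes with `φ`
and `φ b` is positive. -/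
lemma nonneg_of_map_nonneg (φ : B →⋆ₙₐ[ℂ] A) (hφ : Function.Injective φ) {b : B} (hb : 0 ≤ φ b) :
    0 ≤ b := by
  have h1 : IsSelfAdjoint b := hφ (by rw [map_star]; exact hb.isSelfAdjoint.star_eq)
  have h3 : Continuous φ := map_continuous φ
  have e : φ (cfcₙ (fun t : ℝ => |t|) b) = φ b := by
    rw [NonUnitalStarAlgHom.map_cfcₙ φ (fun t : ℝ => |t|) b (by fun_prop) (by simp) h3 h1
      hb.isSelfAdjoint]
    conv_rhs => rw [← cfcₙ_id' ℝ (φ b) hb.isSelfAdjoint]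
    exact cfcₙ_congr fun t ht => abs_of_nonneg (spec_nonneg hb ht)
  rw [← hφ e]
  exact cfcₙ_nonneg fun t _ => abs_nonneg t

lemma CuntzLE.map (φ : B →⋆ₙₐ[ℂ] A) {a b : B} (h : CuntzLE a b) : CuntzLE (φ a) (φ b) := by
  obtain ⟨v, hv⟩ := h
  refine ⟨fun n => φ (v n), ?_⟩
  simpa only [map_mul, map_star, Function.comp_def] using ((map_continuous φ).tendsto a).comp hv

lemma mapₙₐ_injective {φ : B →⋆ₙₐ[ℂ] A} (hφ : Function.Injective φ) (n : ℕ) :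
    Function.Injective (CStarMatrix.mapₙₐ (n := Fin n) φ) := fun M N h => by
  ext i j
  exact hφ (congrFun (congrFun h i) j)

lemma mapₙₐ_spread (φ : B →⋆ₙₐ[ℂ] A) {m n : ℕ} {f g : Fin m → Fin n} (hf : f.Injective)
    (hg : g.Injective) (M : CStarMatrix (Fin m) (Fin m) B) :
    CStarMatrix.mapₙₐ φ (spread f g M) = spread f g (CStarMatrix.mapₙₐ φ M) := by
  refine eq_spread hf hg (fun i j => ?_) (fun a b ha => ?_) (fun a b hb => ?_)
  · show φ (spread f g M (f i) (g j)) = φ (M i j)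
    rw [spread_apply hf hg]
  · show φ (spread f g M a b) = 0
    rw [spread_apply_left _ _ ha, map_zero]
  · show φ (spread f g M a b) = 0
    rw [spread_apply_right _ _ hb, map_zero]

/-- The entrywise application of a homomorphism to `M_∞(B)`. -/
def FinMat.map (φ : B →⋆ₙₐ[ℂ] A) : FinMat B → FinMat A :=
  DirectLimit.lift (corner B) (fun n M => FinMat.mk n (CStarMatrix.mapₙₐ φ M)) fun m n h M => by
    have : CStarMatrix.mapₙₐ φ (corner B m n h M) = corner A m n h (CStarMatrix.mapₙₐ φ M) :=
      mapₙₐ_spread φ (Fin.castLE_injective h) (Fin.castLE_injective h) M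
    rw [this, FinMat.mk_corner]

lemma FinMat.map_mk (φ : B →⋆ₙₐ[ℂ] A) (n : ℕ) (M : CStarMatrix (Fin n) (Fin n) B) :
    FinMat.map φ (FinMat.mk n M) = FinMat.mk n (CStarMatrix.mapₙₐ φ M) := rfl

/-- The homomorphism `M_∞(B) → M_∞(A)` induced by a homomorphism `B → A`. -/
def FinMat.mapHom (φ : B →⋆ₙₐ[ℂ] A) : FinMat B →⋆ₙₐ[ℂ] FinMat A where
  toFun := FinMat.map φ
  map_smul' c := FinMat.ind fun n M => by
    show FinMat.map φ (c • FinMat.mk n M) = c • FinMat.map φ (FinMat.mk n M)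
    rw [← FinMat.mk_smul, FinMat.map_mk, FinMat.map_mk, ← FinMat.mk_smul, map_smul]
  map_zero' := by rw [FinMat.zero_eq_mk 0, FinMat.map_mk, map_zero, ← FinMat.zero_eq_mk]
  map_add' := FinMat.ind₂ fun n M N => by
    rw [← FinMat.mk_add, FinMat.map_mk, FinMat.map_mk, FinMat.map_mk, ← FinMat.mk_add, map_add]
  map_mul' := FinMat.ind₂ fun n M N => by
    rw [← FinMat.mk_mul, FinMat.map_mk, FinMat.map_mk, FinMat.map_mk, ← FinMat.mk_mul, map_mul]
  map_star' := FinMat.ind fun n M => by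
    rw [← FinMat.mk_star, FinMat.map_mk, FinMat.map_mk, ← FinMat.mk_star, map_star]

lemma FinMat.mapHom_mk (φ : B →⋆ₙₐ[ℂ] A) (n : ℕ) (M : CStarMatrix (Fin n) (Fin n) B) :
    FinMat.mapHom φ (FinMat.mk n M) = FinMat.mk n (CStarMatrix.mapₙₐ φ M) := rfl

lemma FinMat.norm_map {φ : B →⋆ₙₐ[ℂ] A} (hφ : Function.Injective φ) (x : FinMat B) :
    ‖FinMat.mapHom φ x‖ = ‖x‖ := by
  induction x using FinMat.ind with | h n M
  exact NonUnitalStarAlgHom.norm_map (CStarMatrix.mapₙₐ φ) (mapₙₐ_injective hφ n) M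

lemma FinMat.map_shift (φ : B →⋆ₙₐ[ℂ] A) (f g : ℕ ↪ ℕ) (x : FinMat B) :
    FinMat.mapHom φ (x.shift f g) = (FinMat.mapHom φ x).shift f g := by
  induction x using FinMat.ind with | h n M
  rw [FinMat.shift_mk f g (FinMat.lt_bound_left f g n) (FinMat.lt_bound_right f g n),
    FinMat.mapHom_mk, FinMat.mapHom_mk,
    FinMat.shift_mk f g (FinMat.lt_bound_left f g n) (FinMat.lt_bound_right f g n),
    mapₙₐ_spread φ (FinMat.trunc_injective f _) (FinMat.trunc_injective g _)]

lemma FinMat.isometry_map {φ : B →⋆ₙₐ[ℂ] A} (hφ : Function.Injective φ) :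
    Isometry (FinMat.mapHom φ) :=
  AddMonoidHomClass.isometry_of_norm (FinMat.mapHom φ) (FinMat.norm_map hφ)

/-- The map `B ⊗ K → A ⊗ K` induced by an injective homomorphism `B → A`. -/
def Stab.mapFun (φ : B →⋆ₙₐ[ℂ] A) : Stab B → Stab A :=
  UniformSpace.Completion.map (FinMat.mapHom φ)

lemma Stab.continuous_mapFun (φ : B →⋆ₙₐ[ℂ] A) : Continuous (Stab.mapFun φ) :=
  UniformSpace.Completion.continuous_map

lemma Stab.mapFun_incl {φ : B →⋆ₙₐ[ℂ] A} (hφ : Function.Injective φ) (x : FinMat B) :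
    Stab.mapFun φ (Stab.incl x) = Stab.incl (FinMat.mapHom φ x) :=
  UniformSpace.Completion.map_coe (FinMat.isometry_map hφ).uniformContinuous x

/-- The homomorphism `B ⊗ K → A ⊗ K` induced by an injective homomorphism `B → A`. -/
def Stab.mapHom (φ : B →⋆ₙₐ[ℂ] A) (hφ : Function.Injective φ) : Stab B →⋆ₙₐ[ℂ] Stab A where
  toFun := Stab.mapFun φ
  map_smul' c x := by
    refine Stab.ind (C := fun x => Stab.mapFun φ (c • x) = c • Stab.mapFun φ x)
      (isClosed_eq ((Stab.continuous_mapFun φ).comp (Stab.continuous_smul_left c))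
        ((Stab.continuous_smul_left c).comp (Stab.continuous_mapFun φ))) (fun x => ?_) x
    rw [← Stab.incl_smul, Stab.mapFun_incl hφ, Stab.mapFun_incl hφ, ← Stab.incl_smul, map_smul]
  map_zero' := by
    rw [← map_zero Stab.incl, Stab.mapFun_incl hφ, map_zero, map_zero]
  map_add' x y := by
    have hc := Stab.continuous_mapFun φ
    refine Stab.ind₂ (C := fun x y => Stab.mapFun φ (x + y) = Stab.mapFun φ x + Stab.mapFun φ y)
      (isClosed_eq (by fun_prop) (by fun_prop)) (fun x y => ?_) x y
    simp only [← map_add, Stab.mapFun_incl hφ]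
  map_mul' x y := by
    have hc := Stab.continuous_mapFun φ
    refine Stab.ind₂ (C := fun x y => Stab.mapFun φ (x * y) = Stab.mapFun φ x * Stab.mapFun φ y)
      (isClosed_eq (by fun_prop) (by fun_prop)) (fun x y => ?_) x y
    simp only [← Stab.incl_mul, Stab.mapFun_incl hφ, map_mul]
  map_star' x := by
    have hc := Stab.continuous_mapFun φ
    refine Stab.ind (C := fun x => Stab.mapFun φ (star x) = star (Stab.mapFun φ x))
      (isClosed_eq (by fun_prop) (by fun_prop)) (fun x => ?_) x
    simp only [← Stab.incl_star, Stab.mapFun_incl hφ, map_star]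

variable {φ : B →⋆ₙₐ[ℂ] A} (hφ : Function.Injective φ)

lemma Stab.mapHom_incl (x : FinMat B) :
    Stab.mapHom φ hφ (Stab.incl x) = Stab.incl (FinMat.mapHom φ x) := Stab.mapFun_incl hφ x

lemma Stab.norm_mapHom (x : Stab B) : ‖Stab.mapHom φ hφ x‖ = ‖x‖ := by
  have hc : Continuous (Stab.mapHom φ hφ) := Stab.continuous_mapFun φ
  refine Stab.ind (C := fun x => ‖Stab.mapHom φ hφ x‖ = ‖x‖)
    (isClosed_eq (by fun_prop) (by fun_prop)) (fun x => ?_) x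
  rw [Stab.mapHom_incl, Stab.incl.norm_map, Stab.incl.norm_map, FinMat.norm_map hφ]

lemma Stab.mapHom_injective : Function.Injective (Stab.mapHom φ hφ) :=
  (AddMonoidHomClass.isometry_of_norm _ (Stab.norm_mapHom hφ)).injective

lemma Stab.mapHom_shift (f g : ℕ ↪ ℕ) (x : Stab B) :
    Stab.mapHom φ hφ (x.shift f g) = (Stab.mapHom φ hφ x).shift f g := by
  have hc : Continuous (Stab.mapHom φ hφ) := Stab.continuous_mapFun φ
  refine Stab.ind (C := fun x => Stab.mapHom φ hφ (x.shift f g) = (Stab.mapHom φ hφ x).shift f g)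
    (isClosed_eq (by fun_prop) (by fun_prop)) (fun x => ?_) x
  simp only [Stab.shift_incl, Stab.mapHom_incl, FinMat.map_shift]

/-- The induced map of positive cones. -/
def StabPos.map (hφ : Function.Injective φ) (a : StabPos B) : StabPos A :=
  ⟨Stab.mapHom φ hφ a.val, map_nonneg_hom _ a.nonneg⟩

lemma StabPos.map_cut (a : StabPos B) {ε : ℝ} (hε : 0 ≤ ε) :
    (a.cut ε).map hφ = (a.map hφ).cut ε := by
  simp only [StabPos.map, StabPos.cut, CuntzSemigroup.map_cut _ a.nonneg hε]

/-- The map of Cuntz semigroups induced by an injective homomorphism. -/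
def Cu.map (hφ : Function.Injective φ) : Cu B →+ Cu A where
  toFun := Quotient.map (StabPos.map hφ) fun _ _ h => ⟨h.1.map _, h.2.map _⟩
  map_zero' := by
    show Cu.cls (StabPos.map hφ ⟨0, le_rfl⟩) = Cu.cls ⟨0, le_rfl⟩
    congr 1
    simp only [StabPos.map, map_zero]
  map_add' x y := by
    induction x using Cu.ind with | h a
    induction y using Cu.ind with | h b
    show Cu.cls (StabPos.map hφ ⟨Stab.dsum a.val b.val, _⟩) =
      Cu.cls ⟨Stab.dsum (Stab.mapHom φ hφ a.val) (Stab.mapHom φ hφ b.val), _⟩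
    congr 1
    simp only [StabPos.map, Stab.dsum, map_add, Stab.mapHom_shift]

lemma Cu.map_cls (a : StabPos B) : Cu.map hφ (Cu.cls a) = Cu.cls (a.map hφ) := rfl

lemma Cu.map_mono {x y : Cu B} (h : x ≤ y) : Cu.map hφ x ≤ Cu.map hφ y := by
  induction x using Cu.ind with | h a
  induction y using Cu.ind with | h b
  exact CuntzLE.map (Stab.mapHom φ hφ) h

lemma Cu.eq_zero_of_map {x : Cu B} (h : Cu.map hφ x = 0) : x = 0 := by
  induction x using Cu.ind with | h a
  rw [Cu.map_cls, Cu.cls_eq_zero_iff] at h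
  rw [Cu.cls_eq_zero_iff]
  exact Stab.mapHom_injective hφ (h.trans (map_zero _).symm)

end Functoriality

/-! ### Matrix units and the corner embedding of an algebra in its stabilization. -/

section Corner

attribute [local instance] CStarAlgebra.spectralOrder CStarAlgebra.spectralOrderedRing

/-- The inclusion of `M_n(A)` in `A ⊗ K`. -/
def embMat (A : Type*) [NonUnitalCStarAlgebra A] (n : ℕ) :
    CStarMatrix (Fin n) (Fin n) A →⋆ₙₐ[ℂ] Stab A where
  toFun M := Stab.incl (FinMat.mk n M)
  map_smul' c M := by rw [FinMat.mk_smul, Stab.incl_smul]; rfl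
  map_zero' := by rw [← FinMat.zero_eq_mk, map_zero]
  map_add' M N := by rw [FinMat.mk_add, map_add]
  map_mul' M N := by rw [FinMat.mk_mul, Stab.incl_mul]
  map_star' M := by rw [FinMat.mk_star, Stab.incl_star]

/-- The matrix with a single nonzero entry. -/
def unitMat {A : Type*} [NonUnitalCStarAlgebra A] {n : ℕ} (i j : Fin n) (a : A) :
    CStarMatrix (Fin n) (Fin n) A := CStarMatrix.ofMatrix (Matrix.single i j a)

section NonUnital

variable {A : Type*} [NonUnitalCStarAlgebra A]

lemma norm_embMat {n : ℕ} (M : CStarMatrix (Fin n) (Fin n) A) : ‖embMat A n M‖ = ‖M‖ :=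
  Stab.incl.norm_map _

lemma embMat_corner {m n : ℕ} (h : m ≤ n) (M : CStarMatrix (Fin m) (Fin m) A) :
    embMat A n (corner A m n h M) = embMat A m M :=
  congrArg Stab.incl (FinMat.mk_corner h M)

lemma unitMat_mul_mul {n : ℕ} (i i' j' j : Fin n) (a b : A) (M : CStarMatrix (Fin n) (Fin n) A) :
    unitMat i i' a * M * unitMat j' j b = unitMat i j (a * M i' j' * b) :=
  Matrix.single_mul_mul_single i i' j' j a M b

lemma unitMat_mul {n : ℕ} (i j k : Fin n) (a b : A) :
    unitMat i j a * unitMat j k b = unitMat i k (a * b) :=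
  Matrix.single_mul_single_same a i j k b

lemma star_unitMat {n : ℕ} (i j : Fin n) (a : A) : star (unitMat i j a) = unitMat j i (star a) :=
  Matrix.conjTranspose_single i j a

lemma unitMat_add {n : ℕ} (i j : Fin n) (a b : A) :
    unitMat i j (a + b) = unitMat i j a + unitMat i j b := Matrix.single_add i j a b

lemma unitMat_smul {n : ℕ} (i j : Fin n) (c : ℂ) (a : A) :
    unitMat i j (c • a) = c • unitMat i j a := (Matrix.smul_single c i j a).symm

lemma unitMat_injective {n : ℕ} (i j : Fin n) : Function.Injective (unitMat (A := A) i j) :=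
  fun a b h => by
    have := congrFun (congrFun h i) j
    simpa [unitMat] using this

lemma matrix_eq_sum {n : ℕ} (M : CStarMatrix (Fin n) (Fin n) A) :
    M = ∑ i, ∑ j, unitMat i j (M i j) := Matrix.matrix_eq_sum_single M

/-- The inclusion of `A` in `M_n(A)` at a diagonal place. -/
def unitHom (A : Type*) [NonUnitalCStarAlgebra A] {n : ℕ} (i : Fin n) :
    A →⋆ₙₐ[ℂ] CStarMatrix (Fin n) (Fin n) A where
  toFun := unitMat i i
  map_smul' c a := unitMat_smul i i c a
  map_zero' := by simpa using unitMat_smul i i 0 (0 : A)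
  map_add' a b := unitMat_add i i a b
  map_mul' a b := (unitMat_mul i i i a b).symm
  map_star' a := (star_unitMat i i a).symm

lemma norm_unitMat_same {n : ℕ} (i : Fin n) (a : A) : ‖unitMat i i a‖ = ‖a‖ :=
  NonUnitalStarAlgHom.norm_map (unitHom A i) (unitMat_injective i i) a

lemma norm_unitMat {n : ℕ} (i j : Fin n) (a : A) : ‖unitMat i j a‖ = ‖a‖ := by
  have := CStarRing.norm_star_mul_self (x := unitMat i j a)
  rw [star_unitMat, unitMat_mul, norm_unitMat_same, CStarRing.norm_star_mul_self] at this
  nlinarith [norm_nonneg a, norm_nonneg (unitMat i j a)]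

lemma norm_matrix_le {n : ℕ} (M : CStarMatrix (Fin n) (Fin n) A) {ε : ℝ}
    (h : ∀ i j, ‖M i j‖ ≤ ε) : ‖M‖ ≤ n * (n * ε) := by
  rw [matrix_eq_sum M]
  refine (norm_sum_le_of_le _ (f := fun i => ∑ j, unitMat i j (M i j)) fun i _ =>
    norm_sum_le_of_le _ fun j _ => (norm_unitMat i j _).trans_le (h i j)).trans ?_
  simp

/-- The corner embedding of `A` in `A ⊗ K`. -/
def embCorner (A : Type*) [NonUnitalCStarAlgebra A] : A →⋆ₙₐ[ℂ] Stab A :=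
  (embMat A 1).comp (unitHom A 0)

lemma embCorner_injective : Function.Injective (embCorner A) := fun a b h => by
  have h1 : Isometry (embMat A 1) := AddMonoidHomClass.isometry_of_norm _ norm_embMat
  exact unitMat_injective 0 0 (h1.injective h)

/-- Lets the corner be computed inside a matrix algebra of any size. -/
lemma embCorner_eq (n : ℕ) (a : A) : embCorner A a = embMat A (n + 1) (unitMat 0 0 a) := by
  show embMat A 1 (unitMat 0 0 a) = _
  rw [← embMat_corner (Nat.le_add_left 1 n)]
  congr 1
  symm
  refine eq_spread (Fin.castLE_injective _) (Fin.castLE_injective _) (fun i j => ?_)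
    (fun a b ha => ?_) (fun a b hb => ?_)
  · rw [Subsingleton.elim i 0, Subsingleton.elim j 0]
    simp [unitMat]
  · have : 0 ≠ a := fun h => ha ⟨0, by rw [← h]; rfl⟩
    simp [unitMat, Matrix.single, this]
  · have : 0 ≠ b := fun h => hb ⟨0, by rw [← h]; rfl⟩
    simp [unitMat, Matrix.single, this]

/-- The class of the diagonal matrix is bounded by the multiple of the class of its entry. -/
lemma cls_unitMat_le {n : ℕ} (i : Fin (n + 1)) {a : A} (ha : 0 ≤ a) :
    CuntzLE (embMat A (n + 1) (unitMat i i a)) (embCorner A a) := by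
  rw [embCorner_eq n]
  have hs := CFC.sqrt_mul_sqrt_self a ha
  have hss : star (CFC.sqrt a) = CFC.sqrt a := (CFC.sqrt_nonneg a).isSelfAdjoint.star_eq
  have := cuntzLE_mul_star (embMat A (n + 1) (unitMat i 0 (CFC.sqrt a)))
  rwa [← map_star, ← map_mul, ← map_mul, star_unitMat, unitMat_mul, unitMat_mul, hss, hs] at this

/-- The diagonal matrix with constant entry. -/
def diagMat {n : ℕ} (a : A) : CStarMatrix (Fin n) (Fin n) A := ∑ i, unitMat i i a

lemma diagMat_mul_apply {n : ℕ} (a : A) (M : CStarMatrix (Fin n) (Fin n) A) (i j : Fin n) :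
    (diagMat a * M : CStarMatrix (Fin n) (Fin n) A) i j = a * M i j := by
  have : diagMat (n := n) a = CStarMatrix.ofMatrix (Matrix.diagonal fun _ => a) := by
    ext i j
    simp only [diagMat, unitMat]
    exact congrFun (congrFun (Matrix.sum_single_eq_diagonal (fun _ : Fin n => a)) i) j
  rw [this]
  exact Matrix.diagonal_mul _ M i j

end NonUnital

end Corner

/-! ### Passing between a unital algebra and its stabilization. -/

section Unital

attribute [local instance] CStarAlgebra.spectralOrder CStarAlgebra.spectralOrderedRing

variable {A : Type*} [CStarAlgebra A]

lemma sum_unitMat_one (n : ℕ) :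
    ∑ i, unitMat (A := A) i i 1 = (1 : CStarMatrix (Fin n) (Fin n) A) :=
  Matrix.sum_single_one

lemma exists_embMat_near (s : Stab A) {ε : ℝ} (hε : 0 < ε) :
    ∃ n M, ‖s - embMat A (n + 1) M‖ < ε := by
  obtain ⟨x, hx⟩ := Metric.denseRange_iff.1 (Stab.isDenseInducing_incl (A := A)).dense s ε hε
  induction x using FinMat.ind with | h k M
  rw [dist_eq_norm] at hx
  refine ⟨k, corner A k (k + 1) k.le_succ M, ?_⟩
  rw [embMat_corner]
  exact hx

lemma Stab.ind_embMat {P : Stab A → Prop} (hP : IsClosed {x | P x})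
    (h : ∀ n M, P (embMat A (n + 1) M)) (s : Stab A) : P s := by
  have : s ∈ closure {x | P x} := Metric.mem_closure_iff.2 fun ε hε => by
    obtain ⟨n, M, hM⟩ := exists_embMat_near s hε
    exact ⟨_, h n M, by rwa [dist_eq_norm]⟩
  rwa [hP.closure_eq] at this

/-- The corner of `A ⊗ K` at the first place is `A`. -/
lemma exists_embCorner_eq (s : Stab A) :
    ∃ a, embCorner A 1 * s * embCorner A 1 = embCorner A a := by
  have hi : Isometry (embCorner A) :=
    AddMonoidHomClass.isometry_of_norm _ (NonUnitalStarAlgHom.norm_map _ embCorner_injective)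
  have hc : IsClosed (Set.range (embCorner A)) := hi.isClosedEmbedding.isClosed_range
  have : ∀ s, embCorner A 1 * s * embCorner A 1 ∈ Set.range (embCorner A) := by
    refine Stab.ind_embMat (hc.preimage (by fun_prop)) fun n M => ⟨M 0 0, ?_⟩
    rw [embCorner_eq n, embCorner_eq n, ← map_mul, ← map_mul, unitMat_mul_mul, one_mul, mul_one]
  obtain ⟨a, ha⟩ := this s
  exact ⟨a, ha.symm⟩

/-- The corner projection is full: every matrix is a sum of terms `M e_{i0} e_{00} e_{0i}`, each
factoring through it. -/
lemma eq_zero_of_corner_mul {x : Stab A} (h : ∀ s, embCorner A 1 * s * x = 0) : x = 0 := by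
  have key : ∀ s, s * x = 0 := by
    refine Stab.ind_embMat (isClosed_eq (by fun_prop) (by fun_prop)) fun n M => ?_
    have : M = ∑ i, M * unitMat i 0 1 * unitMat 0 0 1 * unitMat 0 i 1 := by
      conv_lhs => rw [← mul_one M, ← sum_unitMat_one, Finset.mul_sum]
      refine Finset.sum_congr rfl fun i _ => ?_
      simp only [mul_assoc, unitMat_mul, one_mul]
    rw [this, map_sum, Finset.sum_mul]
    refine Finset.sum_eq_zero fun i _ => ?_
    rw [map_mul, map_mul, ← embCorner_eq, mul_assoc, mul_assoc, ← mul_assoc (embCorner A 1), h,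
      mul_zero]
  rw [← CStarRing.star_mul_self_eq_zero_iff]
  exact key _

lemma exists_corner_mul_ne_zero {x : Stab A} (hx : x ≠ 0) : ∃ s, embCorner A 1 * s * x ≠ 0 := by
  by_contra! h
  exact hx (eq_zero_of_corner_mul h)

lemma star_embCorner_one : star (embCorner A 1) = embCorner A 1 := by
  rw [← map_star, star_one]

/-- Every nonzero positive element of the stabilization dominates a nonzero positive element of
the corner. -/
lemma exists_corner_conj {a : Stab A} (ha : 0 ≤ a) (ha0 : a ≠ 0) :
    ∃ (s : Stab A) (b : A), 0 ≤ b ∧ b ≠ 0 ∧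
      embCorner A 1 * s * a * star s * embCorner A 1 = embCorner A b := by
  obtain ⟨s, hs⟩ := exists_corner_mul_ne_zero ha0
  obtain ⟨b, hb⟩ := exists_embCorner_eq (s * a * star s)
  have e : embCorner A 1 * s * a * star s * embCorner A 1 = embCorner A b := by
    rw [← hb]; simp only [mul_assoc]
  have hn : 0 ≤ embCorner A b := by
    have := star_right_conjugate_nonneg ha (embCorner A 1 * s)
    rwa [star_mul, star_embCorner_one, ← mul_assoc, e] at this
  refine ⟨s, b, nonneg_of_map_nonneg _ embCorner_injective hn, ?_, e⟩
  -- If `b = 0`, then with `a = r⋆ r` the element `r s⋆ p` vanishes, `p` being the corner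
  -- projection; hence `p s a = (p s r⋆) r = 0`, against the choice of `s`.
  rintro rfl
  obtain ⟨r, hr⟩ := CStarAlgebra.nonneg_iff_eq_star_mul_self.1 ha
  have h1 : r * (star s * embCorner A 1) = 0 := by
    rw [← CStarRing.star_mul_self_eq_zero_iff, star_mul, star_mul, star_star, star_embCorner_one]
    rw [map_zero, hr] at e
    simpa only [mul_assoc] using e
  have h2 : embCorner A 1 * s * star r = 0 := by
    have := congrArg star h1
    rwa [star_mul, star_mul, star_star, star_embCorner_one, star_zero] at this
  apply hs
  rw [hr, ← mul_assoc, h2, zero_mul]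

/-- If `x z y = 0` for all `z`, nonzero compressions of `x⋆ x` and `y y⋆` to the corner give nonzero
`a`, `b` in `A` with `a A b = 0`. -/
lemma IsPrimeAlg.stab (hA : IsPrimeAlg A) : IsPrimeAlg (Stab A) := by
  intro x y h
  by_contra! hxy
  have hx : star x * x ≠ 0 := fun h => hxy.1 (CStarRing.star_mul_self_eq_zero_iff x |>.1 h)
  have hy : y * star y ≠ 0 := fun h => hxy.2 (CStarRing.mul_star_self_eq_zero_iff y |>.1 h)
  obtain ⟨s, a, _, ha, hsa⟩ := exists_corner_conj (star_mul_self_nonneg x) hx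
  obtain ⟨t, b, _, hb, htb⟩ := exists_corner_conj (mul_star_self_nonneg y) hy
  refine (hA a b fun z => embCorner_injective ?_).elim ha hb
  rw [map_mul, map_mul, ← hsa, ← htb, map_zero]
  have := h (star s * embCorner A 1 * embCorner A z * embCorner A 1 * t)
  calc _ = embCorner A 1 * s * star x *
        (x * (star s * embCorner A 1 * embCorner A z * embCorner A 1 * t) * y) *
        (star y * star t * embCorner A 1) := by simp only [mul_assoc]
    _ = 0 := by rw [this, mul_zero, zero_mul]

/-- A one-dimensional corner at `a` would compress to a one-dimensional corner of `A` at a nonzero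
positive element. -/
lemma NoMinimal.stab (hA : NoMinimal A) : NoMinimal (Stab A) := by
  intro a ha ha0
  by_contra! h
  obtain ⟨s, b, hb, hb0, hsb⟩ := exists_corner_conj ha ha0
  obtain ⟨z, hz⟩ := hA b hb hb0
  obtain ⟨c, hc⟩ := h (star s * embCorner A 1 * embCorner A z * embCorner A 1 * s)
  apply hz c
  apply embCorner_injective
  rw [map_mul, map_mul, map_smul, ← hsb]
  calc _ = embCorner A 1 * s *
        (a * (star s * embCorner A 1 * embCorner A z * embCorner A 1 * s) * a) *
        (star s * embCorner A 1) := by simp only [mul_assoc]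
    _ = _ := by rw [hc, mul_smul_comm, smul_mul_assoc]; simp only [mul_assoc]

namespace Cu

/-- The class of a positive element of `A`. -/
def ofPos (a : A) (ha : 0 ≤ a) : Cu A := cls ⟨embCorner A a, map_nonneg_hom _ ha⟩

lemma ofPos_le {a b : A} (ha : 0 ≤ a) (hb : 0 ≤ b) (h : CuntzLE a b) : ofPos a ha ≤ ofPos b hb :=
  CuntzLE.map (embCorner A) h

/-- Largeness tests elements of the algebras themselves, not of their stabilizations, so small
classes have to be represented there. -/
lemma exists_ofPos_le {x : Cu A} (hx : x ≠ 0) :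
    ∃ (a : A) (ha : 0 ≤ a), ‖a‖ = 1 ∧ ofPos a ha ≤ x := by
  induction x using ind with | h b
  rw [Ne, cls_eq_zero_iff] at hx
  obtain ⟨s, a, ha, ha0, h⟩ := exists_corner_conj b.nonneg hx
  refine ⟨(‖a‖⁻¹ : ℝ) • a, smul_nonneg (by positivity) ha, ?_, ?_⟩
  · rw [norm_smul, norm_inv, norm_norm, inv_mul_cancel₀ (norm_ne_zero_iff.2 ha0)]
  · have h1 : CuntzLE (embCorner A a) b.val := by
      rw [← h]
      have := cuntzLE_conj (embCorner A 1 * s) b.val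
      rwa [star_mul, star_embCorner_one, ← mul_assoc] at this
    exact (((CuntzLE.refl ha).smul_left (by positivity)).map (embCorner A)).trans h1

/-- The two copies are `w w⋆` and `w⋆ w`, equivalent and orthogonal. -/
lemma exists_two_nsmul_le (hp : IsPrimeAlg A) (hC : NoMinimal A) {x : Cu A} (hx : x ≠ 0) :
    ∃ y : Cu A, y ≠ 0 ∧ 2 • y ≤ x := by
  induction x using ind with | h b
  rw [Ne, cls_eq_zero_iff] at hx
  obtain ⟨w, hw, h1, h2⟩ := exists_orthogonal_equivalent hp.stab hC.stab b.nonneg hx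
  have e1 := mul_star_self_nonneg w
  have e2 := star_mul_self_nonneg w
  refine ⟨cls ⟨w * star w, e1⟩, ?_, ?_⟩
  · rw [Ne, cls_eq_zero_iff]
    exact fun h => hw (CStarRing.mul_star_self_eq_zero_iff w |>.1 h)
  · have h3 : cls ⟨w * star w, e1⟩ ≤ cls ⟨star w * w, e2⟩ := cuntzLE_mul_star w
    rw [two_nsmul]
    refine ((add_le_add_right h3 _).trans (le_cls_add e1 e2 (add_nonneg e1 e2) h2)).trans ?_
    exact h1

lemma exists_nsmul_le (hp : IsPrimeAlg A) (hC : NoMinimal A) (n : ℕ) {x : Cu A} (hx : x ≠ 0) :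
    ∃ y : Cu A, y ≠ 0 ∧ n • y ≤ x := by
  have key : ∀ k : ℕ, ∃ y : Cu A, y ≠ 0 ∧ (2 ^ k) • y ≤ x := by
    intro k
    induction k with
    | zero => exact ⟨x, hx, by simp⟩
    | succ k ih =>
      obtain ⟨y, hy, h⟩ := ih
      obtain ⟨z, hz, h'⟩ := exists_two_nsmul_le hp hC hy
      refine ⟨z, hz, ?_⟩
      rw [pow_succ, mul_smul]
      exact (nsmul_le_nsmul_right h' _).trans h
  obtain ⟨y, hy, h⟩ := key n
  exact ⟨y, hy, (nsmul_le_nsmul_left (zero_le' y) Nat.lt_two_pow_self.le).trans h⟩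

/-- Splitting off a nonzero piece at the cost of doubling. -/
lemma exists_room (hp : IsPrimeAlg A) (hC : NoMinimal A) (a : StabPos A) {ε : ℝ} (hε : 0 < ε)
    (h0 : cls (a.cut ε) ≠ 0) :
    ∃ (c : StabPos A) (s : Cu A), s ≠ 0 ∧ cls c + s ≤ cls a ∧ cls (a.cut ε) ≤ 2 • cls c := by
  rw [Ne, cls_eq_zero_iff] at h0
  obtain ⟨c, h, k, hc, hh, hk, hk0, hck, h1, h2, h3⟩ :=
    CuntzSemigroup.exists_room hp.stab hC.stab a.nonneg hε h0
  refine ⟨⟨c, hc⟩, cls ⟨k, hk⟩, ?_, ?_, ?_⟩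
  · rw [Ne, cls_eq_zero_iff]; exact hk0
  · exact (le_cls_add hc hk (add_nonneg hc hk) hck).trans h1
  · have e1 : cls (a.cut ε) ≤ cls ⟨c + h, add_nonneg hc hh⟩ := h2
    have e2 : cls ⟨h, hh⟩ ≤ cls ⟨c, hc⟩ := h3
    rw [two_nsmul]
    exact (e1.trans (cls_add_le hc hh _)).trans (add_le_add_right e2 _)

/-- The class of a diagonal matrix. -/
lemma cls_diagMat_le (n : ℕ) {a : A} (ha : 0 ≤ a) :
    ∃ h : 0 ≤ embMat A (n + 1) (diagMat a),
      cls ⟨embMat A (n + 1) (diagMat a), h⟩ ≤ (n + 1) • ofPos a ha := by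
  have key : ∀ S : Finset (Fin (n + 1)), ∃ h : 0 ≤ embMat A (n + 1) (∑ i ∈ S, unitMat i i a),
      cls ⟨embMat A (n + 1) (∑ i ∈ S, unitMat i i a), h⟩ ≤ S.card • ofPos a ha := by
    intro S
    induction S using Finset.induction_on with
    | empty =>
      refine ⟨by simp, ?_⟩
      rw [Finset.card_empty, zero_smul]
      refine (cls_eq_zero_iff.2 ?_).le
      simp
    | insert i S hi ih =>
      obtain ⟨h, h'⟩ := ih
      have h0 : 0 ≤ embMat A (n + 1) (unitMat i i a) :=
        map_nonneg_hom ((embMat A (n + 1)).comp (unitHom A i)) ha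
      have h1 : cls ⟨_, h0⟩ ≤ ofPos a ha := cls_unitMat_le i ha
      simp only [Finset.sum_insert hi, Finset.card_insert_of_notMem hi, map_add]
      refine ⟨add_nonneg h0 h, (cls_add_le h0 h _).trans ?_⟩
      rw [succ_nsmul, add_comm]
      exact add_le_add h' h1
  have := key Finset.univ
  rwa [Finset.card_univ, Fintype.card_fin] at this

end Cu

end Unital

/-! ### Transfer of comparison and divisibility between an algebra and a large subalgebra. -/

section Transfer

attribute [local instance] CStarAlgebra.spectralOrder CStarAlgebra.spectralOrderedRing

section Compression

variable {C : Type*} [NonUnitalCStarAlgebra C]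

/-- The compression `(1 - g) a (1 - g)`. -/
def compr (g a : C) : C := a - g * a - a * g + g * a * g

lemma compr_sub (g a b : C) : compr g (a - b) = compr g a - compr g b := by
  unfold compr; noncomm_ring

lemma map_compr {D : Type*} [NonUnitalCStarAlgebra D] (φ : C →⋆ₙₐ[ℂ] D) (g a : C) :
    φ (compr g a) = compr (φ g) (φ a) := by
  simp only [compr, map_sub, map_add, map_mul]

lemma norm_compr_le {g : C} (hg : ‖g‖ ≤ 1) (a : C) : ‖compr g a‖ ≤ 4 * ‖a‖ := by
  have h1 : ‖g * a‖ ≤ ‖a‖ := (norm_mul_le _ _).trans (mul_le_of_le_one_left (norm_nonneg _) hg)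
  have h2 : ‖a * g‖ ≤ ‖a‖ := (norm_mul_le _ _).trans (mul_le_of_le_one_right (norm_nonneg _) hg)
  have h3 : ‖g * a * g‖ ≤ ‖a‖ :=
    ((norm_mul_le _ _).trans (mul_le_of_le_one_right (norm_nonneg _) hg)).trans h1
  have := norm_add_le (a - g * a - a * g) (g * a * g)
  have := norm_sub_le (a - g * a) (a * g)
  have := norm_sub_le a (g * a)
  unfold compr
  linarith

/-- This is how elements descend: when `b` and `w = (1 - g) c` come from the subalgebra, so does the
compression of `c b c⋆`. -/
lemma compr_conj {g c b w : C} (hg : IsSelfAdjoint g) (hw : c - g * c = w) :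
    compr g (c * b * star c) = w * b * star w := by
  rw [← hw, star_sub, star_mul, hg.star_eq]
  unfold compr; noncomm_ring

lemma compr_conj' {g c w : C} (hg : IsSelfAdjoint g) (hw : c - g * c = w) :
    compr g (c * star c) = w * star w := by
  rw [← hw, star_sub, star_mul, hg.star_eq]
  unfold compr; noncomm_ring

lemma compr_nonneg {g a : C} (hg : IsSelfAdjoint g) (ha : 0 ≤ a) : 0 ≤ compr g a := by
  obtain ⟨r, rfl⟩ := CStarAlgebra.nonneg_iff_eq_star_mul_self.1 ha
  have := compr_conj' (c := star r) hg rfl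
  rw [star_star] at this
  rw [this]; exact mul_star_self_nonneg _

/-- The difference of the two sides is `(1 - 2 g) a (1 - 2 g)`. -/
lemma le_compr_add {g a : C} (hg : IsSelfAdjoint g) (ha : 0 ≤ a) :
    a ≤ (2 : ℝ) • compr g a + (2 : ℝ) • (g * a * g) := by
  have h := compr_nonneg (g := g + g) (hg.add hg) ha
  rw [← sub_nonneg]
  have : (2 : ℝ) • compr g a + (2 : ℝ) • (g * a * g) - a = compr (g + g) a := by
    simp only [two_smul]; unfold compr; noncomm_ring
  rwa [this]

lemma cuntzLE_conj_self {g a : C} (hg : 0 ≤ g) (ha : 0 ≤ a) : CuntzLE (g * a * g) g := by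
  have h1 := star_left_conjugate_nonneg ha g
  have h2 := CStarAlgebra.star_left_conjugate_le_norm_smul (a := g) (b := a) ha.isSelfAdjoint
  rw [hg.isSelfAdjoint.star_eq] at h1 h2
  exact (cuntzLE_of_le h1 h2).trans ((cuntzLE_mul_self hg).smul_left (norm_nonneg _))

/-- With `y = (1 - g) √a` the compression is `y y⋆`, while `y⋆ y = √a (1 - g) ^ 2 √a ≤ 2 a`. -/
lemma cuntzLE_compr {g a : C} (hg : 0 ≤ g) (hg1 : ‖g‖ ≤ 1) (ha : 0 ≤ a) :
    CuntzLE (compr g a) a := by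
  set r := CFC.sqrt a with hr
  have hrs : star r = r := (CFC.sqrt_nonneg a).isSelfAdjoint.star_eq
  have hrr : r * r = a := CFC.sqrt_mul_sqrt_self a ha
  have h1 := compr_conj' (g := g) (c := r) hg.isSelfAdjoint rfl
  rw [hrs, hrr] at h1
  rw [h1]
  refine (cuntzLE_of_star_mul_self_le (b := (2 : ℝ) • a) ?_).trans
    ((CuntzLE.refl ha).smul_left (by norm_num))
  have e : star (r - g * r) * (r - g * r) = a + r * (g * g) * r - (2 : ℝ) • (r * g * r) := by
    rw [star_sub, star_mul, hrs, hg.isSelfAdjoint.star_eq, two_smul, ← hrr]; noncomm_ring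
  rw [e, two_smul ℝ a]
  have h2 : 0 ≤ (2 : ℝ) • (r * g * r) := smul_nonneg (by norm_num) (by
    have := star_left_conjugate_nonneg hg r
    rwa [hrs] at this)
  refine (sub_le_self _ h2).trans (add_le_add le_rfl ?_)
  have hgg : IsSelfAdjoint (g * g) := by
    have := IsSelfAdjoint.star_mul_self g
    rwa [hg.isSelfAdjoint.star_eq] at this
  have h3 := CStarAlgebra.star_left_conjugate_le_norm_smul (a := r) (b := g * g) hgg
  rw [hrs, hrr] at h3
  refine h3.trans ?_
  conv_rhs => rw [← one_smul ℝ a]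
  refine smul_le_smul_of_nonneg_right ?_ ha
  calc ‖g * g‖ ≤ ‖g‖ * ‖g‖ := norm_mul_le _ _
    _ ≤ 1 := by nlinarith [norm_nonneg g]

end Compression

/-- In `a ≤ 2 (1 - g) a (1 - g) + 2 g a g` the first term is replaced by `2 x` with an error below
`ε`, which the cut-down absorbs, and the second is subequivalent to `g`. -/
lemma Cu.cls_cut_le_of_compr {A : Type*} [NonUnitalCStarAlgebra A] (a g x : StabPos A) {ε : ℝ}
    (h : ‖compr g.val a.val - x.val‖ < ε / 2) : Cu.cls (a.cut ε) ≤ Cu.cls x + Cu.cls g := by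
  have ha := a.nonneg
  have hg := g.nonneg
  have hc := compr_nonneg hg.isSelfAdjoint ha
  have hgag : 0 ≤ g.val * a.val * g.val := by
    have := star_left_conjugate_nonneg ha g.val
    rwa [hg.isSelfAdjoint.star_eq] at this
  have h1 : CuntzLE (cut a.val ε) ((2 : ℝ) • x.val + (2 : ℝ) • (g.val * a.val * g.val)) := by
    refine cut_cuntzLE_of_le_add (e := (2 : ℝ) • (compr g.val a.val - x.val)) ha
      ((IsSelfAdjoint.all (2 : ℝ)).smul (hc.isSelfAdjoint.sub x.nonneg.isSelfAdjoint)) ?_ ?_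
    · refine (le_compr_add hg.isSelfAdjoint ha).trans_eq ?_
      module
    · rw [norm_smul, Real.norm_eq_abs, abs_of_pos two_pos]; linarith
  have n1 : 0 ≤ (2 : ℝ) • x.val := smul_nonneg (by norm_num) x.nonneg
  have n2 : 0 ≤ (2 : ℝ) • (g.val * a.val * g.val) := smul_nonneg (by norm_num) hgag
  have h2 : Cu.cls (a.cut ε) ≤ Cu.cls ⟨_, add_nonneg n1 n2⟩ := h1
  refine (h2.trans (Cu.cls_add_le n1 n2 _)).trans (add_le_add ?_ ?_)
  · exact (CuntzLE.refl x.nonneg).smul_left (by norm_num)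
  · exact (cuntzLE_conj_self hg ha).smul_left (by norm_num)

variable {A B : Type*} [CStarAlgebra A] [CStarAlgebra B]

/-- The defining property of the inclusion of a large subalgebra. -/
def IsLargeHom (φ : B →⋆ₙₐ[ℂ] A) : Prop :=
  ∀ (n : ℕ) (a : Fin n → A) (ε : ℝ) (x : A) (y : B), 0 < ε → 0 ≤ x → ‖x‖ = 1 → 0 ≤ y → y ≠ 0 →
    ∃ (c : Fin n → A) (g : B), 0 ≤ g ∧ ‖g‖ ≤ 1 ∧ (∀ j, ‖c j - a j‖ < ε) ∧
      (∀ j, ∃ w, c j - φ g * c j = φ w) ∧ CuntzLE g y ∧ CuntzLE (φ g) x ∧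
      1 - ε < ‖compr (φ g) x‖

/-- Homomorphism version of `diagMat`. -/
def diagHom (A : Type*) [NonUnitalCStarAlgebra A] (n : ℕ) :
    A →⋆ₙₐ[ℂ] CStarMatrix (Fin n) (Fin n) A where
  toFun := diagMat
  map_smul' c a := by simp only [diagMat, unitMat_smul, Finset.smul_sum]; rfl
  map_zero' := by
    refine Finset.sum_eq_zero fun i _ => ?_
    exact map_zero (unitHom A i)
  map_add' a b := by simp only [diagMat, unitMat_add, Finset.sum_add_distrib]
  map_mul' a b := by
    conv_rhs => enter [2]; unfold diagMat
    rw [diagMat, Finset.mul_sum]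
    refine Finset.sum_congr rfl fun i _ => ?_
    ext j k
    rw [diagMat_mul_apply]
    simp only [unitMat, CStarMatrix.ofMatrix_apply, Matrix.single, Matrix.of_apply]
    split_ifs <;> simp
  map_star' a := by simp only [diagMat, star_sum, star_unitMat]

variable {φ : B →⋆ₙₐ[ℂ] A} (hφ : Function.Injective φ)

lemma mapHom_embMat (n : ℕ) (M : CStarMatrix (Fin n) (Fin n) B) :
    Stab.mapHom φ hφ (embMat B n M) = embMat A n (CStarMatrix.mapₙₐ φ M) := Stab.mapHom_incl hφ _

lemma mapₙₐ_unitMat {n : ℕ} (i j : Fin n) (b : B) :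
    CStarMatrix.mapₙₐ φ (unitMat i j b) = unitMat i j (φ b) := by
  ext k l
  show φ (unitMat i j b k l) = _
  simp only [unitMat, CStarMatrix.ofMatrix_apply, Matrix.single, Matrix.of_apply]
  split_ifs <;> simp

lemma mapHom_embCorner (b : B) :
    Stab.mapHom φ hφ (embCorner B b) = embCorner A (φ b) := by
  show Stab.mapHom φ hφ (embMat B 1 (unitMat 0 0 b)) = embMat A 1 (unitMat 0 0 (φ b))
  rw [mapHom_embMat, mapₙₐ_unitMat]

lemma mapₙₐ_diagMat (n : ℕ) (b : B) :
    CStarMatrix.mapₙₐ (n := Fin n) φ (diagMat b) = diagMat (φ b) := by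
  simp only [diagMat, map_sum, mapₙₐ_unitMat]

/-- Largeness passes to the stabilizations. -/
lemma IsLargeHom.stab (hL : IsLargeHom φ) (hpA : IsPrimeAlg A) (hmA : NoMinimal A)
    (hpB : IsPrimeAlg B) (hmB : NoMinimal B) (v : Stab A) {ε : ℝ} (hε : 0 < ε) {x : Cu A}
    (hx : x ≠ 0) {y : Cu B} (hy : y ≠ 0) :
    ∃ (c : Stab A) (g : StabPos B) (w : Stab B), ‖c - v‖ < ε ∧
      c - Stab.mapHom φ hφ g.val * c = Stab.mapHom φ hφ w ∧ ‖g.val‖ ≤ 1 ∧ Cu.cls g ≤ y ∧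
      Cu.map hφ (Cu.cls g) ≤ x := by
  obtain ⟨n, M, hM⟩ := exists_embMat_near v (half_pos hε)
  -- The cutting element will be `g` repeated `n + 1` times on the diagonal, so each copy must be
  -- this much smaller.
  obtain ⟨x₁, hx₁, hx'⟩ := Cu.exists_nsmul_le hpA hmA (n + 1) hx
  obtain ⟨y₁, hy₁, hy'⟩ := Cu.exists_nsmul_le hpB hmB (n + 1) hy
  obtain ⟨x₀, hx0, hx01, hx0'⟩ := Cu.exists_ofPos_le hx₁
  obtain ⟨y₀, hy0, hy01, hy0'⟩ := Cu.exists_ofPos_le hy₁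
  have hy00 : y₀ ≠ 0 := by rintro rfl; simp at hy01
  -- All entries of `M` form one finite family, so that a single `g` serves them all.
  let e : Fin (n + 1) × Fin (n + 1) ≃ Fin ((n + 1) * (n + 1)) := finProdFinEquiv
  obtain ⟨δ, hδ, hδε⟩ : ∃ δ > 0, ((n + 1 : ℕ) : ℝ) * (((n + 1 : ℕ) : ℝ) * δ) ≤ ε / 2 := by
    refine ⟨ε / 2 / (((n + 1 : ℕ) : ℝ) * ((n + 1 : ℕ) : ℝ)), by positivity, le_of_eq ?_⟩
    field_simp
  obtain ⟨c, g, hg0, hg1, hc, hw, hgy, hgx, -⟩ := hL ((n + 1) * (n + 1))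
    (fun k => M (e.symm k).1 (e.symm k).2) δ x₀ y₀ hδ hx0 hx01 hy0 hy00
  choose w hw using hw
  let C : CStarMatrix (Fin (n + 1)) (Fin (n + 1)) A := CStarMatrix.ofMatrix fun i j => c (e (i, j))
  let W : CStarMatrix (Fin (n + 1)) (Fin (n + 1)) B := CStarMatrix.ofMatrix fun i j => w (e (i, j))
  obtain ⟨hG, hG'⟩ := Cu.cls_diagMat_le n hg0
  refine ⟨embMat A (n + 1) C, ⟨embMat B (n + 1) (diagMat g), hG⟩, embMat B (n + 1) W, ?_, ?_, ?_,
    ?_, ?_⟩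
  · have h1 : ‖embMat A (n + 1) C - embMat A (n + 1) M‖ ≤ ε / 2 := by
      rw [← map_sub, norm_embMat]
      refine (norm_matrix_le _ fun i j => ?_).trans hδε
      have := (hc (e (i, j))).le
      rw [Equiv.symm_apply_apply] at this
      exact this
    rw [norm_sub_rev] at hM
    have := norm_sub_le_norm_sub_add_norm_sub (embMat A (n + 1) C) (embMat A (n + 1) M) v
    linarith
  · simp only [mapHom_embMat, mapₙₐ_diagMat]
    rw [← map_mul, ← map_sub]
    congr 1
    ext i j
    show C i j - (diagMat (φ g) * C : CStarMatrix (Fin (n + 1)) (Fin (n + 1)) A) i j = φ (W i j)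
    rw [diagMat_mul_apply]
    exact hw (e (i, j))
  · rw [norm_embMat]
    exact (NonUnitalStarAlgHom.norm_apply_le (diagHom B (n + 1)) g).trans hg1
  · refine hG'.trans (le_trans (nsmul_le_nsmul_right ?_ _) hy')
    exact (Cu.ofPos_le hg0 hy0 hgy).trans hy0'
  · refine (Cu.map_mono hφ hG').trans ?_
    rw [map_nsmul]
    refine le_trans (nsmul_le_nsmul_right ?_ _) hx'
    refine le_trans ?_ ((Cu.ofPos_le (map_nonneg_hom φ hg0) hx0 hgx).trans hx0')
    have : Cu.map hφ (Cu.ofPos g hg0) = Cu.ofPos (φ g) (map_nonneg_hom φ hg0) := by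
      unfold Cu.ofPos
      rw [Cu.map_cls]
      congr 1
      simp only [StabPos.map, mapHom_embCorner]
    exact this.le

/-- Subequivalence in `A` implies subequivalence in a large subalgebra, up to an arbitrarily small
error. -/
lemma IsLargeHom.le_add (hL : IsLargeHom φ) (hpA : IsPrimeAlg A) (hmA : NoMinimal A)
    (hpB : IsPrimeAlg B) (hmB : NoMinimal B) {x y z : Cu B} (h : Cu.map hφ x ≤ Cu.map hφ y)
    (hz : z ≠ 0) : x ≤ y + z := by
  -- Otherwise this class fills the slot for a nonzero class of `Cu(A)` in `IsLargeHom.stab`; the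
  -- bound it gives on `g` is discarded.
  by_cases hx : Cu.map hφ x = 0
  · rw [Cu.eq_zero_of_map hφ hx]; exact Cu.zero_le' _
  induction x using Cu.ind with | h a
  induction y using Cu.ind with | h b
  have key : ∀ ε > 0, Cu.cls (a.cut ε) ≤ Cu.cls b + z := by
    intro ε hε
    obtain ⟨v, hv⟩ : CuntzLE (Stab.mapHom φ hφ a.val) (Stab.mapHom φ hφ b.val) := h
    obtain ⟨n, hn⟩ := ((tendsto_iff_norm_sub_tendsto_zero.1 hv).eventually
      (gt_mem_nhds (by positivity : 0 < ε / 8))).exists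
    -- The conjugating element may be perturbed slightly. Compression multiplies norms by at most
    -- `4`, so `ε / 8` becomes `ε / 2`.
    have hopen : IsOpen {c : Stab A | ‖c * Stab.mapHom φ hφ b.val * star c -
        Stab.mapHom φ hφ a.val‖ < ε / 8} := isOpen_lt (by fun_prop) (by fun_prop)
    obtain ⟨δ, hδ, hball⟩ := Metric.isOpen_iff.1 hopen (v n) hn
    obtain ⟨c, g, w, hc, hw, hg, hgz, -⟩ := hL.stab hφ hpA hmA hpB hmB (v n) hδ hx hz
    have hc' := hball (by rwa [Metric.mem_ball, dist_eq_norm])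
    have hsa := (map_nonneg_hom (Stab.mapHom φ hφ) g.nonneg).isSelfAdjoint
    have hX : 0 ≤ w * b.val * star w := star_right_conjugate_nonneg b.nonneg w
    have hdist : ‖compr g.val a.val - w * b.val * star w‖ < ε / 2 := by
      rw [← Stab.norm_mapHom hφ, map_sub, map_compr, map_mul, map_mul, map_star,
        ← compr_conj hsa hw, ← compr_sub]
      refine (norm_compr_le (by rwa [Stab.norm_mapHom]) _).trans_lt ?_
      rw [norm_sub_rev]
      have := hc'.out
      linarith
    have h1 := Cu.cls_cut_le_of_compr a g ⟨_, hX⟩ hdist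
    refine h1.trans (add_le_add ?_ hgz)
    exact cuntzLE_conj w b.val
  induction z using Cu.ind with | h z
  exact (isClosed_cuntzLE _).mem_of_tendsto (cut_tendsto a.nonneg)
    (Eventually.of_forall fun n => key _ (by positivity))

/-- Approximation of elements of `Cu(A)` by sums from `Cu(B)`. -/
lemma IsLargeHom.exists_approx [Nontrivial B] (hL : IsLargeHom φ) (hpA : IsPrimeAlg A)
    (hmA : NoMinimal A) (hpB : IsPrimeAlg B) (hmB : NoMinimal B) (a : StabPos A) {ε : ℝ}
    (hε : 0 < ε) {s : Cu A} (hs : s ≠ 0) :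
    ∃ d γ : Cu B, Cu.map hφ d ≤ Cu.cls a ∧ Cu.map hφ γ ≤ s ∧
      Cu.cls (a.cut ε) ≤ Cu.map hφ d + Cu.map hφ γ := by
  -- Any nonzero class will do, since the bound on `g` in `Cu(B)` is discarded.
  obtain ⟨y, hy⟩ : ∃ y : Cu B, y ≠ 0 := by
    refine ⟨Cu.ofPos 1 zero_le_one, ?_⟩
    rw [Cu.ofPos, Ne, Cu.cls_eq_zero_iff]
    intro h
    exact one_ne_zero (embCorner_injective (h.trans (map_zero _).symm))
  have ha := a.nonneg
  set r := CFC.sqrt a.val with hr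
  have hrs : star r = r := (CFC.sqrt_nonneg a.val).isSelfAdjoint.star_eq
  have hrr : r * r = a.val := CFC.sqrt_mul_sqrt_self a.val ha
  -- With `c` close to `√a` and `w = (1 - g) c` from `B ⊗ K`, the element `w w⋆` lies within `4 (ε /
  -- 16) = ε / 4` of the compression of `a`.
  have hopen : IsOpen {c : Stab A | ‖a.val - c * star c‖ < ε / 16} :=
    isOpen_lt (by fun_prop) (by fun_prop)
  obtain ⟨δ, hδ, hball⟩ := Metric.isOpen_iff.1 hopen r (by
    simp only [Set.mem_ofPred_eq, hrs, hrr, sub_self, norm_zero]; positivity)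
  obtain ⟨c, g, w, hc, hw, hg, -, hgs⟩ := hL.stab hφ hpA hmA hpB hmB r hδ hs hy
  have hc' : ‖a.val - c * star c‖ < ε / 16 := hball (by rwa [Metric.mem_ball, dist_eq_norm])
  have hG := map_nonneg_hom (Stab.mapHom φ hφ) g.nonneg
  have hG1 : ‖Stab.mapHom φ hφ g.val‖ ≤ 1 := by rwa [Stab.norm_mapHom]
  have hww := mul_star_self_nonneg w
  have hd1 : ‖compr (Stab.mapHom φ hφ g.val) a.val - Stab.mapHom φ hφ (w * star w)‖ < ε / 4 := by
    rw [map_mul, map_star, ← compr_conj' hG.isSelfAdjoint hw, ← compr_sub]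
    exact (norm_compr_le hG1 _).trans_lt (by linarith)
  -- Cutting `w w⋆` by `ε / 4` makes it exactly subequivalent to `(1 - g) a (1 - g) ≾ a`, and the
  -- total distance stays below `ε / 2`.
  refine ⟨Cu.cls (StabPos.cut ⟨w * star w, hww⟩ (ε / 4)), Cu.cls g, ?_, hgs, ?_⟩
  · have h1 : CuntzLE (Stab.mapHom φ hφ (cut (w * star w) (ε / 4)))
        (compr (Stab.mapHom φ hφ g.val) a.val) := by
      rw [map_cut _ hww (by positivity)]
      rw [norm_sub_rev] at hd1
      exact cut_cuntzLE_of_norm_sub_lt (map_nonneg_hom _ hww)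
        (compr_nonneg hG.isSelfAdjoint ha).isSelfAdjoint hd1
    exact h1.trans (cuntzLE_compr hG hG1 ha)
  · refine Cu.cls_cut_le_of_compr a (g.map hφ)
      ((StabPos.cut ⟨w * star w, hww⟩ (ε / 4)).map hφ) ?_
    have h2 : ‖w * star w - cut (w * star w) (ε / 4)‖ ≤ ε / 4 :=
      norm_sub_cut_le hww (by positivity)
    rw [← Stab.norm_mapHom hφ, map_sub] at h2
    have := norm_sub_le_norm_sub_add_norm_sub (compr (Stab.mapHom φ hφ g.val) a.val)
      (Stab.mapHom φ hφ (w * star w)) (Stab.mapHom φ hφ (cut (w * star w) (ε / 4)))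
    show ‖compr (Stab.mapHom φ hφ g.val) a.val - Stab.mapHom φ hφ (cut (w * star w) (ε / 4))‖ < _
    linarith

lemma Cu.exists_cut_ne_zero (a : StabPos A) (ha : Cu.cls a ≠ 0) :
    ∃ ε > 0, Cu.cls (a.cut ε) ≠ 0 := by
  by_contra! h
  rw [Ne, Cu.cls_eq_zero_iff] at ha
  have h' : ∀ ε > 0, cut a.val ε = 0 := fun ε hε => Cu.cls_eq_zero_iff.1 (h ε hε)
  exact ha (tendsto_nhds_unique (cut_tendsto a.nonneg) (by
    simp only [h' _ (Nat.one_div_pos_of_nat), tendsto_const_nhds]))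

/-- In `exists_approx` with `s` also as the error bound, `d` and `γ` cannot both vanish, since a
nonzero cut-down lies below their sum. -/
lemma IsLargeHom.exists_map_le [Nontrivial B] (hL : IsLargeHom φ) (hpA : IsPrimeAlg A)
    (hmA : NoMinimal A) (hpB : IsPrimeAlg B) (hmB : NoMinimal B) {s : Cu A} (hs : s ≠ 0) :
    ∃ z : Cu B, z ≠ 0 ∧ Cu.map hφ z ≤ s := by
  induction s using Cu.ind with | h a
  obtain ⟨ε, hε, h⟩ := Cu.exists_cut_ne_zero a hs
  obtain ⟨d, γ, h1, h2, h3⟩ := hL.exists_approx hφ hpA hmA hpB hmB a hε hs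
  by_cases hd : d = 0
  · refine ⟨γ, ?_, h2⟩
    rintro rfl
    apply h
    rw [hd, map_zero, add_zero] at h3
    exact le_antisymm h3 (Cu.zero_le' _)
  · exact ⟨d, hd, h1⟩

/-- Room `c + s ≤ a` is made first. Then `c` is approximated by `d + γ` from `Cu(B)` with `d ≤ c`
and `γ ≤ s`, so `d + γ ≤ a`, and `d + γ` is divided in `Cu(B)`. The factor two is the price of the
room. -/
theorem AlmostDivisible.of_large [Nontrivial B] (hL : IsLargeHom φ) (hpA : IsPrimeAlg A)
    (hmA : NoMinimal A) (hpB : IsPrimeAlg B) (hmB : NoMinimal B) (hφ : Function.Injective φ) {m : ℕ}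
    (hB : AlmostDivisible B m) : AlmostDivisible A (2 * m + 1) := by
  intro x' x hx N hN
  induction x using Cu.ind with | h a
  obtain ⟨ε, hε, hx1⟩ := hx.exists_cut
  by_cases h0 : Cu.cls (a.cut ε) = 0
  · refine ⟨0, by rw [smul_zero]; exact Cu.zero_le' _, ?_⟩
    exact (hx1.le.trans h0.le).trans (Cu.zero_le' _)
  obtain ⟨c, s, hs, hcs, hac⟩ := Cu.exists_room hpA hmA a hε h0
  -- Two cut-downs follow, of `c` and of `e`; each consumes one `≪`.
  obtain ⟨y', hx2, hy'⟩ := hx1.exists_between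
  obtain ⟨δ, hδ, hy''⟩ := Cu.exists_le_nsmul_cut hy' 2 c hac
  obtain ⟨d, γ, hd, hγ, hdγ⟩ := hL.exists_approx hφ hpA hmA hpB hmB c hδ hs
  obtain ⟨e, he⟩ := Cu.exists_cls (d + γ)
  have h1 : y' ≤ 2 • Cu.cls (e.map hφ) := by
    rw [← Cu.map_cls, he, map_add]
    exact hy''.trans (nsmul_le_nsmul_right hdγ 2)
  obtain ⟨τ, hτ, h2⟩ := Cu.exists_le_nsmul_cut hx2 2 (e.map hφ) h1
  obtain ⟨η, hη1, hη2⟩ := hB _ _ (Cu.wayBelow_cls_cut e hτ) N hN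
  refine ⟨Cu.map hφ η, ?_, ?_⟩
  · rw [← map_nsmul]
    refine (Cu.map_mono hφ hη1).trans ?_
    rw [he, map_add]
    exact (add_le_add hd hγ).trans hcs
  · rw [← StabPos.map_cut hφ _ hτ.le, ← Cu.map_cls] at h2
    refine h2.trans ((nsmul_le_nsmul_right (Cu.map_mono hφ hη2) 2).trans_eq ?_)
    rw [map_nsmul, ← mul_smul]
    congr 1; ring

/-- Room `c + s ≤ b` is made in `B` to absorb the comparison error, and the image of `c` is divided
in `Cu(A)`. The quotient `e` is then given room in `A`, so that it can be replaced from below by a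
class of `Cu(B)`. -/
theorem AlmostDivisible.of_large_sub [Nontrivial B] (hL : IsLargeHom φ) (hpA : IsPrimeAlg A)
    (hmA : NoMinimal A) (hpB : IsPrimeAlg B) (hmB : NoMinimal B) (hφ : Function.Injective φ) {m : ℕ}
    (hA : AlmostDivisible A m) : AlmostDivisible B (4 * m + 3) := by
  intro x' x hx N hN
  obtain ⟨K, hK⟩ : ∃ K, K = (N + 1) * (m + 1) := ⟨_, rfl⟩
  have hK1 : 1 ≤ K := by rw [hK]; exact Nat.one_le_iff_ne_zero.2 (by positivity)
  suffices ∃ y : Cu B, N • y ≤ x ∧ x' ≤ (4 * K) • y by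
    obtain ⟨y, h1, h2⟩ := this
    exact ⟨y, h1, h2.trans_eq (by congr 1; rw [hK]; ring)⟩
  induction x using Cu.ind with | h b
  obtain ⟨ε, hε, hx1⟩ := hx.exists_cut
  have htriv : x' ≤ 0 → ∃ y : Cu B, N • y ≤ Cu.cls b ∧ x' ≤ (4 * K) • y := fun h =>
    ⟨0, by rw [smul_zero]; exact Cu.zero_le' _, h.trans (Cu.zero_le' _)⟩
  by_cases h0 : Cu.cls (b.cut ε) = 0
  · exact htriv (hx1.le.trans h0.le)
  obtain ⟨c, s, hs, hcs, hbc⟩ := Cu.exists_room hpB hmB b hε h0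
  obtain ⟨δ, hδ, hx'⟩ := Cu.exists_le_nsmul_cut hx1 2 c hbc
  obtain ⟨η, hη1, hη2⟩ := hA _ _ (Cu.wayBelow_cls_cut (c.map hφ) (half_pos hδ)) N hN
  rw [← hK] at hη2
  have hξ := Cu.wayBelow_cut_cut (c.map hφ) (half_pos hδ) (half_lt_self hδ)
  obtain ⟨y₁, hξ1, hy₁⟩ := hξ.exists_between
  induction η using Cu.ind with | h e
  obtain ⟨τ, hτ, hy₁'⟩ := Cu.exists_le_nsmul_cut hy₁ K e hη2
  by_cases h1 : Cu.cls (e.cut τ) = 0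
  · rw [h1, smul_zero] at hy₁'
    have h2 : Cu.map hφ (Cu.cls (c.cut δ)) = 0 := by
      rw [Cu.map_cls, StabPos.map_cut hφ _ hδ.le]
      exact le_antisymm (hξ1.le.trans hy₁') (Cu.zero_le' _)
    rw [Cu.eq_zero_of_map hφ h2, smul_zero] at hx'
    exact htriv hx'
  obtain ⟨e₁, s₁, hs₁, hes, hee⟩ := Cu.exists_room hpA hmA e hτ h1
  have h3 : y₁ ≤ (K * 2) • Cu.cls e₁ := by
    rw [mul_smul]; exact hy₁'.trans (nsmul_le_nsmul_right hee K)
  obtain ⟨τ₁, hτ₁, h4⟩ := Cu.exists_le_nsmul_cut hξ1 (K * 2) e₁ h3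
  -- The room `s₁` has to hold two small classes: the approximation error `γ` and the comparison
  -- error `z`.
  obtain ⟨s₂, hs₂, hs₂'⟩ := Cu.exists_two_nsmul_le hpA hmA hs₁
  obtain ⟨d, γ, hd, hγ, hdγ⟩ := hL.exists_approx hφ hpA hmA hpB hmB e₁ hτ₁ hs₂
  obtain ⟨z, hz, hzs⟩ := hL.exists_map_le hφ hpA hmA hpB hmB hs₂
  refine ⟨d + γ + z, ?_, ?_⟩
  · refine (hL.le_add hφ hpA hmA hpB hmB (y := Cu.cls c) ?_ hs).trans hcs
    rw [map_nsmul, map_add, map_add, Cu.map_cls]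
    refine (nsmul_le_nsmul_right ?_ N).trans hη1
    refine le_trans ?_ hes
    rw [add_assoc]
    refine add_le_add hd (le_trans ?_ hs₂')
    rw [two_nsmul]
    exact add_le_add hγ hzs
  -- The comparison error `z` is already a summand of the quotient `d + γ + z`, so it is absorbed in
  -- the multiple.
  · have h5 : Cu.cls (c.cut δ) ≤ (K * 2) • (d + γ) + z := by
      refine hL.le_add hφ hpA hmA hpB hmB ?_ hz
      rw [Cu.map_cls, StabPos.map_cut hφ _ hδ.le, map_nsmul, map_add]
      exact h4.trans (nsmul_le_nsmul_right hdγ _)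
    have h6 : z ≤ (K * 2) • z := by
      conv_lhs => rw [← one_smul ℕ z]
      exact nsmul_le_nsmul_left (Cu.zero_le' z) (by omega)
    have h7 : Cu.cls (c.cut δ) ≤ (K * 2) • (d + γ + z) := by
      rw [smul_add _ (d + γ) z]
      exact h5.trans (add_le_add_right h6 _)
    refine (hx'.trans (nsmul_le_nsmul_right h7 2)).trans_eq ?_
    rw [← mul_smul]
    congr 1; ring

end Transfer

/-! ### Primeness and absence of minimal projections, for simple algebras and their large
subalgebras. -/

section SimpleAlgebras

attribute [local instance] CStarAlgebra.spectralOrder CStarAlgebra.spectralOrderedRing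

variable {A B : Type*} [CStarAlgebra A] [CStarAlgebra B]

/-- The elements annihilated on the left by `x A` form a closed two-sided ideal, which is `0` or
contains the unit. -/
lemma IsSimple.isPrimeAlg (hA : IsSimple A) : IsPrimeAlg A := by
  intro x y h
  let I : TwoSidedIdeal A := TwoSidedIdeal.mk' {z | ∀ s, x * s * z = 0} (by simp)
    (fun {u v} hu hv s => by rw [mul_add, hu s, hv s, add_zero])
    (fun {u} hu s => by rw [mul_neg, hu s, neg_zero])
    (fun {u v} hv s => by rw [← mul_assoc, mul_assoc x]; exact hv _)
    (fun {u v} hu s => by rw [← mul_assoc, hu s, zero_mul])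
  have hI : ∀ z, z ∈ I ↔ ∀ s, x * s * z = 0 := fun z => TwoSidedIdeal.mem_mk' ..
  have hc : IsClosed (I : Set A) := by
    have : (I : Set A) = ⋂ s, {z | x * s * z = 0} := by
      ext z; rw [SetLike.mem_coe, hI]; simp
    rw [this]
    exact isClosed_iInter fun s => isClosed_eq (by fun_prop) (by fun_prop)
  have hy : y ∈ I := (hI y).2 h
  rcases hA.2 I hc with h0 | h1
  · rw [h0, TwoSidedIdeal.mem_bot] at hy
    exact Or.inr hy
  · have : (1 : A) ∈ I := by rw [h1]; trivial
    have := (hI 1).1 this 1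
    exact Or.inl (by simpa using this)

/-- The unit of a simple unital algebra belongs to the algebraic ideal generated by any nonzero
element. -/
lemma IsSimple.one_mem_span (hA : IsSimple A) {a : A} (ha : a ≠ 0) :
    (1 : A) ∈ Submodule.span ℂ {z | ∃ x y, z = x * a * y} := by
  have := hA.1
  set S := Submodule.span ℂ {z : A | ∃ x y, z = x * a * y} with hS
  have hl : ∀ u v, v ∈ S → u * v ∈ S := by
    intro u v hv
    induction hv using Submodule.span_induction with
    | mem v hv =>
      obtain ⟨x, y, rfl⟩ := hv
      exact Submodule.subset_span ⟨u * x, y, by simp only [mul_assoc]⟩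
    | zero => rw [mul_zero]; exact S.zero_mem
    | add v w _ _ h1 h2 => rw [mul_add]; exact S.add_mem h1 h2
    | smul c v _ h => rw [mul_smul_comm]; exact S.smul_mem c h
  have hr : ∀ u v, u ∈ S → u * v ∈ S := by
    intro u v hu
    induction hu using Submodule.span_induction with
    | mem u hu =>
      obtain ⟨x, y, rfl⟩ := hu
      exact Submodule.subset_span ⟨x, y * v, by simp only [mul_assoc]⟩
    | zero => rw [zero_mul]; exact S.zero_mem
    | add v w _ _ h1 h2 => rw [add_mul]; exact S.add_mem h1 h2
    | smul c v _ h => rw [smul_mul_assoc]; exact S.smul_mem c h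
  let I : TwoSidedIdeal A := TwoSidedIdeal.mk' (S.topologicalClosure : Set A)
    S.topologicalClosure.zero_mem S.topologicalClosure.add_mem
    (fun h => S.topologicalClosure.neg_mem h)
    (fun {u v} hv => map_mem_closure (f := fun z => u * z) (by fun_prop) hv fun z hz => hl u z hz)
    (fun {u v} hu => map_mem_closure (f := fun z => z * v) (by fun_prop) hu fun z hz => hr z v hz)
  have hI : (I : Set A) = S.topologicalClosure := by
    ext z; exact TwoSidedIdeal.mem_mk' ..
  have hc : IsClosed (I : Set A) := by rw [hI]; exact S.isClosed_topologicalClosure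
  have haI : a ∈ (I : Set A) := by
    rw [hI]
    exact S.le_topologicalClosure (Submodule.subset_span ⟨1, 1, by simp⟩)
  have h1 : (1 : A) ∈ closure (S : Set A) := by
    rcases hA.2 I hc with h0 | h1
    · rw [h0] at haI
      exact (ha ((TwoSidedIdeal.mem_bot A).1 haI)).elim
    · have : (1 : A) ∈ (I : Set A) := by rw [h1]; trivial
      rwa [hI] at this
  -- An element of the algebraic ideal at distance less than one from the unit is invertible, so no
  -- closure is needed.
  obtain ⟨s, hs, hs1⟩ := Metric.mem_closure_iff.1 h1 1 one_pos
  rw [dist_eq_norm] at hs1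
  have hu : IsUnit s := by
    have := isUnit_one_sub_of_norm_lt_one hs1
    rwa [sub_sub_cancel] at this
  obtain ⟨u, rfl⟩ := hu
  have := hl (↑u⁻¹ : A) u hs
  rwa [Units.inv_mul] at this

/-- Suppose `a A a = ℂ a` and write `1` as a combination of elements `xᵢ a yᵢ`. Then `z = 1 z 1` is
a combination of `xᵢ a (yᵢ z xⱼ) a yⱼ`, so the finitely many `xᵢ a yⱼ` span `A`. -/
lemma IsSimple.noMinimal (hA : IsSimple A) (hinf : ¬ FiniteDimensional ℂ A) : NoMinimal A := by
  intro a ha ha0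
  by_contra! hmin
  apply hinf
  obtain ⟨T, hT, h1⟩ := Submodule.mem_span_finite_of_mem_span (hA.one_mem_span ha0)
  choose! X Y hXY using fun t (ht : t ∈ T) => hT ht
  let F := Submodule.span ℂ ((fun p : A × A => X p.1 * a * Y p.2) '' (T ×ˢ T : Finset (A × A)))
  have hF : ∀ z, z ∈ F := by
    intro z
    have key : ∀ u ∈ Submodule.span ℂ (T : Set A), ∀ v ∈ Submodule.span ℂ (T : Set A),
        u * z * v ∈ F := by
      intro u hu v hv
      induction hu using Submodule.span_induction with
      | mem u hu =>
        induction hv using Submodule.span_induction with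
        | mem v hv =>
          obtain ⟨c, hc⟩ := hmin (Y u * z * X v)
          have : u * z * v = c • (X u * a * Y v) := by
            rw [hXY u hu, hXY v hv]
            calc _ = X u * (a * (Y u * z * X v) * a) * Y v := by
                  simp only [← hXY u hu, ← hXY v hv]
                  conv_lhs => rw [hXY u hu, hXY v hv]
                  simp only [mul_assoc]
              _ = _ := by
                rw [hc, mul_smul_comm, smul_mul_assoc]
                simp only [← hXY u hu, ← hXY v hv]
          rw [this]
          refine F.smul_mem c (Submodule.subset_span ⟨(u, v), ?_, rfl⟩)
          simpa using ⟨hu, hv⟩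
        | zero => rw [mul_zero]; exact F.zero_mem
        | add v w _ _ h1 h2 => rw [mul_add]; exact F.add_mem h1 h2
        | smul c v _ h => rw [mul_smul_comm]; exact F.smul_mem c h
      | zero => rw [zero_mul, zero_mul]; exact F.zero_mem
      | add v w _ _ h1 h2 => rw [add_mul, add_mul]; exact F.add_mem h1 h2
      | smul c v _ h => rw [smul_mul_assoc, smul_mul_assoc]; exact F.smul_mem c h
    simpa using key 1 h1 1 h1
  have hfin : F.FG := Submodule.fg_span ((Finset.finite_toSet _).image _)
  have htop : F = ⊤ := by ext z; simp [hF z]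
  rw [htop] at hfin
  exact ⟨hfin⟩

variable {φ : B →⋆ₙₐ[ℂ] A}

/-- If `u B v = 0`, choose `g ≾ v v⋆`, which forces `u g = 0`. For `c` near `z` with `(1 - g) c` in
`B` this gives `u c v = u (1 - g) c v = 0`; hence `u A v = 0`. -/
lemma IsLargeHom.isPrimeAlg [Nontrivial A] (hL : IsLargeHom φ) (hφ : Function.Injective φ)
    (hA : IsPrimeAlg A) : IsPrimeAlg B := by
  intro u v h
  by_contra! huv
  have hvv : v * star v ≠ 0 := fun h => huv.2 (CStarRing.mul_star_self_eq_zero_iff v |>.1 h)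
  have key : ∀ z, φ u * z * φ v = 0 := by
    intro z
    have hb : ∀ ε > 0, ‖φ u * z * φ v‖ ≤ ε * (‖φ u‖ * ‖φ v‖) := by
      intro ε hε
      obtain ⟨c, g, hg0, hg1, hc, hw, hgy, -, -⟩ := hL 1 (fun _ => z) ε 1 (v * star v) hε
        zero_le_one norm_one (mul_star_self_nonneg v) hvv
      obtain ⟨w, hw⟩ := hw 0
      have hug : u * g = 0 := by
        obtain ⟨t, ht⟩ := hgy
        refine tendsto_nhds_unique (ht.const_mul u) ?_
        have : ∀ n, u * (t n * (v * star v) * star (t n)) = 0 := fun n => by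
          calc _ = (u * t n * v) * (star v * star (t n)) := by simp only [mul_assoc]
            _ = 0 := by rw [h, zero_mul]
        simp only [this, tendsto_const_nhds]
      have e : φ u * c 0 * φ v = 0 := by
        rw [sub_eq_iff_eq_add.1 hw, mul_add, ← mul_assoc, ← map_mul φ u g, hug, ← map_mul, map_zero,
          zero_mul, add_zero, ← map_mul, h, map_zero]
      have e2 : φ u * z * φ v = - (φ u * (c 0 - z) * φ v) := by
        rw [mul_sub, sub_mul, e]; simp
      rw [e2, norm_neg]
      have := hc 0
      calc _ ≤ ‖φ u‖ * ‖c 0 - z‖ * ‖φ v‖ :=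
            (norm_mul_le _ _).trans (mul_le_mul_of_nonneg_right (norm_mul_le _ _) (norm_nonneg _))
        _ ≤ ‖φ u‖ * ε * ‖φ v‖ := by gcongr
        _ = _ := by ring
    rw [← norm_le_zero_iff]
    refine ge_of_tendsto (x := 𝓝[>] (0 : ℝ)) (f := fun ε => ε * (‖φ u‖ * ‖φ v‖)) ?_
      (eventually_nhdsWithin_of_forall hb)
    have : Tendsto (fun ε : ℝ => ε * (‖φ u‖ * ‖φ v‖)) (𝓝 0) (𝓝 (0 * (‖φ u‖ * ‖φ v‖))) :=
      tendsto_id.mul_const _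
    rw [zero_mul] at this
    exact this.mono_left nhdsWithin_le_nhds
  rcases hA _ _ key with h | h
  · exact huv.1 (hφ (h.trans (map_zero φ).symm))
  · exact huv.2 (hφ (h.trans (map_zero φ).symm))

lemma exists_real_of_smul_nonneg {C : Type*} [NonUnitalCStarAlgebra C] {a : C} (ha : 0 ≤ a)
    (ha0 : a ≠ 0) {c : ℂ} (h : 0 ≤ c • a) : ∃ r : ℝ, 0 ≤ r ∧ c • a = r • a ∧ c = r := by
  have h1 : (c - star c) • a = 0 := by
    rw [sub_smul, sub_eq_zero]
    nth_rw 1 [← h.isSelfAdjoint.star_eq]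
    rw [star_smul, ha.isSelfAdjoint.star_eq]
  have h2 : star c = c := (sub_eq_zero.1 ((smul_eq_zero.1 h1).resolve_right ha0)).symm
  have h3 : (c.re : ℂ) = c := Complex.conj_eq_iff_re.1 h2
  have h4 : c • a = c.re • a := by
    rw [← Complex.coe_smul c.re a, h3]
  refine ⟨c.re, ?_, h4, h3.symm⟩
  by_contra! hneg
  rw [h4] at h
  have h5 : 0 ≤ (-c.re) • a := smul_nonneg (by linarith) ha
  rw [neg_smul, Left.nonneg_neg_iff] at h5
  exact (smul_eq_zero.1 (le_antisymm h5 h)).elim hneg.ne ha0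

/-- A minimal projection `a` of `B` would be minimal in `A`. The norm clause of largeness, applied
to `a` itself, makes `a g` small, so `a z a` is close to `a (1 - g) c a`, a multiple of `a` because
`(1 - g) c` lies in `B`. -/
lemma IsLargeHom.noMinimal (hL : IsLargeHom φ) (hφ : Function.Injective φ)
    (hA : NoMinimal A) : NoMinimal B := by
  intro b hb hb0
  by_contra! hmin'
  obtain ⟨a, ha, han, hmin⟩ : ∃ a : B, 0 ≤ a ∧ ‖a‖ = 1 ∧ ∀ x, ∃ c : ℂ, a * x * a = c • a := by
    refine ⟨(‖b‖⁻¹ : ℝ) • b, smul_nonneg (by positivity) hb, ?_, fun x => ?_⟩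
    · rw [norm_smul, norm_inv, norm_norm, inv_mul_cancel₀ (norm_ne_zero_iff.2 hb0)]
    · obtain ⟨c, hc⟩ := hmin' x
      refine ⟨(‖b‖⁻¹ : ℝ) • c, ?_⟩
      rw [smul_mul_assoc, smul_mul_assoc, mul_smul_comm, hc, smul_assoc, smul_comm c]
  have ha0 : a ≠ 0 := by rintro rfl; simp at han
  -- The square of `a` is a nonnegative multiple of `a`, and the norm being one forces the factor
  -- one.
  have haa : a * a = a := by
    obtain ⟨c, hc⟩ := hmin 1
    rw [mul_one] at hc
    have h1 : 0 ≤ c • a := by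
      rw [← hc]
      have := star_mul_self_nonneg a
      rwa [ha.isSelfAdjoint.star_eq] at this
    obtain ⟨r, hr, hra, -⟩ := exists_real_of_smul_nonneg ha ha0 h1
    rw [hra] at hc
    have h2 : ‖a * a‖ = 1 := by
      have := CStarRing.norm_star_mul_self (x := a)
      rwa [ha.isSelfAdjoint.star_eq, han, one_mul] at this
    rw [hc, norm_smul, han, mul_one, Real.norm_eq_abs, abs_of_nonneg hr] at h2
    rw [hc, h2, one_smul]
  obtain ⟨z, hz⟩ := hA (φ a) (map_nonneg_hom φ ha) fun h => ha0 (hφ (h.trans (map_zero φ).symm))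
  have hclosed : IsClosed (Submodule.span ℂ {φ a} : Set A) := Submodule.closed_of_finiteDimensional _
  have hmem : φ a * z * φ a ∈ (Submodule.span ℂ {φ a} : Set A) := by
    rw [← hclosed.closure_eq]
    refine Metric.mem_closure_iff.2 fun η hη => ?_
    -- The first term bounds the error from `c` approximating `z`, the second the contribution of `a
    -- g c a`.
    obtain ⟨ε, hε, hε1, hεη⟩ : ∃ ε > 0, ε ≤ 1 ∧ ε + Real.sqrt ε * (‖z‖ + 1) < η := by
      have hcont : Continuous fun ε : ℝ => ε + Real.sqrt ε * (‖z‖ + 1) := by fun_prop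
      have h0 : ∀ᶠ ε in 𝓝[>] (0 : ℝ), ε + Real.sqrt ε * (‖z‖ + 1) < η :=
        (hcont.tendsto 0).mono_left nhdsWithin_le_nhds |>.eventually
          (gt_mem_nhds (by simpa using hη))
      have h1 : ∀ᶠ ε in 𝓝[>] (0 : ℝ), ε ≤ 1 :=
        nhdsWithin_le_nhds (Iic_mem_nhds one_pos)
      obtain ⟨ε, h2, h3, h4⟩ := (h0.and (h1.and self_mem_nhdsWithin)).exists
      exact ⟨ε, h4, h3, h2⟩
    have hφa : ‖φ a‖ = 1 := by rw [NonUnitalStarAlgHom.norm_map φ hφ, han]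
    obtain ⟨c, g, hg0, hg1, hc, hw, -, -, hn⟩ := hL 1 (fun _ => z) ε (φ a) a hε
      (map_nonneg_hom φ ha) hφa ha ha0
    obtain ⟨w, hw⟩ := hw 0
    have hc0 := hc 0
    have hgs := hg0.isSelfAdjoint.star_eq
    have has := ha.isSelfAdjoint.star_eq
    rw [← map_compr, NonUnitalStarAlgHom.norm_map φ hφ] at hn
    have hgg : g * g ≤ g := by
      have hs := CFC.sqrt_mul_sqrt_self g hg0
      have hss : star (CFC.sqrt g) = CFC.sqrt g := (CFC.sqrt_nonneg g).isSelfAdjoint.star_eq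
      have := CStarAlgebra.star_left_conjugate_le_norm_smul (a := CFC.sqrt g) (b := g)
        hg0.isSelfAdjoint
      rw [hss, hs] at this
      have e : CFC.sqrt g * g * CFC.sqrt g = g * g := by
        calc CFC.sqrt g * g * CFC.sqrt g
            = CFC.sqrt g * (CFC.sqrt g * CFC.sqrt g) * CFC.sqrt g := by rw [hs]
          _ = (CFC.sqrt g * CFC.sqrt g) * (CFC.sqrt g * CFC.sqrt g) := by simp only [mul_assoc]
          _ = g * g := by rw [hs]
      rw [e] at this
      refine this.trans ?_
      conv_rhs => rw [← one_smul ℝ g]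
      exact smul_le_smul_of_nonneg_right hg1 hg0
    -- As `2 g - g ^ 2 = 1 - (1 - g) ^ 2`, the element `a (1 - g) ^ 2 a` is `(1 - μ) a`. Its norm
    -- equals that of `(1 - g) a (1 - g)`, which exceeds `1 - ε`, so `μ` is less than `ε`.
    obtain ⟨μ, hμ⟩ := hmin (g + g - g * g)
    have hconj : ∀ u v : B, u ≤ v → a * u * a ≤ a * v * a := fun u v huv => by
      have := star_left_conjugate_le_conjugate huv a
      rwa [has] at this
    have hg2 : g ≤ g + g - g * g := by
      rw [add_sub_assoc]; exact le_add_of_nonneg_right (sub_nonneg.2 hgg)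
    have hμ0 : 0 ≤ μ • a := by
      rw [← hμ]
      have := hconj 0 _ (hg0.trans hg2)
      rwa [mul_zero, zero_mul] at this
    obtain ⟨r, hr, hra, hμr⟩ := exists_real_of_smul_nonneg ha ha0 hμ0
    rw [hra] at hμ
    have e1 : star (a - a * g) * (a - a * g) = compr g a := by
      rw [star_sub, star_mul, has, hgs]
      have : (a - g * a) * (a - a * g) = a * a - g * (a * a) - (a * a) * g + g * (a * a) * g := by
        noncomm_ring
      rw [this, haa]; rfl
    have e2 : (a - a * g) * star (a - a * g) = (1 - r) • a := by
      have : (a - a * g) * (a - g * a) = a * a - a * (g + g - g * g) * a := by noncomm_ring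
      rw [star_sub, star_mul, has, hgs, this, haa, hμ, sub_smul, one_smul]
    have e3 : |1 - r| = ‖compr g a‖ := by
      rw [← e1, CStarRing.norm_star_mul_self, ← CStarRing.norm_self_mul_star, e2, norm_smul, han,
        mul_one, Real.norm_eq_abs]
    have hr1 : 0 ≤ 1 - r := by
      have h0 := mul_star_self_nonneg (a - a * g)
      rw [e2, ← Complex.coe_smul] at h0
      obtain ⟨q, hq, -, hqr⟩ := exists_real_of_smul_nonneg ha ha0 h0
      rw [Complex.ofReal_inj.1 hqr]; exact hq
    rw [← e3, abs_of_nonneg hr1] at hn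
    -- From `g ^ 2 ≤ 2 g - g ^ 2` follows `‖a g‖ ^ 2 = ‖a g ^ 2 a‖ ≤ r < ε`.
    have hag : ‖a * g‖ ≤ Real.sqrt ε := by
      refine Real.le_sqrt_of_sq_le ?_
      have h1 : ‖a * g‖ ^ 2 = ‖a * (g * g) * a‖ := by
        rw [sq, ← CStarRing.norm_self_mul_star, star_mul, has, hgs]; simp only [mul_assoc]
      have h2 : ‖a * (g * g) * a‖ ≤ ‖a * (g + g - g * g) * a‖ := by
        refine CStarAlgebra.norm_le_norm_of_nonneg_of_le ?_ (hconj _ _ (hgg.trans hg2))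
        have := mul_star_self_nonneg (a * g)
        rw [star_mul, has, hgs] at this
        simpa only [mul_assoc] using this
      rw [hμ, norm_smul, han, mul_one, Real.norm_eq_abs, abs_of_nonneg hr] at h2
      linarith
    obtain ⟨k, hk⟩ := hmin w
    refine ⟨k • φ a, Submodule.smul_mem _ _ (Submodule.mem_span_singleton_self _), ?_⟩
    rw [dist_eq_norm]
    have e4 : φ a * z * φ a - k • φ a = φ a * (z - c 0) * φ a + φ (a * g) * c 0 * φ a := by
      rw [← map_smul, ← hk, map_mul, map_mul, ← hw, map_mul]; noncomm_ring
    rw [e4]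
    have hφag : ‖φ (a * g)‖ ≤ Real.sqrt ε := by rwa [NonUnitalStarAlgHom.norm_map φ hφ]
    have h1 : ‖φ a * (z - c 0) * φ a‖ ≤ ε := by
      refine (norm_mul_le _ _).trans ?_
      rw [hφa, mul_one]
      refine (norm_mul_le _ _).trans ?_
      rw [hφa, one_mul, norm_sub_rev]
      exact hc0.le
    have h2 : ‖c 0‖ ≤ ‖z‖ + 1 := by
      have := norm_le_norm_add_norm_sub' (c 0) z
      linarith
    have h3 : ‖φ (a * g) * c 0 * φ a‖ ≤ Real.sqrt ε * (‖z‖ + 1) := by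
      refine (norm_mul_le _ _).trans ?_
      rw [hφa, mul_one]
      refine (norm_mul_le _ _).trans ?_
      gcongr
    exact (norm_add_le _ _).trans_lt ((add_le_add h1 h3).trans_lt hεη)
  obtain ⟨k, hk⟩ := Submodule.mem_span_singleton.1 hmem
  exact hz k hk.symm

end SimpleAlgebras

/-! ### From the subalgebra to its inclusion homomorphism. -/

section Subalgebras

attribute [local instance] CStarAlgebra.spectralOrder CStarAlgebra.spectralOrderedRing

/-- The inclusion of a large subalgebra is large. -/
lemma IsLarge.isLargeHom {A : Type*} [CStarAlgebra A] {B : StarSubalgebra ℂ A}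
    [hBclosed : IsClosed (B : Set A)] (hB : IsLarge B) :
    IsLargeHom B.subtype.toNonUnitalStarAlgHom := by
  set φ : B →⋆ₙₐ[ℂ] A := B.subtype.toNonUnitalStarAlgHom
  have hφ : Function.Injective φ := Subtype.val_injective
  have hφv : ∀ b, φ b = (b : A) := fun _ => rfl
  intro n a ε x y hε hx hx1 hy hy0
  obtain ⟨c, g, hg0, hg1, hc, hw, hgy, hgx, hn⟩ := hB n a ε x y hε hx hx1 (map_nonneg_hom φ hy) hy0
  refine ⟨c, g, nonneg_of_map_nonneg φ hφ hg0, ?_, hc, fun j => ⟨⟨_, hw j⟩, ?_⟩, hgy, hgx, ?_⟩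
  · rw [← NonUnitalStarAlgHom.norm_map φ hφ]
    exact (CStarAlgebra.norm_le_one_iff_of_nonneg _ hg0).2 hg1
  · rw [hφv, hφv]; simp only [sub_mul, one_mul]
  · have : compr (φ g) x = (1 - (g : A)) * x * (1 - (g : A)) := by
      rw [hφv]; unfold compr; noncomm_ring
    rwa [this]

end Subalgebras

end CuntzSemigroup

end

theorem mainTheorem8 {A : Type*} [CStarAlgebra A]
    (hsimple : CuntzSemigroup.IsSimple A) (hinf : ¬ FiniteDimensional ℂ A)
    (hfin : CuntzSemigroup.IsStablyFinite A)
    (B : StarSubalgebra ℂ A) [hBclosed : IsClosed (B : Set A)]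
    (hB : CuntzSemigroup.IsLarge B) (m : ℕ) :
    (CuntzSemigroup.AlmostDivisible B m → CuntzSemigroup.AlmostDivisible A (2 * m + 1)) ∧
      (CuntzSemigroup.AlmostDivisible A m → CuntzSemigroup.AlmostDivisible B (4 * m + 3)) := by
  have := hsimple.1
  have hL := hB.isLargeHom
  have hφ : Function.Injective B.subtype.toNonUnitalStarAlgHom := Subtype.val_injective
  have hpA := hsimple.isPrimeAlg
  have hmA := hsimple.noMinimal hinf
  have hpB := hL.isPrimeAlg hφ hpA
  have hmB := hL.noMinimal hφ hmA
  exact ⟨fun h => CuntzSemigroup.AlmostDivisible.of_large hL hpA hmA hpB hmB hφ h,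
    fun h => CuntzSemigroup.AlmostDivisible.of_large_sub hL hpA hmA hpB hmB hφ h⟩
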